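/- **Setting.** Let $d\in\{2,3\}$, let $\Omega\subset\mathbb R^d$ be a bounded domain (open, connected, non-empty) with Lipschitz boundary, $\partial\Omega=\Gamma_1\cup\Gamma_2$ with $\Gamma_1\cap\Gamma_2=\emptyset$ ($\Gamma_1,\Gamma_2$ measurable), $T>0$, $0<S_\epsilon<\tfrac12$. Let $\mathcal K(x)$ be a measurable symmetric tensor field on $\Omega$ with $K_{\min}|a|^2\le \mathcal K(x)a\cdot a\le K_{\max}|a|^2$ for all $a\in\mathbb R^d$ and almost every $x$, with constants $K_{\min},K_{\max}>0$. Values on $\partial\Omega$ of $H^1(\Omega)$-functions are traces, $(f,g)=\int_\Omega fg\,dx$, and $\langle f,g\rangle_{\Gamma_2}=\int_{\Gamma_2}fg\,ds$ with the surface measure $ds$. Assume: 1. $\phi\in L^\infty(\Omega)$ and $\phi\ge\phi_m>0$ with a constant $\phi_m$. The functions $q_w,q_n,k_{rw},k_{rn}$ of the saturation are continuous on $[0,1]$, $k_{rw}(0)=0$, $k_{rw}(s)>0$ for $s>0$, $k_{rn}(1)=0$, $k_{rn}(s)>0$ for $s<1$. Put $\lambda_\alpha=k_{r\alpha}/\eta_\alpha$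 with constants $\eta_\alpha>0$ ($\alpha=w,n$), $\lambda_t=\lambda_w+\lambda_n$, $q_t=q_w+q_n$. 2. The parameters $\gamma_w,\gamma_n,\gamma_{wn}$ are given, positive, measurable and essentially bounded on $\Omega$ and on $\Gamma_2$, and for some constant $c_{\min}>0$ they satisfy $\frac{\gamma_w}{s}+\frac{\gamma_n}{1-s}-2\gamma_{wn}\ge c_{\min}$ for all $s\in(0,1)$, almost everywhere on $\Omega$ and on $\Gamma_2$. Thus $s\mapsto\mu_w(s)=\gamma_w\ln s-\gamma_n\ln(1-s)+\gamma_{wn}(1-2s)$ is, at almost every point, an increasing bijection of $(0,1)$ onto $\mathbb R$; its inverse is denoted by $\mathcal S$. 3. $\varphi_1\in H^1(0,T;H^{-1}(\Omega))\cap L^2(0,T;H^1(\Omega))\cap W^{1,1}(0,T;L^1(\Omega))$, where $H^{-1}(\Omega)$ is the dual of $H^1(\Omega)$, and $\varphi_3\in L^2(0,T;H^1(\Omega))$. The functions $\varphi_2,\varphi_4$ of the saturation are continuous on $[0,1]$; put $\varphi_{2,4}=\varphi_2+\varphi_4$. 4. At $s=S_\epsilon$: $\lambda_nq_w-\lambda_wq_n\ge0$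 and $\lambda_n\varphi_4-\lambda_w\varphi_2\ge0$. At $s=1-S_\epsilon$: $\lambda_nq_w-\lambda_wq_n\le0$ and $\lambda_n\varphi_4-\lambda_w\varphi_2\le0$. In the scheme below, each $f\in\{\lambda_w,\lambda_n,\lambda_t,q_w,q_n,q_t,\varphi_2,\varphi_4,\varphi_{2,4}\}$ is replaced by its truncation, equal to $f$ on $[S_\epsilon,1-S_\epsilon]$, to $f(S_\epsilon)$ for $s\le S_\epsilon$ and to $f(1-S_\epsilon)$ for $s\ge1-S_\epsilon$. 5. (Solvability of the pure Neumann problem.) If $\Gamma_1$ has surface measure zero, then $\int_\Omega q_t(s)\,dx+\int_{\Gamma_2}\varphi_{2,4}(s)\,ds=0$ for the two constants $s=S_\epsilon$ and $s=1-S_\epsilon$. Let $W=\{v\in H^1(\Omega): v|_{\Gamma_1}=0\}$ and $V=\{v\in W: \int_\Omega v\,dx=0 \text{ if }\Gamma_1\text{ has measure zero}\}$. **Theorem.** Let $N,k$ be integers with $0\le k\le N-1$, $\tau=T/N$, and let $S_w^k$ be measurable with $S_\epsilon\le S_w^k\le1-S_\epsilon$ almost everywhere in $\Omega$. Let $W_m\subset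 W\cap L^\infty(\Omega)$ and $V_m\subset V\cap L^\infty(\Omega)$ be the spans of linearly independent families $\{\xi_i\}_{i=1}^m$ and $\{v_i\}_{i=1}^m$. For $\alpha=1,3$ put $\varphi_\alpha^{k+1}=\frac1\tau\int_{k\tau}^{(k+1)\tau}\varphi_\alpha\,dt\in H^1(\Omega)$. Then there exists $(S,\mu,p)$ with $$\mu\in\varphi_1^{k+1}+W_m,\qquad p\in\varphi_3^{k+1}+V_m,\qquad S=\mathcal S(\mu)\ \text{a.e. in }\Omega,$$ such that for all $v\in V_m$ $$(\lambda_t(S)\mathcal K\nabla p,\nabla v)=-(\lambda_w(S)\mathcal K\nabla\mu,\nabla v)+(q_t(S),v)+\langle\varphi_{2,4}(S),v\rangle_{\Gamma_2},$$ and for all $\xi\in W_m$ $$\Big(\phi\,\frac{S-S_w^k}{\tau},\xi\Big)+(\lambda_w(S)\mathcal K\nabla\mu,\nabla\xi)=-(\lambda_w(S)\mathcal K\nabla p,\nabla\xi)+(q_w(S),\xi)+\langle\varphi_4(S),\xi\rangle_{\Gamma_2},$$ where on $\Gamma_2$ the saturation is $S=\mathcal S(\mu|_{\Gamma_2})$.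 -/

import Mathlib

open MeasureTheory Set Filter Topology
open scoped ENNReal ContDiff

noncomputable section

namespace TwoPhase

/-- The Euclidean space `ℝ^d`. -/
abbrev E (d : ℕ) : Type := EuclideanSpace ℝ (Fin d)

/-- Lebesgue measure on `Ω`. -/
abbrev vol {d : ℕ} (Ω : Set (E d)) : Measure (E d) := volume.restrict Ω

/-- The `(d-1)`-dimensional surface measure (the Hausdorff measure, normalised so that it is
Lebesgue measure on hyperplanes), restricted to the set `Γ`. -/
abbrev surf {d : ℕ} (Γ : Set (E d)) : Measure (E d) :=
  (Measure.euclideanHausdorffMeasure (d - 1) : Measure (E d)).restrict Γ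

/-- `Ω` has a Lipschitz boundary: near each boundary point, `Ω` is the set of points lying strictly
above the graph of a Lipschitz function, in the direction of some unit vector `e`. The height
function is only evaluated at the component orthogonal to `e`. -/
def HasLipschitzBoundary {d : ℕ} (Ω : Set (E d)) : Prop :=
  ∀ x ∈ frontier Ω, ∃ (e : E d) (h : E d → ℝ) (L : NNReal) (r : ℝ),
    ‖e‖ = 1 ∧ LipschitzWith L h ∧ 0 < r ∧
    ∀ y ∈ Metric.ball x r, y ∈ Ω ↔ h (y - inner ℝ e y • e) < inner ℝ e y

/-! ### The Sobolev space `H¹(Ω)` -/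

/-- `g` is the weak gradient of `u` on `Ω`, for `u`, `g` square integrable on `Ω`. -/
def HasWeakGradient {d : ℕ} (Ω : Set (E d)) (u : E d → ℝ) (g : E d → E d) : Prop :=
  ∀ ψ : E d → ℝ, ContDiff ℝ ∞ ψ → HasCompactSupport ψ → tsupport ψ ⊆ Ω → ∀ e : E d,
    ∫ x in Ω, u x * fderiv ℝ ψ x e = - ∫ x in Ω, inner ℝ (g x) e * ψ x

/-- The Hilbert space `L²(Ω) × L²(Ω; ℝ^d)`. -/
abbrev L2Pair {d : ℕ} (Ω : Set (E d)) : Type :=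
  WithLp 2 (Lp ℝ 2 (vol Ω) × Lp (E d) 2 (vol Ω))

theorem memLp_test {d : ℕ} (Ω : Set (E d)) {ψ : E d → ℝ} (h1 : ContDiff ℝ ∞ ψ)
    (h2 : HasCompactSupport ψ) (e : E d) :
    MemLp (fun x => fderiv ℝ ψ x e) 2 (vol Ω) ∧ MemLp (fun x => ψ x • e) 2 (vol Ω) := by
  constructor
  · have hc : Continuous (fun x => fderiv ℝ ψ x e) :=
      (h1.continuous_fderiv (by simp)).clm_apply continuous_const
    exact (hc.memLp_of_hasCompactSupport (h2.fderiv_apply ℝ e)).restrict Ω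
  · have hc : Continuous (fun x => ψ x • e) := h1.continuous.smul continuous_const
    exact (hc.memLp_of_hasCompactSupport h2.smul_right).restrict Ω

/-- The weak gradient relation, tested against one test function, as an equation between inner
products of `L²`. -/
theorem test_iff {d : ℕ} (Ω : Set (E d)) {ψ : E d → ℝ} (h1 : ContDiff ℝ ∞ ψ)
    (h2 : HasCompactSupport ψ) (e : E d) (w : L2Pair Ω) :
    (∫ x in Ω, w.fst x * fderiv ℝ ψ x e = - ∫ x in Ω, inner ℝ (w.snd x) e * ψ x) ↔
      inner ℝ ((memLp_test Ω h1 h2 e).1.toLp _) w.fst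
        + inner ℝ ((memLp_test Ω h1 h2 e).2.toLp _) w.snd = 0 := by
  have a1 : inner ℝ ((memLp_test Ω h1 h2 e).1.toLp _) w.fst
      = ∫ x in Ω, w.fst x * fderiv ℝ ψ x e := by
    rw [L2.inner_def]
    refine integral_congr_ae ?_
    filter_upwards [(memLp_test Ω h1 h2 e).1.coeFn_toLp] with x hx
    rw [hx]; simp
  have a2 : inner ℝ ((memLp_test Ω h1 h2 e).2.toLp _) w.snd
      = ∫ x in Ω, inner ℝ (w.snd x) e * ψ x := by
    rw [L2.inner_def]
    refine integral_congr_ae ?_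
    filter_upwards [(memLp_test Ω h1 h2 e).2.coeFn_toLp] with x hx
    rw [hx, real_inner_comm, inner_smul_right, mul_comm]
  rw [a1, a2]
  constructor <;> intro h <;> linarith

/-- `H¹(Ω)`: the pairs `(u, ∇u)` of a function `u ∈ L²(Ω)` and its weak gradient
`∇u ∈ L²(Ω; ℝ^d)`, with the norm `(‖u‖² + ‖∇u‖²)^(1/2)`. -/
def H1 {d : ℕ} (Ω : Set (E d)) : Submodule ℝ (L2Pair Ω) where
  carrier := {w | HasWeakGradient Ω w.fst w.snd}
  zero_mem' := by
    intro ψ h1 h2 _ e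
    rw [test_iff Ω h1 h2 e 0]; simp
  add_mem' := by
    intro a b ha hb ψ h1 h2 h3 e
    have ha' := (test_iff Ω h1 h2 e a).1 (ha ψ h1 h2 h3 e)
    have hb' := (test_iff Ω h1 h2 e b).1 (hb ψ h1 h2 h3 e)
    rw [test_iff Ω h1 h2 e (a + b), WithLp.add_fst, WithLp.add_snd, inner_add_right,
      inner_add_right]
    linarith
  smul_mem' := by
    intro c a ha ψ h1 h2 h3 e
    have ha' := (test_iff Ω h1 h2 e a).1 (ha ψ h1 h2 h3 e)
    rw [test_iff Ω h1 h2 e (c • a), WithLp.smul_fst, WithLp.smul_snd, inner_smul_right,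
      inner_smul_right, ← mul_add, ha', mul_zero]

theorem isClosed_H1 {d : ℕ} (Ω : Set (E d)) : IsClosed (H1 Ω : Set (L2Pair Ω)) := by
  have : (H1 Ω : Set (L2Pair Ω)) = ⋂ (ψ : E d → ℝ) (h1 : ContDiff ℝ ∞ ψ)
      (h2 : HasCompactSupport ψ) (_ : tsupport ψ ⊆ Ω) (e : E d),
      {w : L2Pair Ω | inner ℝ ((memLp_test Ω h1 h2 e).1.toLp _) w.fst
        + inner ℝ ((memLp_test Ω h1 h2 e).2.toLp _) w.snd = 0} := by
    ext w
    simp only [mem_iInter, mem_ofPred_eq]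
    constructor
    · intro h ψ h1 h2 h3 e
      exact (test_iff Ω h1 h2 e w).1 (h ψ h1 h2 h3 e)
    · intro h ψ h1 h2 h3 e
      exact (test_iff Ω h1 h2 e w).2 (h ψ h1 h2 h3 e)
  rw [this]
  refine isClosed_iInter fun ψ => isClosed_iInter fun h1 => isClosed_iInter fun h2 =>
    isClosed_iInter fun _ => isClosed_iInter fun e => isClosed_eq ?_ continuous_const
  exact (continuous_const.inner ((WithLp.prod_continuous_ofLp 2 _ _).fst)).add
    (continuous_const.inner ((WithLp.prod_continuous_ofLp 2 _ _).snd))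

/-- `H¹(Ω)` is complete, so that Bochner integrals of `H¹(Ω)`-valued functions are meaningful. -/
instance {d : ℕ} (Ω : Set (E d)) : CompleteSpace (H1 Ω) :=
  (isClosed_H1 Ω).completeSpace_coe

/-- The underlying function of an element of `H¹(Ω)`, as a continuous linear map into `L²(Ω)`. -/
def H1.val {d : ℕ} {Ω : Set (E d)} : H1 Ω →L[ℝ] Lp ℝ 2 (vol Ω) :=
  (WithLp.fstL 2 ℝ (Lp ℝ 2 (vol Ω)) (Lp (E d) 2 (vol Ω))).comp (H1 Ω).subtypeL

/-- The weak gradient of an element of `H¹(Ω)`. -/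
def H1.grad {d : ℕ} {Ω : Set (E d)} : H1 Ω →L[ℝ] Lp (E d) 2 (vol Ω) :=
  (WithLp.sndL 2 ℝ (Lp ℝ 2 (vol Ω)) (Lp (E d) 2 (vol Ω))).comp (H1 Ω).subtypeL

/-! ### The trace on `∂Ω` -/

/-- `R : H¹(Ω) → L²(∂Ω)` is continuous, linear, and is the restriction to the boundary for
functions that are smooth up to the boundary. -/
def IsTraceOperator {d : ℕ} (Ω : Set (E d)) (R : H1 Ω →L[ℝ] Lp ℝ 2 (surf (frontier Ω))) : Prop :=
  ∀ w : E d → ℝ, ContDiff ℝ ∞ w → ∀ u : H1 Ω, H1.val u =ᵐ[vol Ω] w →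
    R u =ᵐ[surf (frontier Ω)] w

open scoped Classical in
/-- The trace operator `H¹(Ω) → L²(∂Ω)`. It exists and is unique for a bounded open set with
Lipschitz boundary; the value `0` is used only where there is no such operator. -/
def trace {d : ℕ} (Ω : Set (E d)) : H1 Ω →L[ℝ] Lp ℝ 2 (surf (frontier Ω)) :=
  if h : ∃ R, IsTraceOperator Ω R then h.choose else 0

/-! ### Functions of time with values in a Banach space -/

/-- `u ∈ W^{1,p}(0,T;X)`: `u` and its weak time derivative are in `L^p(0,T;X)`. -/
def MemW1p {X : Type*} [NormedAddCommGroup X] [NormedSpace ℝ X] (p : ℝ≥0∞) (T : ℝ)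
    (u : ℝ → X) : Prop :=
  MemLp u p (volume.restrict (Ioo 0 T)) ∧
  ∃ u' : ℝ → X, MemLp u' p (volume.restrict (Ioo 0 T)) ∧
    ∀ ψ : ℝ → ℝ, ContDiff ℝ ∞ ψ → HasCompactSupport ψ → tsupport ψ ⊆ Ioo 0 T →
      ∫ t in Ioo 0 T, deriv ψ t • u t = - ∫ t in Ioo 0 T, ψ t • u' t

/-- The embedding of `H¹(Ω)` into the dual space of `H¹(Ω)`, `u ↦ (v ↦ ∫_Ω u v)`. -/
def toDual {d : ℕ} {Ω : Set (E d)} (u : H1 Ω) : H1 Ω →L[ℝ] ℝ :=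
  (innerSL ℝ (H1.val u)).comp H1.val

/-! ### The model -/

/-- The data of the two-phase flow model. -/
structure Model (d : ℕ) where
  /-- the porous medium -/
  Ω : Set (E d)
  /-- the Dirichlet part of the boundary -/
  Γ₁ : Set (E d)
  /-- the Neumann part of the boundary -/
  Γ₂ : Set (E d)
  /-- the final time -/
  T : ℝ
  /-- the porosity -/
  poro : E d → ℝ
  /-- the absolute permeability tensor -/
  K : E d → (E d →L[ℝ] E d)
  /-- the relative permeability of the wetting phase, as a function of the saturation `S_w` -/
  krw : ℝ → ℝ
  /-- the relative permeability of the non-wetting phase, as a function of `S_w` -/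
  krn : ℝ → ℝ
  /-- the viscosity of the wetting phase -/
  ηw : ℝ
  /-- the viscosity of the non-wetting phase -/
  ηn : ℝ
  /-- the volumetric flow rate of the wetting phase, as a function of `S_w` -/
  qw : ℝ → ℝ
  /-- the volumetric flow rate of the non-wetting phase, as a function of `S_w` -/
  qn : ℝ → ℝ
  /-- the energy parameters, given on `Ω` and on `Γ₂` -/
  γw : E d → ℝ
  γn : E d → ℝ
  γwn : E d → ℝ
  /-- the Dirichlet datum for the chemical potential, extended to `Ω`, as a function of time -/
  φ₁ : ℝ → H1 Ω
  /-- the Neumann datum of the non-wetting phase, as a function of `S_w` -/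
  φ₂ : ℝ → ℝ
  /-- the Dirichlet datum for the pressure, extended to `Ω`, as a function of time -/
  φ₃ : ℝ → H1 Ω
  /-- the Neumann datum of the wetting phase, as a function of `S_w` -/
  φ₄ : ℝ → ℝ
  /-- the residual saturation level -/
  Sε : ℝ

namespace Model

variable {d : ℕ} (D : Model d)

/-- The phase mobilities and the total mobility, the total flow rate and the total boundary flux. -/
def lamw (s : ℝ) : ℝ := D.krw s / D.ηw
def lamn (s : ℝ) : ℝ := D.krn s / D.ηn
def lamt (s : ℝ) : ℝ := D.lamw s + D.lamn s
def qt (s : ℝ) : ℝ := D.qw s + D.qn s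
def φ₂₄ (s : ℝ) : ℝ := D.φ₄ s + D.φ₂ s

/-- The extension of the saturation functions by their values at `Sε` and `1 - Sε`:
`trunc f s = f Sε` for `s ≤ Sε`, and `trunc f s = f (1 - Sε)` for `s ≥ 1 - Sε`. -/
def trunc (f : ℝ → ℝ) (s : ℝ) : ℝ := f (max D.Sε (min s (1 - D.Sε)))

/-- The chemical potential at `x` as a function of the saturation `s ∈ (0,1)`. -/
def chemPot (x : E d) (s : ℝ) : ℝ :=
  D.γw x * Real.log s - D.γn x * Real.log (1 - s) + D.γwn x * (1 - 2 * s)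

/-- The solution operator: the saturation `s ∈ (0,1)` with `chemPot x s = μ`. -/
def satOp (x : E d) (μ : ℝ) : ℝ := Function.invFunOn (D.chemPot x) (Ioo 0 1) μ

/-- The domain and its boundary parts, the final time, the permeability, the viscosities and the
residual saturation. -/
structure Standing : Prop where
  isOpen : IsOpen D.Ω
  isBounded : Bornology.IsBounded D.Ω
  isConnected : IsConnected D.Ω
  lipschitz : HasLipschitzBoundary D.Ω
  union_eq : D.Γ₁ ∪ D.Γ₂ = frontier D.Ω
  inter_eq : D.Γ₁ ∩ D.Γ₂ = ∅
  meas₁ : MeasurableSet D.Γ₁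
  meas₂ : MeasurableSet D.Γ₂
  T_pos : 0 < D.T
  K_meas : AEStronglyMeasurable D.K (vol D.Ω)
  K_symm : ∀ᵐ x ∂(vol D.Ω), ∀ a b : E d, inner ℝ (D.K x a) b = inner ℝ a (D.K x b)
  K_bound : ∃ Kmin Kmax : ℝ, 0 < Kmin ∧ 0 < Kmax ∧ ∀ᵐ x ∂(vol D.Ω), ∀ a : E d,
    Kmin * inner ℝ a a ≤ inner ℝ (D.K x a) a ∧ inner ℝ (D.K x a) a ≤ Kmax * inner ℝ a a
  ηw_pos : 0 < D.ηw
  ηn_pos : 0 < D.ηn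
  Sε_pos : 0 < D.Sε
  Sε_lt : D.Sε < 1 / 2

/-- The assumptions on the porosity, the flow rates and the relative permeabilities. -/
structure FlowAssumption : Prop where
  poro_memLp : MemLp D.poro ∞ (vol D.Ω)
  poro_pos : ∃ φm : ℝ, 0 < φm ∧ ∀ᵐ x ∂(vol D.Ω), φm ≤ D.poro x
  qw_cont : ContinuousOn D.qw (Icc 0 1)
  qn_cont : ContinuousOn D.qn (Icc 0 1)
  krw_cont : ContinuousOn D.krw (Icc 0 1)
  krn_cont : ContinuousOn D.krn (Icc 0 1)
  krw_zero : D.krw 0 = 0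
  krw_pos : ∀ s ∈ Ioc (0 : ℝ) 1, 0 < D.krw s
  krn_one : D.krn 1 = 0
  krn_pos : ∀ s ∈ Ico (0 : ℝ) 1, 0 < D.krn s

/-- The assumptions on the energy parameters, with respect to a measure `ν`. -/
structure EnergyAssumptionOn (cmin : ℝ) (ν : Measure (E d)) : Prop where
  γw_memLp : MemLp D.γw ∞ ν
  γn_memLp : MemLp D.γn ∞ ν
  γwn_memLp : MemLp D.γwn ∞ ν
  pos : ∀ᵐ x ∂ν, 0 < D.γw x ∧ 0 < D.γn x ∧ 0 < D.γwn x
  convex : ∀ᵐ x ∂ν, ∀ s ∈ Ioo (0 : ℝ) 1, cmin ≤ D.γw x / s + D.γn x / (1 - s) - 2 * D.γwn x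

/-- The assumptions on the energy parameters hold almost everywhere in `Ω` and on `Γ₂`. (The
Neumann data depend on the saturation on `Γ₂`, and hence on the parameters there.) -/
def EnergyAssumption : Prop :=
  ∃ cmin : ℝ, 0 < cmin ∧ D.EnergyAssumptionOn cmin (vol D.Ω) ∧
    D.EnergyAssumptionOn cmin (surf D.Γ₂)

/-- The assumptions on the boundary data. -/
structure BoundaryAssumption : Prop where
  /-- `φ₁ ∈ L²(0,T;H¹(Ω))` -/
  φ₁_memLp : MemLp D.φ₁ 2 (volume.restrict (Ioo 0 D.T))
  /-- `φ₁ ∈ H¹(0,T;H⁻¹(Ω))` -/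
  φ₁_dual : MemW1p 2 D.T (fun t => toDual (D.φ₁ t))
  /-- `φ₁ ∈ W^{1,1}(0,T;L¹(Ω))` -/
  φ₁_L1 : ∃ Φ : ℝ → Lp ℝ 1 (vol D.Ω),
    (∀ t, Φ t =ᵐ[vol D.Ω] H1.val (D.φ₁ t)) ∧ MemW1p 1 D.T Φ
  /-- `φ₃ ∈ L²(0,T;H¹(Ω))` -/
  φ₃_memLp : MemLp D.φ₃ 2 (volume.restrict (Ioo 0 D.T))
  φ₂_cont : ContinuousOn D.φ₂ (Icc 0 1)
  φ₄_cont : ContinuousOn D.φ₄ (Icc 0 1)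

/-- The sign conditions at the residual saturations. -/
structure ResidualAssumption : Prop where
  q_left : 0 ≤ D.lamn D.Sε * D.qw D.Sε - D.lamw D.Sε * D.qn D.Sε
  φ_left : 0 ≤ D.lamn D.Sε * D.φ₄ D.Sε - D.lamw D.Sε * D.φ₂ D.Sε
  q_right : D.lamn (1 - D.Sε) * D.qw (1 - D.Sε) - D.lamw (1 - D.Sε) * D.qn (1 - D.Sε) ≤ 0
  φ_right : D.lamn (1 - D.Sε) * D.φ₄ (1 - D.Sε) - D.lamw (1 - D.Sε) * D.φ₂ (1 - D.Sε) ≤ 0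

/-- The solvability condition of the pure Neumann problem: if there is no Dirichlet boundary, the
total source and the total boundary flux balance at the two residual saturations. -/
def Compatible : Prop :=
  surf D.Γ₁ univ = 0 → ∀ s ∈ ({D.Sε, 1 - D.Sε} : Set ℝ),
    (∫ _ in D.Ω, D.qt s) + (∫ _, D.φ₂₄ s ∂(surf D.Γ₂)) = 0

/-- `W`: the functions of `H¹(Ω)` whose trace vanishes on `Γ₁`. -/
def W : Set (H1 D.Ω) := {v | trace D.Ω v =ᵐ[surf D.Γ₁] 0}

/-- `V`: the functions of `W`, with mean zero if `Γ₁` has measure zero. -/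
def V : Set (H1 D.Ω) :=
  {v | trace D.Ω v =ᵐ[surf D.Γ₁] 0 ∧ (surf D.Γ₁ univ = 0 → ∫ x in D.Ω, H1.val v x = 0)}

/-- The functions of `H¹(Ω)` in `L^∞(Ω)`. -/
def Bdd : Set (H1 D.Ω) := {v | MemLp (H1.val v) ∞ (vol D.Ω)}

/-- The time step size for `N` steps. -/
def τ (N : ℕ) : ℝ := D.T / N

/-- The mean value of `φ` over the time interval `(kτ, (k+1)τ]`. -/
def avg (N k : ℕ) (φ : ℝ → H1 D.Ω) : H1 D.Ω :=
  (1 / D.τ N) • ∫ t in Ioc (k * D.τ N) ((k + 1) * D.τ N), φ t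

/-- `(f 𝒦∇u, ∇v)` for a scalar function `f` on `Ω`. -/
def diffForm (f : E d → ℝ) (u v : H1 D.Ω) : ℝ :=
  ∫ x in D.Ω, f x * inner ℝ (D.K x (H1.grad u x)) (H1.grad v x)

/-- `(f, v)` for a scalar function `f` on `Ω`. -/
def pairing (f : E d → ℝ) (v : H1 D.Ω) : ℝ :=
  ∫ x in D.Ω, f x * H1.val v x

/-- `⟨f, v⟩` on `Γ₂` for a scalar function `f` on `Γ₂`. -/
def bdryPairing (f : E d → ℝ) (v : H1 D.Ω) : ℝ :=
  ∫ x, f x * trace D.Ω v x ∂(surf D.Γ₂)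

/-- The saturation on the boundary that belongs to the chemical potential `μ`. -/
def bdrySat (μ : H1 D.Ω) (x : E d) : ℝ := D.satOp x (trace D.Ω μ x)

/-- `(S, μ, p)` is a weak solution of the fully discrete scheme in the time step from `k` to
`k + 1` of `N` steps, with the saturation `Sk` at step `k` and with the spaces `W_m` and `V_m`
spanned by `ξ` and `v`. -/
structure IsDiscreteWeakSolution (N k : ℕ) (Sk : E d → ℝ) {m : ℕ} (ξ v : Fin m → H1 D.Ω)
    (S : E d → ℝ) (μ p : H1 D.Ω) : Prop where
  μ_mem : ∃ α : Fin m → ℝ, μ = D.avg N k D.φ₁ + ∑ i, α i • ξ i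
  p_mem : ∃ β : Fin m → ℝ, p = D.avg N k D.φ₃ + ∑ i, β i • v i
  sat_eq : ∀ᵐ x ∂(vol D.Ω), S x = D.satOp x (H1.val μ x)
  pressure_eq : ∀ z ∈ Submodule.span ℝ (range v),
    D.diffForm (fun x => D.trunc D.lamt (S x)) p z
      = - D.diffForm (fun x => D.trunc D.lamw (S x)) μ z
        + D.pairing (fun x => D.trunc D.qt (S x)) z
        + D.bdryPairing (fun x => D.trunc D.φ₂₄ (D.bdrySat μ x)) z
  saturation_eq : ∀ z ∈ Submodule.span ℝ (range ξ),
    D.pairing (fun x => D.poro x * ((S x - Sk x) / D.τ N)) z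
        + D.diffForm (fun x => D.trunc D.lamw (S x)) μ z
      = - D.diffForm (fun x => D.trunc D.lamw (S x)) p z
        + D.pairing (fun x => D.trunc D.qw (S x)) z
        + D.bdryPairing (fun x => D.trunc D.φ₄ (D.bdrySat μ x)) z

end Model

end TwoPhase

end

/-!
The unknowns are the increments `ζ = μ - φ₁ ∈ W_m` and `π = p - φ₃ ∈ V_m`. Adding the saturation
equation tested with `ζ'` to the pressure equation tested with `π'` gives one equation in the finite
dimensional space `W_m × V_m`; since `λ_t = λ_w + λ_n`, its diffusive part is
`(λ_w 𝒦∇(ζ+π), ∇(ζ'+π')) + (λ_n 𝒦∇π, ∇π')`, and everything else (`Model.loadForm`) depends on the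
unknowns only through the saturation, hence is bounded. By the acute angle form of Brouwer's theorem
(`exists_forall_eq_zero_of_apply_self_pos`), a solution exists if the residual tested with the
unknowns themselves is positive on some sphere.

On the sphere, the diffusive part is at least `kw ‖∇(ζ+π)‖² + kn ‖∇π‖²`, because the truncated
mobilities are bounded below (`exists_le_diffFunctional`). It beats the load form except near the
directions with `∇ζ = 0` and `∇π = 0`. There `π = 0` (by the definition of `V`) and `ζ` is a constant
`c ≠ 0`, which is possible only if `Γ₁` is a null set. Along a sequence going to infinity in such a
direction the chemical potential tends to `+∞` or `-∞` and the saturation to `1` or `0`; in the limit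
the load form is positive, because the increment `S - S_w^k` has the sign of `c`, and the sign
conditions at the residual saturations together with the compatibility condition fix the sign of
`∫ q_w + ∫ φ₄` (`loadForm_one_pos`, `loadForm_zero_pos`). A compactness argument
(`exists_pos_on_sphere`) turns this into positivity on a large sphere.

Three facts about the setting are needed on the way. Brouwer's theorem is proved by the
Milnor–Rogers volume argument: if the ball had a `C¹` retraction `g` onto its sphere, the integral of
the Jacobian of `x ↦ (1 - t) x + t g(x)` over the ball would be a polynomial in `t`, equal to the
volume of the ball for small `t`, while it vanishes at `t = 1`. The operator `trace` is a trace
operator and not `0`: integration along the line segments of a boundary chart that point into `Ω`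
bounds the boundary values of a smooth function by its `H¹` norm (`exists_trace_inequality`), so they
extend to the closure of the smooth functions by continuity; existence does not need density, since
`0` may be taken on the orthogonal complement (`isTraceOperator_trace`). A function of `H¹(Ω)` with
weak gradient `0` is constant on the connected set `Ω` (`exists_ae_eq_const_of_grad_eq_zero`), and
its trace is then the same constant.
-/

/-! ### Brouwer's theorem in the form of the acute angle lemma -/

section Brouwer

variable {X : Type*} [NormedAddCommGroup X] [InnerProductSpace ℝ X] [FiniteDimensional ℝ X]

/-- `det (1 + t A)` is a polynomial in `t` of degree at most `dim X`; it is recovered by Lagrange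
interpolation from its values at `dim X + 1` nodes. -/
theorem det_one_add_smul_eq_sum_lagrange (A : X →L[ℝ] X) (s : Finset ℝ)
    (hs : Module.finrank ℝ X < s.card) (t : ℝ) :
    (1 + t • A).det
      = ∑ r ∈ s, (Lagrange.basis s id r).eval t * (1 + r • A).det := by
  classical
  let b := Module.finBasis ℝ X
  let M := LinearMap.toMatrix b b (A : X →ₗ[ℝ] X)
  let p : Polynomial ℝ := Matrix.det ((Polynomial.X : Polynomial ℝ) • M.map Polynomial.C
    + (1 : Matrix _ _ ℝ).map Polynomial.C)
  have hp : ∀ r : ℝ, (1 + r • A).det = p.eval r := by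
    intro r
    have h1 : (1 + r • A).det = Matrix.det (LinearMap.toMatrix b b
        ((1 + r • A : X →L[ℝ] X) : X →ₗ[ℝ] X)) := by
      rw [LinearMap.det_toMatrix]
    rw [h1]
    have h2 : LinearMap.toMatrix b b ((1 + r • A : X →L[ℝ] X) : X →ₗ[ℝ] X) = 1 + r • M := by
      have : ((1 + r • A : X →L[ℝ] X) : X →ₗ[ℝ] X) = LinearMap.id + r • (A : X →ₗ[ℝ] X) := by
        ext x; simp
      rw [this, map_add, map_smul, LinearMap.toMatrix_id]
    rw [h2]
    change _ = Polynomial.evalRingHom r p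
    simp only [p, RingHom.map_det]
    congr 1
    ext i j
    simp only [Matrix.add_apply, Matrix.smul_apply, Matrix.one_apply, smul_eq_mul,
      RingHom.mapMatrix_apply, Matrix.map_apply, map_add, Polynomial.coe_evalRingHom,
      Polynomial.eval_C]
    rw [add_comm]
    split_ifs <;> simp <;> exact mul_comm _ _
  have hdeg : p.degree < s.card := by
    refine lt_of_le_of_lt Polynomial.degree_le_natDegree ?_
    have := Polynomial.natDegree_det_X_add_C_le M 1
    simp only [Fintype.card_fin] at this
    exact_mod_cast lt_of_le_of_lt this hs
  have h3 := Lagrange.eq_interpolate (f := p) (v := (id : ℝ → ℝ)) (s := s)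
    (Function.injective_id.injOn) hdeg
  rw [hp t]
  conv_lhs => rw [h3]
  rw [Lagrange.interpolate_apply, Polynomial.eval_finsetSum]
  refine Finset.sum_congr rfl fun r _ => ?_
  rw [Polynomial.eval_mul, Polynomial.eval_C, hp r, mul_comm]
  rfl

theorem det_one_add_pos {A : X →L[ℝ] X} (hA : ‖A‖ < 1) : 0 < (1 + A).det := by
  have hne : ∀ s ∈ Icc (0 : ℝ) 1, (1 + s • A).det ≠ 0 := by
    intro s hs hdet
    have hker : ∃ x : X, x ≠ 0 ∧ (1 + s • A) x = 0 := by
      have h := LinearMap.bot_lt_ker_of_det_eq_zero (f := ((1 + s • A : X →L[ℝ] X) : X →ₗ[ℝ] X)) hdet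
      obtain ⟨x, hx, hx0⟩ := Submodule.exists_mem_ne_zero_of_ne_bot h.ne'
      exact ⟨x, hx0, hx⟩
    obtain ⟨x, hx0, hx⟩ := hker
    have hx' : x = -(s • A x) := by
      have : x + s • A x = 0 := by simpa using hx
      exact eq_neg_of_add_eq_zero_left this
    have h1 : ‖x‖ ≤ ‖A‖ * ‖x‖ := by
      calc ‖x‖ = s * ‖A x‖ := by
            conv_lhs => rw [hx']
            rw [norm_neg, norm_smul, Real.norm_of_nonneg hs.1]
        _ ≤ 1 * ‖A x‖ := by gcongr; exact hs.2
        _ ≤ ‖A‖ * ‖x‖ := by rw [one_mul]; exact A.le_opNorm x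
    have h2 : 0 < ‖x‖ := norm_pos_iff.2 hx0
    nlinarith
  have hcont : Continuous fun s : ℝ => (1 + s • A).det :=
    ContinuousLinearMap.continuous_det.comp (by fun_prop)
  by_contra hneg
  have h0 : (1 + (0 : ℝ) • A).det = 1 := by simp [ContinuousLinearMap.det]
  have h1 : (1 + (1 : ℝ) • A).det ≤ 0 := by simpa using hneg
  obtain ⟨s, hs, hs0⟩ := intermediate_value_Icc' (zero_le_one (α := ℝ)) hcont.continuousOn
    (show (0 : ℝ) ∈ Icc _ _ from ⟨h1, by rw [h0]; exact zero_le_one⟩)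
  exact hne s hs hs0

omit [FiniteDimensional ℝ X] in
/-- A Lipschitz map on the unit ball that vanishes on the sphere stays Lipschitz when it is
extended by zero. -/
theorem LipschitzOnWith.indicator_closedBall {h : X → X} {K : NNReal}
    (hK : LipschitzOnWith K h (Metric.closedBall 0 1)) (h0 : ∀ x, ‖x‖ = 1 → h x = 0) :
    LipschitzWith K (indicator (Metric.closedBall 0 1) h) := by
  have key : ∀ x ∈ Metric.closedBall (0 : X) 1, ∀ y ∉ Metric.closedBall (0 : X) 1,
      dist (h x) 0 ≤ K * dist x y := by
    intro x hx y hy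
    rw [mem_closedBall_zero_iff] at hx hy
    have hc : ContinuousOn (fun s : ℝ => ‖AffineMap.lineMap x y s‖) (Icc 0 1) := by
      have : Continuous fun s : ℝ => (AffineMap.lineMap x y s : X) :=
        AffineMap.lineMap_continuous
      exact this.norm.continuousOn
    obtain ⟨s, hs, hs1⟩ := intermediate_value_Icc (zero_le_one (α := ℝ)) hc
      (show (1 : ℝ) ∈ Icc _ _ from ⟨by simpa using hx, by simpa using (not_le.1 hy).le⟩)
    have h2 := hK.dist_le_mul x (by simpa using hx) (AffineMap.lineMap x y s)
      (by simpa using (le_of_eq hs1))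
    rw [h0 _ hs1] at h2
    refine h2.trans ?_
    gcongr
    rw [dist_left_lineMap, Real.norm_of_nonneg hs.1]
    exact mul_le_of_le_one_left dist_nonneg hs.2
  refine LipschitzWith.of_dist_le_mul fun x y => ?_
  by_cases hx : x ∈ Metric.closedBall (0 : X) 1 <;> by_cases hy : y ∈ Metric.closedBall (0 : X) 1
  · rw [indicator_of_mem hx, indicator_of_mem hy]
    exact hK.dist_le_mul x hx y hy
  · rw [indicator_of_mem hx, indicator_of_notMem hy]
    exact key x hx y hy
  · rw [indicator_of_notMem hx, indicator_of_mem hy, dist_comm, dist_comm x]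
    exact key y hy x hx
  · rw [indicator_of_notMem hx, indicator_of_notMem hy, dist_self]
    positivity

variable [MeasurableSpace X] [BorelSpace X]

/-- For small `t` the map `x ↦ x + t h(x)` is a bijection of the unit ball if `x + h(x)` maps the
ball to itself and fixes the sphere, so the integral of its Jacobian is the volume of the ball. -/
theorem integral_det_one_add_smul {h : X → X} {K : NNReal}
    (hd : ∀ x ∈ Metric.closedBall (0 : X) 1, DifferentiableAt ℝ h x)
    (hK : LipschitzOnWith K h (Metric.closedBall 0 1))
    (hD : ∀ x ∈ Metric.closedBall (0 : X) 1, ‖fderiv ℝ h x‖ ≤ K)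
    (h0 : ∀ x, ‖x‖ = 1 → h x = 0) (h1 : ∀ x, ‖x‖ ≤ 1 → ‖x + h x‖ ≤ 1)
    {t : ℝ} (ht0 : 0 ≤ t) (ht1 : t ≤ 1) (htK : t * K < 1) :
    ∫ x in Metric.closedBall (0 : X) 1, (1 + t • fderiv ℝ h x).det
      = volume.real (Metric.closedBall (0 : X) 1) := by
  set B := Metric.closedBall (0 : X) 1
  let f : X → X := fun x => x + t • h x
  have hf' : ∀ x ∈ B, HasFDerivWithinAt f (1 + t • fderiv ℝ h x) B x := fun x hx =>
    ((hasFDerivAt_id x).add ((hd x hx).hasFDerivAt.const_smul t)).hasFDerivWithinAt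
  have hinj : InjOn f B := by
    intro x hx y hy hxy
    have e1 : x - y = t • (h y - h x) := by
      have : x + t • h x = y + t • h y := hxy
      rw [smul_sub, sub_eq_sub_iff_add_eq_add, this, add_comm]
    have e2 : ‖x - y‖ ≤ t * K * ‖x - y‖ := by
      conv_lhs => rw [e1]
      rw [norm_smul, Real.norm_of_nonneg ht0, mul_assoc]
      gcongr
      have := hK.dist_le_mul y hy x hx
      rwa [dist_eq_norm, dist_eq_norm, norm_sub_rev y x] at this
    by_contra hne
    have : 0 < ‖x - y‖ := norm_pos_iff.2 (sub_ne_zero.2 hne)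
    nlinarith
  have himg : f '' B = B := by
    apply Subset.antisymm
    · rintro _ ⟨x, hx, rfl⟩
      have hx' : ‖x‖ ≤ 1 := by simpa [B] using hx
      have e : f x = (1 - t) • x + t • (x + h x) := by
        simp only [f, smul_add, sub_smul, one_smul]; abel
      have : ‖f x‖ ≤ 1 := by
        rw [e]
        refine (norm_add_le _ _).trans ?_
        rw [norm_smul, norm_smul, Real.norm_of_nonneg ht0, Real.norm_of_nonneg (by linarith)]
        nlinarith [h1 x hx']
      simpa [B] using this
    · intro y hy
      -- the point with `f x = y` is the fixed point of the contraction `x ↦ y - t h(x)`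
      let H := indicator B h
      have hH : LipschitzWith K H := hK.indicator_closedBall h0
      have hC : ContractingWith (t.toNNReal * K) (fun x => y - t • H x) := by
        refine ⟨by rw [← NNReal.coe_lt_coe]; simpa [Real.coe_toNNReal t ht0] using htK, ?_⟩
        refine LipschitzWith.of_dist_le_mul fun a b => ?_
        rw [dist_sub_left, dist_smul₀, Real.norm_of_nonneg ht0]
        have := hH.dist_le_mul a b
        simp only [NNReal.coe_mul, Real.coe_toNNReal t ht0, mul_assoc]
        gcongr
      have hx : y - t • H (hC.fixedPoint) = hC.fixedPoint := hC.fixedPoint_isFixedPt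
      by_cases hB : hC.fixedPoint ∈ B
      · refine ⟨_, hB, ?_⟩
        have e : H (hC.fixedPoint) = h (hC.fixedPoint) := indicator_of_mem hB h
        rw [e] at hx
        simp only [f]
        nth_rw 1 [← hx]
        abel
      · have e : H (hC.fixedPoint) = 0 := indicator_of_notMem hB h
        rw [e, smul_zero, sub_zero] at hx
        exact absurd (hx ▸ hy) hB
  have hcv := integral_image_eq_integral_abs_det_fderiv_smul (volume : Measure X)
    (Metric.isClosed_closedBall.measurableSet) hf' hinj (fun _ => (1 : ℝ))
  rw [himg] at hcv
  have e : ∫ x in B, (1 + t • fderiv ℝ h x).det = ∫ x in B, |(1 + t • fderiv ℝ h x).det| • (1 : ℝ) := by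
    refine setIntegral_congr_fun Metric.isClosed_closedBall.measurableSet fun x hx => ?_
    have : ‖t • fderiv ℝ h x‖ < 1 := by
      rw [norm_smul, Real.norm_of_nonneg ht0]
      exact (mul_le_mul_of_nonneg_left (hD x hx) ht0).trans_lt htK
    simp only [smul_eq_mul, mul_one]
    rw [abs_of_pos (det_one_add_pos this)]
  rw [e, ← hcv]
  simp

omit [MeasurableSpace X] [BorelSpace X] in
theorem det_fderiv_eq_zero_of_norm_eq_one {g : X → X} {x : X} (hd : DifferentiableAt ℝ g x)
    (h : ∀ᶠ y in 𝓝 x, ‖g y‖ = 1) : (fderiv ℝ g x).det = 0 := by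
  have hort : ∀ w, inner ℝ (g x) (fderiv ℝ g x w) = 0 := by
    intro w
    have h1 : HasFDerivAt (fun y => inner ℝ (g y) (g y))
        ((fderivInnerCLM ℝ (g x, g x)).comp ((fderiv ℝ g x).prod (fderiv ℝ g x))) x :=
      hd.hasFDerivAt.inner ℝ hd.hasFDerivAt
    have h2 : (fun y => inner ℝ (g y) (g y)) =ᶠ[𝓝 x] fun _ => (1 : ℝ) := by
      filter_upwards [h] with y hy
      rw [real_inner_self_eq_norm_sq, hy]; norm_num
    have h3 := (h1.congr_of_eventuallyEq h2.symm).unique (hasFDerivAt_const (1 : ℝ) x)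
    have h4 := congrArg (fun L => L w) h3
    simp only [ContinuousLinearMap.comp_apply, ContinuousLinearMap.prod_apply,
      fderivInnerCLM_apply, _root_.zero_apply] at h4
    rw [real_inner_comm (g x)] at h4
    linarith
  by_contra hdet
  let e := LinearMap.equivOfDetNeZero ((fderiv ℝ g x : X →L[ℝ] X) : X →ₗ[ℝ] X) hdet
  have h5 : fderiv ℝ g x (e.symm (g x)) = g x := e.apply_symm_apply (g x)
  have h6 := hort (e.symm (g x))
  rw [h5, real_inner_self_eq_norm_sq, h.self_of_nhds] at h6
  norm_num at h6

/-- There is no `C¹` retraction of the ball onto the sphere. The integral of `det (1 + t Dh)` with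
`h = g - id` is a polynomial in `t` which equals the volume of the ball for small `t`, hence for
all `t`; but at `t = 1` the Jacobian of `g` vanishes. -/
theorem not_exists_contDiffAt_retraction {g : X → X}
    (hg : ∀ x ∈ Metric.closedBall (0 : X) 1, ContDiffAt ℝ 1 g x)
    (hg1 : ∀ x, ‖x‖ ≤ 1 → ‖g x‖ = 1) (hg0 : ∀ x, ‖x‖ = 1 → g x = x) : False := by
  set B := Metric.closedBall (0 : X) 1 with hB
  let h : X → X := fun x => g x - x
  have hh : ∀ x ∈ B, ContDiffAt ℝ 1 h x := fun x hx => (hg x hx).sub contDiffAt_id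
  have hd : ∀ x ∈ B, DifferentiableAt ℝ h x := fun x hx => (hh x hx).differentiableAt one_ne_zero
  have hcont : ContinuousOn (fderiv ℝ h) B := fun x hx =>
    ((hh x hx).continuousAt_fderiv one_ne_zero).continuousWithinAt
  have hcpt : IsCompact B := isCompact_closedBall 0 1
  obtain ⟨K₀, hK₀⟩ := hcpt.exists_bound_of_continuousOn hcont
  let K : NNReal := ⟨max K₀ 0, le_max_right _ _⟩
  have hD : ∀ x ∈ B, ‖fderiv ℝ h x‖ ≤ K := fun x hx => (hK₀ x hx).trans (le_max_left _ _)
  have hLip : LipschitzOnWith K h B :=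
    (convex_closedBall 0 1).lipschitzOnWith_of_nnnorm_fderiv_le hd (fun x hx => hD x hx)
  -- the interpolation nodes
  let n := Module.finrank ℝ X
  let node : Fin (n + 1) → ℝ := fun i => 1 / ((K + 1) * (i + 1 : ℝ))
  have hKpos : (0 : ℝ) < K + 1 := by positivity
  have hnode_inj : Function.Injective node := by
    intro i j hij
    have h2 : ((K : ℝ) + 1) * (i + 1) = (K + 1) * (j + 1) := by
      have := congrArg (fun z : ℝ => z⁻¹) hij
      simpa [node] using this
    have h3 := mul_left_cancel₀ hKpos.ne' h2
    have h4 : (i : ℝ) = j := by linarith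
    exact Fin.ext (by exact_mod_cast h4)
  let s : Finset ℝ := Finset.univ.image node
  have hs : n < s.card := by
    rw [Finset.card_image_of_injective _ hnode_inj]; simp
  have hsP : ∀ r ∈ s, ∫ x in B, (1 + r • fderiv ℝ h x).det = volume.real B := by
    intro r hr
    obtain ⟨i, -, rfl⟩ := Finset.mem_image.1 hr
    have hi : (1 : ℝ) ≤ i + 1 := by simp
    have hle : node i ≤ 1 / (K + 1) := by
      simp only [node]
      apply one_div_le_one_div_of_le hKpos
      nlinarith
    have h0 : 0 ≤ node i := by positivity
    refine integral_det_one_add_smul hd hLip hD (fun x hx => ?_) (fun x hx => ?_) h0 ?_ ?_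
    · simp [h, hg0 x hx]
    · simp [h, hg1 x hx]
    · refine hle.trans ?_
      rw [div_le_one hKpos]; linarith [K.coe_nonneg]
    · calc node i * K ≤ 1 / (K + 1) * K := by gcongr
        _ < 1 := by rw [one_div, inv_mul_lt_iff₀ hKpos]; linarith
  have hint : ∀ r : ℝ, IntegrableOn (fun x => (1 + r • fderiv ℝ h x).det) B volume := by
    intro r
    refine ContinuousOn.integrableOn_compact hcpt ?_
    exact ContinuousLinearMap.continuous_det.comp_continuousOn
      (continuousOn_const.add (hcont.const_smul r))
  have h1 : ∫ x in B, (1 + (1 : ℝ) • fderiv ℝ h x).det = volume.real B := by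
    calc ∫ x in B, (1 + (1 : ℝ) • fderiv ℝ h x).det
        = ∫ x in B, ∑ r ∈ s, (Lagrange.basis s id r).eval 1 * (1 + r • fderiv ℝ h x).det := by
          refine integral_congr_ae (Eventually.of_forall fun x => ?_)
          exact det_one_add_smul_eq_sum_lagrange _ s hs 1
      _ = ∑ r ∈ s, (Lagrange.basis s id r).eval 1 * volume.real B := by
          rw [integral_finsetSum _ fun r _ => (hint r).const_mul _]
          refine Finset.sum_congr rfl fun r hr => ?_
          rw [integral_const_mul, hsP r hr]
      _ = volume.real B := by
          have hsum := Lagrange.sum_basis (s := s) (v := (id : ℝ → ℝ))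
            Function.injective_id.injOn (Finset.card_pos.1 (by omega))
          rw [← Finset.sum_mul, ← Polynomial.eval_finsetSum, hsum, Polynomial.eval_one, one_mul]
  have h2 : ∫ x in B, (1 + (1 : ℝ) • fderiv ℝ h x).det = 0 := by
    have hball : ∀ x ∈ Metric.ball (0 : X) 1, (1 + (1 : ℝ) • fderiv ℝ h x).det = 0 := by
      intro x hx
      have hxB : x ∈ B := Metric.ball_subset_closedBall hx
      have e : 1 + (1 : ℝ) • fderiv ℝ h x = fderiv ℝ g x := by
        have : fderiv ℝ h x = fderiv ℝ g x - 1 :=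
          (((hg x hxB).differentiableAt one_ne_zero).hasFDerivAt.sub (hasFDerivAt_id x)).fderiv
        rw [this, one_smul]; abel
      rw [e]
      refine det_fderiv_eq_zero_of_norm_eq_one ((hg x hxB).differentiableAt one_ne_zero) ?_
      filter_upwards [Metric.isOpen_ball.mem_nhds hx] with y hy
      exact hg1 y (by simpa using (Metric.ball_subset_closedBall hy))
    rcases subsingleton_or_nontrivial X with hX | hX
    · exfalso
      have := hg1 0 (by simp)
      rw [Subsingleton.elim (g 0) 0] at this
      simp at this
    · have hae : ∀ᵐ x ∂(volume.restrict B), (1 + (1 : ℝ) • fderiv ℝ h x).det = 0 := by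
        rw [ae_restrict_iff' Metric.isClosed_closedBall.measurableSet]
        have hsph : ∀ᵐ x ∂(volume : Measure X), x ∉ Metric.sphere (0 : X) 1 :=
          measure_eq_zero_iff_ae_notMem.1 (Measure.addHaar_sphere _ _ _)
        filter_upwards [hsph] with x hx hxB
        apply hball
        rw [mem_ball_zero_iff]
        rw [mem_closedBall_zero_iff] at hxB
        exact lt_of_le_of_ne hxB (by simpa using hx)
      rw [integral_congr_ae hae]; simp
  have h3 : 0 < volume.real B :=
    ENNReal.toReal_pos (Metric.measure_closedBall_pos _ _ one_pos).ne' hcpt.measure_lt_top.ne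
  linarith

omit [MeasurableSpace X] [BorelSpace X] in
/-- A `C¹` vector field that points outwards on the unit sphere has a zero in the ball: otherwise
moving each point along the field to the sphere is a `C¹` retraction. -/
theorem exists_zero_of_contDiff_of_inner_pos {F : X → X} (hF : ContDiff ℝ 1 F)
    (hpos : ∀ x, ‖x‖ = 1 → 0 < inner ℝ x (F x)) : ∃ x, ‖x‖ ≤ 1 ∧ F x = 0 := by
  by_contra! hne
  borelize X
  let disc : X → ℝ := fun x => (inner ℝ x (F x)) ^ 2 + ‖F x‖ ^ 2 * (1 - ‖x‖ ^ 2)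
  let lam : X → ℝ := fun x => (-inner ℝ x (F x) + √(disc x)) / ‖F x‖ ^ 2
  let g : X → X := fun x => x + lam x • F x
  have hdisc : ∀ x, ‖x‖ ≤ 1 → 0 < disc x := by
    intro x hx
    have hFx : 0 < ‖F x‖ := norm_pos_iff.2 (hne x hx)
    rcases hx.lt_or_eq with hx | hx
    · have : 0 < 1 - ‖x‖ ^ 2 := by nlinarith [norm_nonneg x]
      have := sq_nonneg (inner ℝ x (F x))
      simp only [disc]; positivity
    · have := hpos x hx
      simp only [disc, hx]
      positivity
  refine not_exists_contDiffAt_retraction (g := g) ?_ ?_ ?_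
  · intro x hx
    have hx : ‖x‖ ≤ 1 := by simpa using hx
    have hin : ContDiffAt ℝ 1 (fun x => inner ℝ x (F x)) x :=
      contDiffAt_id.inner ℝ hF.contDiffAt
    have hn : ContDiffAt ℝ 1 (fun x => ‖F x‖ ^ 2) x := hF.contDiffAt.norm_sq ℝ
    have hd : ContDiffAt ℝ 1 disc x :=
      (hin.pow 2).add (hn.mul (contDiffAt_const.sub (contDiffAt_id.norm_sq ℝ)))
    have hl : ContDiffAt ℝ 1 lam x :=
      (hin.neg.add (hd.sqrt (hdisc x hx).ne')).div hn
        (pow_ne_zero 2 (norm_ne_zero_iff.2 (hne x hx)))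
    exact contDiffAt_id.add (hl.smul hF.contDiffAt)
  · intro x hx
    have hFx : ‖F x‖ ≠ 0 := norm_ne_zero_iff.2 (hne x hx)
    have hq : ‖g x‖ ^ 2 = 1 := by
      have e : ‖g x‖ ^ 2 = ‖x‖ ^ 2 + 2 * (lam x * inner ℝ x (F x)) + (lam x * ‖F x‖) ^ 2 := by
        simp only [g]
        rw [norm_add_sq_real, inner_smul_right, norm_smul, mul_pow, mul_pow, Real.norm_eq_abs,
          sq_abs]
      have hs := Real.sq_sqrt (hdisc x hx).le
      have hl : lam x * ‖F x‖ ^ 2 = -inner ℝ x (F x) + √(disc x) :=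
        div_mul_cancel₀ _ (pow_ne_zero 2 hFx)
      have e2 : ‖F x‖ ^ 2 * (‖g x‖ ^ 2 - 1) = 0 := by
        rw [e]
        have : (lam x * ‖F x‖ ^ 2 + inner ℝ x (F x)) ^ 2 = disc x := by
          rw [hl, neg_add_cancel_comm, hs]
        simp only [disc] at this
        linarith
      have := (mul_eq_zero.1 e2).resolve_left (pow_ne_zero 2 hFx)
      linarith
    have := norm_nonneg (g x)
    nlinarith
  · intro x hx
    have : lam x = 0 := by
      have h1 : disc x = (inner ℝ x (F x)) ^ 2 := by simp [disc, hx]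
      simp only [lam, h1]
      rw [Real.sqrt_sq (hpos x hx).le]
      simp
    simp [g, this]

omit [MeasurableSpace X] [BorelSpace X] in
theorem exists_zero_of_inner_pos_unit {F : X → X} (hF : Continuous F)
    (hpos : ∀ x, ‖x‖ = 1 → 0 < inner ℝ x (F x)) : ∃ x, ‖x‖ ≤ 1 ∧ F x = 0 := by
  -- a smooth field that is close to `F` still points outwards; let the distance tend to zero
  have happrox : ∀ n : ℕ, ∃ x, ‖x‖ ≤ 1 ∧ ‖F x‖ ≤ 1 / (n + 1 : ℝ) := by
    intro n
    obtain ⟨c, hc, hcF⟩ : ∃ c > 0, ∀ x, ‖x‖ = 1 → c ≤ inner ℝ x (F x) := by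
      rcases (Metric.sphere (0 : X) 1).eq_empty_or_nonempty with he | hne
      · refine ⟨1, one_pos, fun x hx => ?_⟩
        have : x ∈ Metric.sphere (0 : X) 1 := by simpa using hx
        simp [he] at this
      · obtain ⟨x₀, hx₀, hmin⟩ := (isCompact_sphere (0 : X) 1).exists_isMinOn hne
          (continuous_id.inner (𝕜 := ℝ) hF).continuousOn
        exact ⟨_, hpos x₀ (by simpa using hx₀), fun x hx => hmin (by simpa using hx)⟩
    have hn : (0 : ℝ) < 1 / (n + 1 : ℝ) := by positivity
    obtain ⟨G, hG, hGF, -⟩ := hF.exists_contDiff_approx 1 (ε := fun _ => min c (1 / (n + 1 : ℝ)))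
      continuous_const (fun _ => lt_min hc hn)
    obtain ⟨x, hx, hx0⟩ := exists_zero_of_contDiff_of_inner_pos (F := G) hG (fun x hx => by
      have h1 : |inner ℝ x (F x - G x)| ≤ ‖x‖ * ‖F x - G x‖ := abs_real_inner_le_norm _ _
      have h2 : ‖F x - G x‖ < c := by
        have := hGF x
        rw [dist_comm, dist_eq_norm] at this
        exact this.trans_le (min_le_left _ _)
      rw [hx, one_mul, inner_sub_right] at h1
      have := hcF x hx
      have := (abs_le.1 h1).2
      linarith)
    refine ⟨x, hx, ?_⟩
    have := hGF x
    rw [hx0, dist_zero_left] at this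
    exact this.le.trans (min_le_right _ _)
  choose u hu1 hu2 using happrox
  obtain ⟨x, hx, φ, hφ, hlim⟩ := (isCompact_closedBall (0 : X) 1).tendsto_subseq
    (x := u) (fun n => by simpa using hu1 n)
  refine ⟨x, by simpa using hx, ?_⟩
  have h1 : Tendsto (fun n => F (u (φ n))) atTop (𝓝 (F x)) := (hF.tendsto x).comp hlim
  have h2 : Tendsto (fun n => F (u (φ n))) atTop (𝓝 0) := by
    refine squeeze_zero_norm (fun n => hu2 (φ n)) ?_
    exact tendsto_one_div_add_atTop_nhds_zero_nat.comp hφ.tendsto_atTop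
  exact tendsto_nhds_unique h1 h2

omit [MeasurableSpace X] [BorelSpace X] in
/-- **Acute angle lemma**, for a family of linear functionals: if `A x` depends continuously on
`x` and `A x x > 0` on a sphere, then some `A x` vanishes. -/
theorem exists_forall_eq_zero_of_apply_self_pos {A : X → X →ₗ[ℝ] ℝ}
    (hA : ∀ y, Continuous fun x => A x y) {R : ℝ} (hR : 0 < R)
    (hpos : ∀ x, ‖x‖ = R → 0 < A x x) : ∃ x, ∀ y, A x y = 0 := by
  let b := stdOrthonormalBasis ℝ X
  let F : X → X := fun x => ∑ i, A (R • x) (b i) • b i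
  have hFi : ∀ x y, inner ℝ y (F x) = A (R • x) y := by
    intro x y
    simp only [F, inner_sum, inner_smul_right]
    conv_rhs => rw [← b.sum_repr' y, map_sum]
    refine Finset.sum_congr rfl fun i _ => ?_
    rw [map_smul, smul_eq_mul, real_inner_comm, mul_comm]
  have hFc : Continuous F := by
    refine continuous_finsetSum _ fun i _ => ?_
    exact ((hA (b i)).comp (continuous_const_smul R)).smul continuous_const
  obtain ⟨x, -, hx⟩ := exists_zero_of_inner_pos_unit hFc (fun x hx => by
    rw [hFi]
    have := hpos (R • x) (by rw [norm_smul, hx, mul_one, Real.norm_of_nonneg hR.le])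
    rw [map_smul, smul_eq_mul] at this
    exact pos_of_mul_pos_right this hR.le)
  exact ⟨R • x, fun y => by rw [← hFi, hx, inner_zero_right]⟩

end Brouwer

/-! ### The trace inequality on a Lipschitz boundary -/

namespace TwoPhase

variable {d : ℕ}

/-- Tonelli's theorem for the lines in the direction of the unit vector `e`. -/
theorem lintegral_eq_lintegral_orthogonal_line {e : E d} (he : ‖e‖ = 1) {G : E d → ℝ≥0∞}
    (hG : Measurable G) :
    ∫⁻ x, G x = ∫⁻ z : (ℝ ∙ e)ᗮ, ∫⁻ t : ℝ, G (z + t • e) := by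
  have h1 := ((ℝ ∙ e).measurePreserving_measurableEquivProd (0 : E d)).symm
  have h2 : ∫⁻ x, G x = ∫⁻ q : (ℝ ∙ e) × (ℝ ∙ e)ᗮ, G (q.1 + q.2) := by
    have hv : (volume : Measure (E d)) = Measure.euclideanHausdorffMeasure
      (Module.finrank ℝ (E d)) := InnerProductSpace.euclideanHausdorffMeasure_eq_volume.symm
    rw [hv, ← h1.lintegral_comp_emb (MeasurableEquiv.measurableEmbedding _)]
    refine lintegral_congr fun q => ?_
    rw [Submodule.measurableEquivProd_symm_apply]
    simp
  have hGm : Measurable fun q : (ℝ ∙ e) × (ℝ ∙ e)ᗮ => G (q.1 + q.2) :=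
    hG.comp (by fun_prop)
  rw [h2, Measure.volume_eq_prod, lintegral_prod_symm _ hGm.aemeasurable]
  refine lintegral_congr fun z => ?_
  have h3 := (LinearIsometryEquiv.toSpanUnitSingleton (𝕜 := ℝ) e he).measurePreserving
  rw [← h3.lintegral_comp_emb
    (LinearIsometryEquiv.toSpanUnitSingleton (𝕜 := ℝ) e he).toHomeomorph.measurableEmbedding]
  refine lintegral_congr fun t => ?_
  simp [add_comm]

/-- The surface integral over a piece of a Lipschitz graph is bounded by the integral over the
hyperplane on which the graph is parametrised. -/
theorem setLIntegral_graph_le {e : E d} (he : ‖e‖ = 1) {h : E d → ℝ} {L : NNReal}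
    (hh : LipschitzWith L h) {A : Set (E d)}
    (hAh : ∀ y ∈ A, inner ℝ e y = h (y - inner ℝ e y • e)) {g : E d → ℝ≥0∞} (hg : Measurable g) :
    ∫⁻ y in A, g y ∂(Measure.euclideanHausdorffMeasure (d - 1) : Measure (E d))
      ≤ ((1 + L : NNReal) : ℝ≥0∞) ^ (d - 1) * ∫⁻ z : (ℝ ∙ e)ᗮ, g (z + h z • e) := by
  set ν := (Measure.euclideanHausdorffMeasure (d - 1) : Measure (E d))
  set c := ((1 + L : NNReal) : ℝ≥0∞) ^ (d - 1)
  let F : (ℝ ∙ e)ᗮ → E d := fun z => z + h z • e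
  have hF : LipschitzWith (1 + L) F := by
    refine LipschitzWith.of_dist_le_mul fun a b => ?_
    have h1 : dist (h a • e) (h b • e) ≤ L * dist a b := by
      rw [dist_eq_norm, ← sub_smul, norm_smul, he, mul_one, ← dist_eq_norm]
      exact hh.dist_le_mul a b
    calc dist (F a) (F b) ≤ dist (a : E d) b + dist (h a • e) (h b • e) := dist_add_add_le _ _ _ _
      _ ≤ dist a b + L * dist a b := add_le_add le_rfl h1
      _ = ((1 + L : NNReal) : ℝ) * dist a b := by push_cast; ring
  have hFm : Measurable F := hF.continuous.measurable
  have he0 : e ≠ 0 := by rintro rfl; simp at he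
  have hrank : Module.finrank ℝ (ℝ ∙ e)ᗮ = d - 1 := by
    have h1 := (ℝ ∙ e).finrank_add_finrank_orthogonal
    rw [finrank_span_singleton he0, finrank_euclideanSpace, Fintype.card_fin] at h1
    omega
  have hvol : (volume : Measure (ℝ ∙ e)ᗮ) = Measure.euclideanHausdorffMeasure (d - 1) := by
    rw [← hrank]; exact InnerProductSpace.euclideanHausdorffMeasure_eq_volume.symm
  have himg : ∀ B : Set (ℝ ∙ e)ᗮ, ν (F '' B) ≤ c * volume B := by
    intro B
    have h1 := hF.hausdorffMeasure_image_le (d := ((d - 1 : ℕ) : ℝ)) (Nat.cast_nonneg _) B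
    rw [ENNReal.rpow_natCast] at h1
    rw [hvol]
    simp only [ν, Measure.euclideanHausdorffMeasure_def, Measure.smul_apply, ENNReal.smul_def,
      smul_eq_mul]
    rw [mul_left_comm]
    exact mul_le_mul_right h1 _
  have hle : ν.restrict A ≤ c • Measure.map F volume := by
    refine Measure.le_iff.2 fun B hB => ?_
    rw [Measure.restrict_apply hB, Measure.smul_apply, Measure.map_apply hFm hB, smul_eq_mul]
    have hsub : B ∩ A ⊆ F '' (F ⁻¹' B) := by
      rintro y ⟨hyB, hyA⟩
      have hmem : y - inner ℝ e y • e ∈ (ℝ ∙ e)ᗮ := by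
        rw [Submodule.mem_orthogonal_singleton_iff_inner_right, inner_sub_right, inner_smul_right,
          real_inner_self_eq_norm_sq, he]
        simp
      have hy : F ⟨_, hmem⟩ = y := by
        simp only [F]
        rw [← hAh y hyA, sub_add_cancel]
      exact ⟨⟨_, hmem⟩, by rw [mem_preimage, hy]; exact hyB, hy⟩
    exact (measure_mono hsub).trans (himg _)
  calc ∫⁻ y in A, g y ∂ν ≤ ∫⁻ y, g y ∂(c • Measure.map F volume) := lintegral_mono' hle le_rfl
    _ = c * ∫⁻ z, g (F z) := by
      rw [lintegral_smul_measure, lintegral_map hg hFm, smul_eq_mul]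

/-- A boundary value is bounded by the integral along a segment that starts there. -/
theorem ofReal_sq_le_lintegral_segment {w : E d → ℝ} (hw : ContDiff ℝ 1 w) {e : E d}
    (he : ‖e‖ = 1) (y : E d) {δ : ℝ} (hδ : 0 < δ) :
    ENNReal.ofReal (w y ^ 2) ≤ ENNReal.ofReal (1 / δ + 1) *
      ∫⁻ t in Ioo 0 δ, ENNReal.ofReal (w (y + t • e) ^ 2 + ‖fderiv ℝ w (y + t • e)‖ ^ 2) := by
  let W : ℝ → ℝ := fun t => w (y + t • e)
  let W' : ℝ → ℝ := fun t => fderiv ℝ w (y + t • e) e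
  let N : ℝ → ℝ := fun t => ‖fderiv ℝ w (y + t • e)‖
  have hline : Continuous fun t : ℝ => y + t • e := by fun_prop
  have hWc : Continuous W := hw.continuous.comp hline
  have hDc : Continuous fun t : ℝ => fderiv ℝ w (y + t • e) :=
    (hw.continuous_fderiv one_ne_zero).comp hline
  have hW'c : Continuous W' := hDc.clm_apply continuous_const
  have hNc : Continuous N := hDc.norm
  have hWd : ∀ t, HasDerivAt W (W' t) t := by
    intro t
    have h1 : HasDerivAt (fun t : ℝ => y + t • e) e t := by
      simpa using ((hasDerivAt_id t).smul_const e).const_add y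
    exact ((hw.differentiable one_ne_zero).differentiableAt.hasFDerivAt).comp_hasDerivAt t h1
  let f : ℝ → ℝ := fun t => (1 - t / δ) * W t ^ 2
  let f' : ℝ → ℝ := fun t => (-(1 / δ)) * W t ^ 2 + (1 - t / δ) * (2 * W t * W' t)
  have hf : ∀ t, HasDerivAt f (f' t) t := by
    intro t
    have h1 : HasDerivAt (fun t : ℝ => 1 - t / δ) (-(1 / δ)) t :=
      ((hasDerivAt_id t).div_const δ).const_sub 1
    have h2 : HasDerivAt (fun t => W t ^ 2) (2 * W t * W' t) t := by
      have h3 := (hWd t).fun_pow 2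
      simpa using h3
    exact h1.mul h2
  have hf'c : Continuous f' := by fun_prop
  have hFTC := intervalIntegral.integral_eq_sub_of_hasDerivAt (a := 0) (b := δ)
    (fun t _ => hf t) (hf'c.intervalIntegrable _ _)
  have hval : w y ^ 2 = ∫ t in (0 : ℝ)..δ, - f' t := by
    rw [intervalIntegral.integral_neg, hFTC]
    simp [f, W, div_self hδ.ne']
  have hgc : Continuous fun t => (1 / δ + 1) * (W t ^ 2 + N t ^ 2) := by fun_prop
  have hle : w y ^ 2 ≤ ∫ t in (0 : ℝ)..δ, (1 / δ + 1) * (W t ^ 2 + N t ^ 2) := by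
    rw [hval]
    refine intervalIntegral.integral_mono_on hδ.le (hf'c.neg.intervalIntegrable _ _)
      (hgc.intervalIntegrable _ _) fun t ht => ?_
    have h1 : |W' t| ≤ N t := by
      have := (fderiv ℝ w (y + t • e)).le_opNorm e
      rwa [he, mul_one, Real.norm_eq_abs] at this
    have h2 : 0 ≤ 1 - t / δ := by rw [sub_nonneg, div_le_one hδ]; exact ht.2
    have h3 : 1 - t / δ ≤ 1 := by
      have := div_nonneg ht.1 hδ.le
      linarith
    have h4 : -(2 * W t * W' t) ≤ W t ^ 2 + N t ^ 2 := by
      have := sq_le_sq' (neg_le_of_abs_le h1) (le_of_abs_le h1)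
      nlinarith [sq_nonneg (W t + W' t)]
    have h5 : (1 - t / δ) * -(2 * W t * W' t) ≤ W t ^ 2 + N t ^ 2 := by
      calc (1 - t / δ) * -(2 * W t * W' t) ≤ (1 - t / δ) * (W t ^ 2 + N t ^ 2) := by gcongr
        _ ≤ 1 * (W t ^ 2 + N t ^ 2) := by gcongr
        _ = _ := one_mul _
    have h6 : 0 ≤ (1 / δ) * N t ^ 2 := by positivity
    simp only [f']
    linarith
  calc ENNReal.ofReal (w y ^ 2)
      ≤ ENNReal.ofReal (∫ t in (0 : ℝ)..δ, (1 / δ + 1) * (W t ^ 2 + N t ^ 2)) :=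
        ENNReal.ofReal_le_ofReal hle
    _ = ENNReal.ofReal (1 / δ + 1) * ∫⁻ t in Ioo 0 δ, ENNReal.ofReal (W t ^ 2 + N t ^ 2) := by
        rw [intervalIntegral.integral_const_mul, ENNReal.ofReal_mul (by positivity),
          intervalIntegral.integral_of_le hδ.le, integral_Ioc_eq_integral_Ioo,
          ofReal_integral_eq_lintegral_ofReal]
        · have : Continuous fun t => W t ^ 2 + N t ^ 2 := by fun_prop
          exact (this.integrableOn_Icc (a := 0) (b := δ)).mono_set Ioo_subset_Icc_self
        · exact Eventually.of_forall fun t => by positivity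

/-- In the chart of a Lipschitz boundary, the boundary is the graph. -/
theorem inner_eq_of_mem_frontier {Ω : Set (E d)} (hΩ : IsOpen Ω) {e x : E d} {h : E d → ℝ} {r : ℝ}
    (hh : Continuous h)
    (hgr : ∀ y ∈ Metric.ball x r, y ∈ Ω ↔ h (y - inner ℝ e y • e) < inner ℝ e y)
    {y : E d} (hy : y ∈ frontier Ω) (hyx : y ∈ Metric.ball x r) :
    inner ℝ e y = h (y - inner ℝ e y • e) := by
  have hc1 : Continuous fun y : E d => inner ℝ e y := continuous_const.inner continuous_id
  have hc2 : Continuous fun y : E d => h (y - inner ℝ e y • e) :=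
    hh.comp (continuous_id.sub (hc1.smul continuous_const))
  rw [hΩ.frontier_eq] at hy
  apply le_antisymm
  · by_contra hlt
    exact hy.2 ((hgr y hyx).2 (not_le.1 hlt))
  · have h1 : y ∈ closure (Ω ∩ Metric.ball x r) := by
      have := Metric.isOpen_ball.inter_closure (s := Metric.ball x r) (t := Ω) ⟨hyx, hy.1⟩
      rwa [inter_comm] at this
    have h2 : closure (Ω ∩ Metric.ball x r) ⊆ {y | h (y - inner ℝ e y • e) ≤ inner ℝ e y} :=
      closure_minimal (fun z hz => ((hgr z hz.2).1 hz.1).le) (isClosed_le hc2 hc1)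
    exact h2 h1

/-- The trace inequality near one boundary point. -/
theorem exists_trace_inequality_near {Ω : Set (E d)} (hΩ : IsOpen Ω) {x e : E d} {h : E d → ℝ}
    {L : NNReal} {r : ℝ} (he : ‖e‖ = 1) (hh : LipschitzWith L h) (hr : 0 < r)
    (hgr : ∀ y ∈ Metric.ball x r, y ∈ Ω ↔ h (y - inner ℝ e y • e) < inner ℝ e y) :
    ∃ C : ℝ≥0∞, C ≠ ⊤ ∧ ∀ w : E d → ℝ, ContDiff ℝ 1 w →
      ∫⁻ y in frontier Ω ∩ Metric.ball x (r / 2), ENNReal.ofReal (w y ^ 2)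
          ∂(Measure.euclideanHausdorffMeasure (d - 1) : Measure (E d))
        ≤ C * ∫⁻ y in Ω, ENNReal.ofReal (w y ^ 2 + ‖fderiv ℝ w y‖ ^ 2) := by
  refine ⟨((1 + L : NNReal) : ℝ≥0∞) ^ (d - 1) * ENNReal.ofReal (1 / (r / 2) + 1),
    ENNReal.mul_ne_top (ENNReal.pow_ne_top ENNReal.coe_ne_top) ENNReal.ofReal_ne_top,
    fun w hw => ?_⟩
  set A := frontier Ω ∩ Metric.ball x (r / 2)
  have hAm : MeasurableSet A := isClosed_frontier.measurableSet.inter measurableSet_ball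
  have hball : Metric.ball x (r / 2) ⊆ Metric.ball x r :=
    Metric.ball_subset_ball (by linarith)
  have hAh : ∀ y ∈ A, inner ℝ e y = h (y - inner ℝ e y • e) := fun y hy =>
    inner_eq_of_mem_frontier hΩ hh.continuous hgr hy.1 (hball hy.2)
  let G : E d → ℝ≥0∞ := fun y => ENNReal.ofReal (w y ^ 2 + ‖fderiv ℝ w y‖ ^ 2)
  have hGm : Measurable G := by
    have h1 : Continuous fun y => w y ^ 2 + ‖fderiv ℝ w y‖ ^ 2 :=
      (hw.continuous.pow 2).add ((hw.continuous_fderiv one_ne_zero).norm.pow 2)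
    exact h1.measurable.ennreal_ofReal
  let G₁ : E d → ℝ≥0∞ := Ω.indicator G
  have hG₁ : Measurable G₁ := hGm.indicator hΩ.measurableSet
  let Φ : E d → ℝ≥0∞ := fun y => ∫⁻ t : ℝ, G₁ (y + t • e)
  have hΦ : Measurable Φ := by
    have h1 : Measurable fun q : E d × ℝ => G₁ (q.1 + q.2 • e) := hG₁.comp (by fun_prop)
    exact h1.lintegral_prod_right'
  -- the segment above a boundary point lies in `Ω`
  have hpt : ∀ y ∈ A, ENNReal.ofReal (w y ^ 2) ≤ ENNReal.ofReal (1 / (r / 2) + 1) * Φ y := by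
    intro y hy
    refine (ofReal_sq_le_lintegral_segment hw he y (half_pos hr)).trans ?_
    gcongr
    calc ∫⁻ t in Ioo 0 (r / 2), G (y + t • e)
        = ∫⁻ t in Ioo 0 (r / 2), G₁ (y + t • e) := by
          refine setLIntegral_congr_fun measurableSet_Ioo fun t ht => ?_
          have hin : inner ℝ e (y + t • e) = inner ℝ e y + t := by
            rw [inner_add_right, inner_smul_right, real_inner_self_eq_norm_sq, he]; ring
          have hΩy : y + t • e ∈ Ω := by
            rw [hgr _ ?_]
            · rw [hin]
              have : y + t • e - (inner ℝ e y + t) • e = y - inner ℝ e y • e := by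
                rw [add_smul]; abel
              rw [this, ← hAh y hy]
              linarith [ht.1]
            · rw [Metric.mem_ball]
              calc dist (y + t • e) x ≤ dist (y + t • e) y + dist y x := dist_triangle _ _ _
                _ < r / 2 + r / 2 := by
                  refine add_lt_add ?_ hy.2
                  rw [dist_eq_norm, add_sub_cancel_left, norm_smul, he, mul_one,
                    Real.norm_of_nonneg ht.1.le]
                  exact ht.2
                _ = r := by ring
          exact (indicator_of_mem hΩy G).symm
      _ ≤ Φ y := setLIntegral_le_lintegral _ _
  calc ∫⁻ y in A, ENNReal.ofReal (w y ^ 2) ∂(Measure.euclideanHausdorffMeasure (d - 1))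
      ≤ ∫⁻ y in A, ENNReal.ofReal (1 / (r / 2) + 1) * Φ y
          ∂(Measure.euclideanHausdorffMeasure (d - 1)) := setLIntegral_mono' hAm hpt
    _ ≤ ((1 + L : NNReal) : ℝ≥0∞) ^ (d - 1) * ∫⁻ z : (ℝ ∙ e)ᗮ,
          ENNReal.ofReal (1 / (r / 2) + 1) * Φ (z + h z • e) :=
        setLIntegral_graph_le he hh hAh (hΦ.const_mul _)
    _ = ((1 + L : NNReal) : ℝ≥0∞) ^ (d - 1) * ENNReal.ofReal (1 / (r / 2) + 1) *
          ∫⁻ y in Ω, G y := by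
        rw [lintegral_const_mul' _ _ ENNReal.ofReal_ne_top, mul_assoc]
        congr 2
        rw [← lintegral_indicator hΩ.measurableSet, lintegral_eq_lintegral_orthogonal_line he hG₁]
        refine lintegral_congr fun z => ?_
        simp only [Φ]
        rw [← lintegral_add_left_eq_self (fun t => G₁ (z + t • e)) (h z)]
        simp_rw [add_smul, add_assoc]

/-- The trace inequality for functions that are `C¹` up to the boundary. -/
theorem exists_trace_inequality {Ω : Set (E d)} (hΩ : IsOpen Ω) (hb : Bornology.IsBounded Ω)
    (hL : HasLipschitzBoundary Ω) :
    ∃ C : ℝ≥0∞, C ≠ ⊤ ∧ ∀ w : E d → ℝ, ContDiff ℝ 1 w →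
      ∫⁻ y, ENNReal.ofReal (w y ^ 2) ∂(surf (frontier Ω))
        ≤ C * ∫⁻ y in Ω, ENNReal.ofReal (w y ^ 2 + ‖fderiv ℝ w y‖ ^ 2) := by
  have hcpt : IsCompact (frontier Ω) :=
    Metric.isCompact_of_isClosed_isBounded isClosed_frontier
      (hb.closure.subset frontier_subset_closure)
  refine hcpt.induction_on (p := fun s => ∃ C : ℝ≥0∞, C ≠ ⊤ ∧ ∀ w : E d → ℝ, ContDiff ℝ 1 w →
      ∫⁻ y, ENNReal.ofReal (w y ^ 2) ∂(surf s)
        ≤ C * ∫⁻ y in Ω, ENNReal.ofReal (w y ^ 2 + ‖fderiv ℝ w y‖ ^ 2)) ?_ ?_ ?_ ?_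
  · exact ⟨0, ENNReal.zero_ne_top, fun w _ => by simp⟩
  · rintro s t hst ⟨C, hC, h⟩
    exact ⟨C, hC, fun w hw => (lintegral_mono_set hst).trans (h w hw)⟩
  · rintro s t ⟨C, hC, h⟩ ⟨C', hC', h'⟩
    refine ⟨C + C', ENNReal.add_ne_top.2 ⟨hC, hC'⟩, fun w hw => ?_⟩
    rw [add_mul]
    exact (lintegral_union_le _ s t).trans (add_le_add (h w hw) (h' w hw))
  · intro x hx
    obtain ⟨e, h, L, r, he, hh, hr, hgr⟩ := hL x hx
    refine ⟨_, inter_mem self_mem_nhdsWithin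
      (mem_nhdsWithin_of_mem_nhds (Metric.ball_mem_nhds x (half_pos hr))), ?_⟩
    exact exists_trace_inequality_near hΩ he hh hr hgr

/-- The boundary has finite surface measure: the trace inequality for `w = 1`. -/
theorem isFiniteMeasure_surf_frontier {Ω : Set (E d)} (hΩ : IsOpen Ω)
    (hb : Bornology.IsBounded Ω) (hL : HasLipschitzBoundary Ω) :
    IsFiniteMeasure (surf (frontier Ω)) := by
  obtain ⟨C, hC, h⟩ := exists_trace_inequality hΩ hb hL
  have h1 := h (fun _ => 1) contDiff_const
  simp only [one_pow, ENNReal.ofReal_one, lintegral_const, one_mul, fderiv_fun_const, Pi.zero_apply,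
    norm_zero, ne_eq, OfNat.ofNat_ne_zero, not_false_eq_true, zero_pow, add_zero,
    Measure.restrict_apply_univ Ω] at h1
  exact ⟨h1.trans_lt (ENNReal.mul_lt_top hC.lt_top hb.measure_lt_top)⟩

end TwoPhase

/-! ### Existence of the trace operator -/

namespace TwoPhase

variable {d : ℕ}

theorem memLp_of_continuous_of_isBounded {F : Type*} [NormedAddCommGroup F] {f : E d → F}
    (hf : Continuous f) {s : Set (E d)} (hs : MeasurableSet s) (hb : Bornology.IsBounded s)
    [SecondCountableTopology F] (μ : Measure (E d)) [IsFiniteMeasure (μ.restrict s)] (p : ℝ≥0∞) :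
    MemLp f p (μ.restrict s) := by
  obtain ⟨C, hC⟩ := hb.isCompact_closure.exists_bound_of_continuousOn hf.continuousOn
  exact MemLp.of_bound hf.aestronglyMeasurable C
    (ae_restrict_of_forall_mem hs fun x hx => hC x (subset_closure hx))

theorem isFiniteMeasure_vol {Ω : Set (E d)} (hb : Bornology.IsBounded Ω) :
    IsFiniteMeasure (vol Ω) :=
  ⟨by rw [Measure.restrict_apply_univ]; exact hb.measure_lt_top⟩

/-- A function that is smooth up to the boundary has its gradient as weak gradient. -/
theorem hasWeakGradient_gradient (Ω : Set (E d)) {w : E d → ℝ} (hw : ContDiff ℝ ∞ w) :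
    HasWeakGradient Ω w (gradient w) := by
  intro ψ h1 h2 h3 e
  have hψ0 : ∀ x ∉ Ω, ψ x = 0 := fun x hx => image_eq_zero_of_notMem_tsupport fun h => hx (h3 h)
  have hDψ0 : ∀ x ∉ Ω, fderiv ℝ ψ x e = 0 := fun x hx => by
    rw [image_eq_zero_of_notMem_tsupport (f := fderiv ℝ ψ)
      fun h => hx (h3 (tsupport_fderiv_subset ℝ h))]
    rfl
  rw [setIntegral_eq_integral_of_forall_compl_eq_zero (fun x hx => by rw [hDψ0 x hx, mul_zero]),
    setIntegral_eq_integral_of_forall_compl_eq_zero (fun x hx => by rw [hψ0 x hx, mul_zero])]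
  simp only [inner_gradient_left]
  have hψc := h1.continuous
  have hDψc : Continuous fun x => fderiv ℝ ψ x e :=
    (h1.continuous_fderiv (by simp)).clm_apply continuous_const
  have hDwc : Continuous fun x => fderiv ℝ w x e :=
    (hw.continuous_fderiv (by simp)).clm_apply continuous_const
  refine integral_mul_fderiv_eq_neg_fderiv_mul_of_integrable ?_ ?_ ?_
    (fun x _ => (hw.differentiable (by simp)).differentiableAt)
    (fun x _ => (h1.differentiable (by simp)).differentiableAt)
  · exact (hDwc.mul hψc).integrable_of_hasCompactSupport h2.mul_left
  · exact (hw.continuous.mul hDψc).integrable_of_hasCompactSupport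
      ((h2.fderiv_apply ℝ e).mul_left)
  · exact (hw.continuous.mul hψc).integrable_of_hasCompactSupport h2.mul_left

/-- The weak gradient is determined by the function. -/
theorem H1.ext_val {Ω : Set (E d)} (hΩ : IsOpen Ω) (hb : Bornology.IsBounded Ω) {u v : H1 Ω}
    (h : H1.val u = H1.val v) : u = v := by
  have := isFiniteMeasure_vol hb
  rw [← sub_eq_zero] at h ⊢
  rw [← map_sub] at h
  set z := u - v
  have hval : z.1.fst = 0 := h
  have hg0 : ∀ e : E d, ∀ᵐ x, x ∈ Ω → inner ℝ (z.1.snd x) e = 0 := by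
    intro e
    refine hΩ.ae_eq_zero_of_integral_contDiff_smul_eq_zero ?_ fun ψ h1 h2 h3 => ?_
    · have h4 : Integrable (z.1.snd : E d → E d) (vol Ω) :=
        (Lp.memLp z.1.snd).integrable (by norm_num)
      exact IntegrableOn.locallyIntegrableOn (h4.inner_const e)
    · have h4 := z.2 ψ h1 h2 h3 e
      have hl : ∫ x in Ω, z.1.fst x * fderiv ℝ ψ x e = 0 := by
        rw [hval]
        refine integral_eq_zero_of_ae ?_
        filter_upwards [Lp.coeFn_zero ℝ 2 (vol Ω)] with x hx
        rw [hx]; simp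
      rw [hl] at h4
      rw [← setIntegral_eq_integral_of_forall_compl_eq_zero (s := Ω)]
      · have h5 : ∀ x, ψ x • inner ℝ (z.1.snd x) e = inner ℝ (z.1.snd x) e * ψ x := fun x => by
          rw [smul_eq_mul, mul_comm]
        simp only [h5]
        linarith
      · intro x hx
        rw [image_eq_zero_of_notMem_tsupport fun h => hx (h3 h), zero_smul]
  have hsnd : z.1.snd = 0 := by
    apply Lp.ext
    have h5 : ∀ᵐ x ∂(vol Ω), ∀ i, inner ℝ (z.1.snd x) (EuclideanSpace.single i (1 : ℝ)) = 0 :=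
      ae_all_iff.2 fun i => (ae_restrict_iff' hΩ.measurableSet).2 (hg0 _)
    filter_upwards [h5, Lp.coeFn_zero (E d) 2 (vol Ω)] with x hx hx0
    rw [hx0]
    ext i
    simpa [EuclideanSpace.inner_single_right] using hx i
  apply Subtype.ext
  exact WithLp.ofLp_injective 2 (Prod.ext hval hsnd)

/-- The functions that are smooth on the whole space. -/
def smoothFun (d : ℕ) : Submodule ℝ (E d → ℝ) where
  carrier := {w | ContDiff ℝ ∞ w}
  zero_mem' := show ContDiff ℝ ∞ fun _ => (0 : ℝ) from contDiff_const
  add_mem' {a b} ha hb :=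
    show ContDiff ℝ ∞ (a + b) from
      (show ContDiff ℝ ∞ a from ha).add (show ContDiff ℝ ∞ b from hb)
  smul_mem' c a ha :=
    show ContDiff ℝ ∞ (c • a) from contDiff_const.smul (show ContDiff ℝ ∞ a from ha)

theorem smoothFun.contDiff (w : smoothFun d) : ContDiff ℝ ∞ (w : E d → ℝ) := w.2

theorem continuous_gradient {w : E d → ℝ} (hw : ContDiff ℝ ∞ w) : Continuous (gradient w) :=
  (InnerProductSpace.toDual ℝ (E d)).symm.continuous.comp (hw.continuous_fderiv (by simp))

theorem memLp_smoothFun {Ω : Set (E d)} (hΩ : IsOpen Ω) (hb : Bornology.IsBounded Ω)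
    (w : smoothFun d) : MemLp (w : E d → ℝ) 2 (vol Ω) := by
  have := isFiniteMeasure_vol hb
  exact memLp_of_continuous_of_isBounded (smoothFun.contDiff w).continuous hΩ.measurableSet hb _ _

theorem memLp_gradient_smoothFun {Ω : Set (E d)} (hΩ : IsOpen Ω) (hb : Bornology.IsBounded Ω)
    (w : smoothFun d) : MemLp (gradient (w : E d → ℝ)) 2 (vol Ω) := by
  have := isFiniteMeasure_vol hb
  exact memLp_of_continuous_of_isBounded (continuous_gradient w.2) hΩ.measurableSet hb _ _

/-- The restriction of smooth functions to `Ω`, as a map into `H¹(Ω)`. -/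
noncomputable def smoothToH1 {Ω : Set (E d)} (hΩ : IsOpen Ω) (hb : Bornology.IsBounded Ω) :
    smoothFun d →ₗ[ℝ] H1 Ω where
  toFun w := ⟨WithLp.toLp 2 ((memLp_smoothFun hΩ hb w).toLp _,
      (memLp_gradient_smoothFun hΩ hb w).toLp _), by
    intro ψ h1 h2 h3 e
    have h4 := hasWeakGradient_gradient Ω w.2 ψ h1 h2 h3 e
    have e1 : ∫ x in Ω, ((memLp_smoothFun hΩ hb w).toLp _ : E d → ℝ) x * fderiv ℝ ψ x e
        = ∫ x in Ω, (w : E d → ℝ) x * fderiv ℝ ψ x e := by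
      refine integral_congr_ae ?_
      filter_upwards [(memLp_smoothFun hΩ hb w).coeFn_toLp] with x hx
      rw [hx]
    have e2 : ∫ x in Ω, inner ℝ (((memLp_gradient_smoothFun hΩ hb w).toLp _ : E d → E d) x) e * ψ x
        = ∫ x in Ω, inner ℝ (gradient (w : E d → ℝ) x) e * ψ x := by
      refine integral_congr_ae ?_
      filter_upwards [(memLp_gradient_smoothFun hΩ hb w).coeFn_toLp] with x hx
      rw [hx]
    exact e1.trans (h4.trans (congrArg Neg.neg e2.symm))⟩
  map_add' a b := by
    refine H1.ext_val hΩ hb ?_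
    rw [map_add]
    exact MemLp.toLp_add (memLp_smoothFun hΩ hb a) (memLp_smoothFun hΩ hb b)
  map_smul' c a := by
    refine H1.ext_val hΩ hb ?_
    rw [map_smul]
    exact MemLp.toLp_const_smul c (memLp_smoothFun hΩ hb a)

theorem val_smoothToH1 {Ω : Set (E d)} (hΩ : IsOpen Ω) (hb : Bornology.IsBounded Ω)
    (w : smoothFun d) : H1.val (smoothToH1 hΩ hb w) =ᵐ[vol Ω] (w : E d → ℝ) :=
  (memLp_smoothFun hΩ hb w).coeFn_toLp

theorem grad_smoothToH1 {Ω : Set (E d)} (hΩ : IsOpen Ω) (hb : Bornology.IsBounded Ω)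
    (w : smoothFun d) :
    H1.grad (smoothToH1 hΩ hb w) =ᵐ[vol Ω] gradient (w : E d → ℝ) :=
  (memLp_gradient_smoothFun hΩ hb w).coeFn_toLp

theorem H1.norm_sq {Ω : Set (E d)} (u : H1 Ω) :
    ‖u‖ ^ 2 = ‖H1.val u‖ ^ 2 + ‖H1.grad u‖ ^ 2 :=
  WithLp.prod_norm_sq_eq_of_L2 u.1

theorem Lp_norm_sq_eq_integral {F : Type*} [NormedAddCommGroup F] [InnerProductSpace ℝ F]
    {μ : Measure (E d)} (f : Lp F 2 μ) : ‖f‖ ^ 2 = ∫ x, ‖f x‖ ^ 2 ∂μ := by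
  rw [← real_inner_self_eq_norm_sq, L2.inner_def]
  simp only [real_inner_self_eq_norm_sq]

theorem memLp_smoothFun_frontier {Ω : Set (E d)} (hb : Bornology.IsBounded Ω)
    (hfin : IsFiniteMeasure (surf (frontier Ω))) (w : smoothFun d) :
    MemLp (w : E d → ℝ) 2 (surf (frontier Ω)) :=
  memLp_of_continuous_of_isBounded (smoothFun.contDiff w).continuous
    isClosed_frontier.measurableSet (hb.closure.subset frontier_subset_closure) _ _

/-- The boundary values of smooth functions, as a map into `L²(∂Ω)`. -/
noncomputable def smoothToBdry (Ω : Set (E d)) (hb : Bornology.IsBounded Ω)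
    (hfin : IsFiniteMeasure (surf (frontier Ω))) :
    smoothFun d →ₗ[ℝ] Lp ℝ 2 (surf (frontier Ω)) where
  toFun w := (memLp_smoothFun_frontier hb hfin w).toLp _
  map_add' _ _ := MemLp.toLp_add _ _
  map_smul' _ _ := MemLp.toLp_const_smul _ _

theorem smoothToBdry_ae (Ω : Set (E d)) (hb : Bornology.IsBounded Ω)
    (hfin : IsFiniteMeasure (surf (frontier Ω))) (w : smoothFun d) :
    smoothToBdry Ω hb hfin w =ᵐ[surf (frontier Ω)] (w : E d → ℝ) :=
  (memLp_smoothFun_frontier hb hfin w).coeFn_toLp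

theorem exists_norm_smoothToBdry_le {Ω : Set (E d)} (hΩ : IsOpen Ω) (hb : Bornology.IsBounded Ω)
    (hL : HasLipschitzBoundary Ω) (hfin : IsFiniteMeasure (surf (frontier Ω))) :
    ∃ C : ℝ, ∀ w, ‖smoothToBdry Ω hb hfin w‖ ≤ C * ‖smoothToH1 hΩ hb w‖ := by
  obtain ⟨C, hC, h⟩ := exists_trace_inequality hΩ hb hL
  refine ⟨√C.toReal, fun w => ?_⟩
  have hw := h w ((smoothFun.contDiff w).of_le (by simp))
  have e1 : ∫⁻ y, ENNReal.ofReal ((w : E d → ℝ) y ^ 2) ∂(surf (frontier Ω))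
      = ENNReal.ofReal (‖smoothToBdry Ω hb hfin w‖ ^ 2) := by
    rw [Lp_norm_sq_eq_integral, ofReal_integral_eq_lintegral_ofReal]
    · refine lintegral_congr_ae ?_
      filter_upwards [smoothToBdry_ae Ω hb hfin w] with x hx
      rw [hx, Real.norm_eq_abs, sq_abs]
    · exact (Lp.memLp _).integrable_norm_pow two_ne_zero
    · exact Eventually.of_forall fun x => by positivity
  have e2 : ∫⁻ y in Ω, ENNReal.ofReal ((w : E d → ℝ) y ^ 2 + ‖fderiv ℝ (w : E d → ℝ) y‖ ^ 2)
      = ENNReal.ofReal (‖smoothToH1 hΩ hb w‖ ^ 2) := by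
    have i1 : Integrable (fun x => ‖H1.val (smoothToH1 hΩ hb w) x‖ ^ 2) (vol Ω) :=
      (Lp.memLp _).integrable_norm_pow two_ne_zero
    have i2 : Integrable (fun x => ‖H1.grad (smoothToH1 hΩ hb w) x‖ ^ 2) (vol Ω) :=
      (Lp.memLp _).integrable_norm_pow two_ne_zero
    rw [H1.norm_sq, Lp_norm_sq_eq_integral, Lp_norm_sq_eq_integral, ← integral_add i1 i2,
      ofReal_integral_eq_lintegral_ofReal (i1.fun_add i2)]
    · refine lintegral_congr_ae ?_
      filter_upwards [val_smoothToH1 hΩ hb w, grad_smoothToH1 hΩ hb w] with x hx hx'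
      rw [hx, hx', Real.norm_eq_abs, sq_abs, gradient, LinearIsometryEquiv.norm_map]
    · exact Eventually.of_forall fun x => by positivity
  rw [e1, e2] at hw
  have hw' : ‖smoothToBdry Ω hb hfin w‖ ^ 2 ≤ C.toReal * ‖smoothToH1 hΩ hb w‖ ^ 2 := by
    rw [← ENNReal.ofReal_toReal hC, ← ENNReal.ofReal_mul ENNReal.toReal_nonneg] at hw
    exact (ENNReal.ofReal_le_ofReal_iff (by positivity)).1 hw
  rw [← Real.sqrt_sq (norm_nonneg (smoothToBdry Ω hb hfin w)),
    ← Real.sqrt_sq (norm_nonneg (smoothToH1 hΩ hb w)), ← Real.sqrt_mul ENNReal.toReal_nonneg]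
  exact Real.sqrt_le_sqrt hw'

/-- The trace operator exists: the boundary values of smooth functions are extended to the closure
of the smooth functions in `H¹(Ω)` by continuity, and by zero to its orthogonal complement. -/
theorem isTraceOperator_trace {Ω : Set (E d)} (hΩ : IsOpen Ω) (hb : Bornology.IsBounded Ω)
    (hL : HasLipschitzBoundary Ω) : IsTraceOperator Ω (trace Ω) := by
  have hfin := isFiniteMeasure_surf_frontier hΩ hb hL
  have hex : ∃ R, IsTraceOperator Ω R := by
    let M := (LinearMap.range (smoothToH1 hΩ hb)).topologicalClosure
    have hmem : ∀ w, smoothToH1 hΩ hb w ∈ M := fun w =>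
      Submodule.le_topologicalClosure _ (LinearMap.mem_range_self _ w)
    let e : smoothFun d →ₗ[ℝ] M := (smoothToH1 hΩ hb).codRestrict M hmem
    have : CompleteSpace M := Submodule.topologicalClosure.completeSpace _
    have hdense : DenseRange e := by
      intro x
      rw [closure_subtype]
      have hx : (x : H1 Ω) ∈ closure (LinearMap.range (smoothToH1 hΩ hb) : Set (H1 Ω)) := x.2
      refine closure_mono ?_ hx
      rintro _ ⟨w, rfl⟩
      exact ⟨e w, mem_range_self w, rfl⟩
    obtain ⟨C, hC⟩ := exists_norm_smoothToBdry_le hΩ hb hL hfin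
    refine ⟨((smoothToBdry Ω hb hfin).extendOfNorm e).comp M.orthogonalProjectionOnto, ?_⟩
    intro w hw u hu
    let w' : smoothFun d := ⟨w, hw⟩
    have hu' : u = smoothToH1 hΩ hb w' :=
      H1.ext_val hΩ hb (Lp.ext (hu.trans (val_smoothToH1 hΩ hb w').symm))
    have hproj : M.orthogonalProjectionOnto u = e w' := by
      rw [hu']
      exact Submodule.orthogonalProjectionOnto_mem_subspace_eq_self (e w')
    rw [ContinuousLinearMap.comp_apply, hproj, LinearMap.extendOfNorm_eq hdense ⟨C, hC⟩]
    exact smoothToBdry_ae Ω hb hfin w'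
  rw [trace, dif_pos hex]
  exact hex.choose_spec

/-! ### Functions with vanishing weak gradient -/

/-- The derivative of a mollification, as the integral of the function against a test function. -/
theorem fderiv_convolution_normed_apply (φ : ContDiffBump (0 : E d)) {U : E d → ℝ}
    (hU : LocallyIntegrable U volume) (x e : E d) :
    fderiv ℝ (convolution (φ.normed volume) U (ContinuousLinearMap.lsmul ℝ ℝ) volume) x e
      = - ∫ y, U y * fderiv ℝ (fun y => φ.normed volume (x - y)) y e := by
  have hφ : ContDiff ℝ 1 (φ.normed (volume : Measure (E d))) := φ.contDiff_normed
  have h1 := φ.hasCompactSupport_normed.hasFDerivAt_convolution_left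
    (ContinuousLinearMap.lsmul ℝ ℝ) hφ hU x
  have h2 : Integrable (fun t => (ContinuousLinearMap.precompL (E d) (ContinuousLinearMap.lsmul ℝ ℝ))
      (fderiv ℝ (φ.normed (volume : Measure (E d))) (x - t)) (U t)) :=
    (convolutionExistsAt_iff_integrable_swap).1
      ((φ.hasCompactSupport_normed.fderiv ℝ).convolutionExists_left _
      (hφ.continuous_fderiv one_ne_zero) hU x)
  rw [h1.fderiv, convolution_eq_swap, ContinuousLinearMap.integral_apply h2, ← integral_neg]
  refine integral_congr_ae (Eventually.of_forall fun y => ?_)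
  have h3 : HasFDerivAt (fun y => φ.normed volume (x - y))
      ((fderiv ℝ (φ.normed (volume : Measure (E d))) (x - y)).comp (-ContinuousLinearMap.id ℝ (E d)))
      y := by
    have h4 : HasFDerivAt (fun y : E d => x - y) (-ContinuousLinearMap.id ℝ (E d)) y :=
      (hasFDerivAt_id y).const_sub x
    exact ((hφ.differentiable one_ne_zero).differentiableAt.hasFDerivAt).comp y h4
  simp only [h3.fderiv, ContinuousLinearMap.precompL_apply]
  simp [mul_comm]

/-- A function with vanishing weak gradient is constant on balls: its mollifications are. -/
theorem exists_ae_eq_const_on_ball {Ω : Set (E d)} (hΩ : IsOpen Ω) (hb : Bornology.IsBounded Ω)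
    {u : H1 Ω} (hu : H1.grad u = 0) {x : E d} {r : ℝ} (hr : 0 < r)
    (hball : Metric.closedBall x (2 * r) ⊆ Ω) :
    ∃ c : ℝ, ∀ᵐ y, y ∈ Metric.ball x r → H1.val u y = c := by
  have := isFiniteMeasure_vol hb
  let U : E d → ℝ := Ω.indicator (H1.val u)
  have hUi : Integrable U := by
    rw [integrable_indicator_iff hΩ.measurableSet]
    exact (Lp.memLp (H1.val u)).integrable (by norm_num)
  let φ : ℕ → ContDiffBump (0 : E d) := fun n =>
    { rIn := r / (n + 1) / 2, rOut := r / (n + 1), rIn_pos := by positivity,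
      rIn_lt_rOut := half_lt_self (by positivity) }
  have hφ0 : Tendsto (fun n => (φ n).rOut) atTop (𝓝 0) := by
    have := tendsto_one_div_add_atTop_nhds_zero_nat.const_mul r
    simpa [φ, div_eq_mul_inv] using this
  have hφK : ∀ᶠ n in atTop, (φ n).rOut ≤ 2 * (φ n).rIn :=
    Eventually.of_forall fun n => by simp only [φ]; linarith
  have hlim := ContDiffBump.ae_convolution_tendsto_right_of_locallyIntegrable hφ0 hφK
    hUi.locallyIntegrable
  set un : ℕ → E d → ℝ := fun n =>
    convolution ((φ n).normed volume) U (ContinuousLinearMap.lsmul ℝ ℝ) volume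
  have hconst : ∀ n, ∀ y ∈ Metric.ball x r, ∀ z ∈ Metric.ball x r, un n y = un n z := by
    intro n y hy z hz
    have hcd : ContDiff ℝ 1 (un n) :=
      (φ n).hasCompactSupport_normed.contDiff_convolution_left _ (φ n).contDiff_normed
        hUi.locallyIntegrable
    refine Metric.isOpen_ball.is_const_of_fderiv_eq_zero (𝕜 := ℝ)
      (convex_ball x r).isPreconnected (hcd.differentiable one_ne_zero).differentiableOn ?_ hy hz
    intro a ha
    ext e
    rw [fderiv_convolution_normed_apply _ hUi.locallyIntegrable]
    let ψ : E d → ℝ := fun y => (φ n).normed volume (a - y)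
    have hψ : ContDiff ℝ ∞ ψ :=
      (ContDiffBump.contDiff_normed (φ n) (n := ⊤)).comp (contDiff_const.sub contDiff_id)
    have hsupp : Function.support ψ ⊆ Metric.closedBall x (2 * r) := by
      intro y hy
      have h1 : a - y ∈ Metric.ball (0 : E d) (φ n).rOut := by
        rw [← ContDiffBump.support_normed_eq (φ n) (μ := volume)]; exact hy
      have h2 : (φ n).rOut ≤ r := by
        simp only [φ]
        exact div_le_self hr.le (by simp)
      rw [mem_ball_zero_iff, ← dist_eq_norm] at h1
      rw [Metric.mem_closedBall]
      have h3 := dist_triangle_left y x a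
      have h4 : dist a x < r := ha
      linarith
    have hts : tsupport ψ ⊆ Metric.closedBall x (2 * r) :=
      closure_minimal hsupp Metric.isClosed_closedBall
    have hψc : HasCompactSupport ψ :=
      (isCompact_closedBall x (2 * r)).of_isClosed_subset (isClosed_tsupport ψ) hts
    have h5 := u.2 ψ hψ hψc (hts.trans hball) e
    have h6 : ∫ x in Ω, inner ℝ (u.1.snd x) e * ψ x = 0 := by
      refine integral_eq_zero_of_ae ?_
      have h7 : u.1.snd = 0 := hu
      rw [h7]
      filter_upwards [Lp.coeFn_zero (E d) 2 (vol Ω)] with x hx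
      rw [hx]; simp
    rw [h6, neg_zero, ← integral_indicator hΩ.measurableSet] at h5
    have h8 : ∫ y, U y * fderiv ℝ ψ y e = 0 := by
      rw [← h5]
      refine integral_congr_ae (Eventually.of_forall fun y => ?_)
      by_cases hy : y ∈ Ω
      · simp only [U, indicator_of_mem hy]; rfl
      · simp only [U, indicator_of_notMem hy, zero_mul]
    rw [h8]; simp
  -- compare with the value at one point where the mollifications converge
  have hex : ∃ y₀ ∈ Metric.ball x r, Tendsto (fun n => un n y₀) atTop (𝓝 (U y₀)) := by
    by_contra! hno
    have h1 : volume (Metric.ball x r) = 0 :=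
      measure_mono_null (fun y hy => hno y hy) (ae_iff.1 hlim)
    exact (Metric.measure_ball_pos volume x hr).ne' h1
  obtain ⟨y₀, hy₀, hlim₀⟩ := hex
  refine ⟨U y₀, ?_⟩
  filter_upwards [hlim] with y hy hyB
  have hyΩ : y ∈ Ω := hball (Metric.ball_subset_closedBall
    (Metric.ball_subset_ball (by linarith) hyB))
  have h1 : Tendsto (fun n => un n y) atTop (𝓝 (U y₀)) :=
    hlim₀.congr fun n => hconst n y₀ hy₀ y hyB
  have h2 := tendsto_nhds_unique hy h1
  simpa [U, indicator_of_mem hyΩ] using h2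

theorem exists_ae_eq_const_of_grad_eq_zero {Ω : Set (E d)} (hΩ : IsOpen Ω)
    (hb : Bornology.IsBounded Ω) (hc : IsConnected Ω) {u : H1 Ω} (hu : H1.grad u = 0) :
    ∃ c : ℝ, H1.val u =ᵐ[vol Ω] fun _ => c := by
  let V : ℝ → Set (E d) := fun c =>
    {x | ∃ r > 0, ∀ᵐ y, y ∈ Metric.ball x r → H1.val u y = c}
  have hVo : ∀ c, IsOpen (V c) := by
    intro c
    rw [Metric.isOpen_iff]
    rintro x ⟨r, hr, h⟩
    refine ⟨r / 2, half_pos hr, fun z hz => ⟨r / 2, half_pos hr, ?_⟩⟩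
    filter_upwards [h] with y hy hyz
    refine hy ?_
    rw [Metric.mem_ball] at hz hyz ⊢
    linarith [dist_triangle y z x]
  have hVd : ∀ c c' x, x ∈ V c → x ∈ V c' → c = c' := by
    rintro c c' x ⟨r, hr, h⟩ ⟨r', hr', h'⟩
    by_contra hne
    have h1 : volume (Metric.ball x (min r r')) = 0 := by
      refine measure_mono_null (fun y hy => ?_) (ae_iff.1 (h.and h'))
      intro hyy
      exact hne ((hyy.1 (Metric.ball_subset_ball (min_le_left _ _) hy)).symm.trans
        (hyy.2 (Metric.ball_subset_ball (min_le_right _ _) hy)))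
    exact (Metric.measure_ball_pos volume x (lt_min hr hr')).ne' h1
  have hcov : ∀ x ∈ Ω, ∃ c, x ∈ V c := by
    intro x hx
    obtain ⟨ε, hε, hεΩ⟩ := Metric.isOpen_iff.1 hΩ x hx
    have hsub : Metric.closedBall x (2 * (ε / 4)) ⊆ Ω :=
      (Metric.closedBall_subset_ball (by linarith)).trans hεΩ
    obtain ⟨c, h⟩ := exists_ae_eq_const_on_ball hΩ hb hu (by positivity) hsub
    exact ⟨c, ε / 4, by positivity, h⟩
  obtain ⟨x₀, hx₀⟩ := hc.nonempty
  obtain ⟨c, hxc⟩ := hcov x₀ hx₀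
  refine ⟨c, ?_⟩
  have hsub : Ω ⊆ V c := by
    refine hc.isPreconnected.subset_left_of_subset_union (hVo c)
      (isOpen_biUnion (s := {c' | c' ≠ c}) fun c' _ => hVo c') ?_ ?_ ⟨x₀, hx₀, hxc⟩
    · rw [Set.disjoint_left]
      intro x hx hx'
      obtain ⟨c', hc', hxc'⟩ := mem_iUnion₂.1 hx'
      exact hc' (hVd _ _ x hxc' hx)
    · intro x hx
      obtain ⟨c', hc'⟩ := hcov x hx
      by_cases h : c' = c
      · exact Or.inl (h ▸ hc')
      · exact Or.inr (mem_iUnion₂.2 ⟨c', h, hc'⟩)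
  rw [EventuallyEq, ae_restrict_iff' hΩ.measurableSet, ae_iff]
  refine measure_null_of_locally_null _ fun x hx => ?_
  have hxΩ : x ∈ Ω := by
    by_contra h
    exact hx fun h' => absurd h' h
  obtain ⟨r, hr, h⟩ := hsub hxΩ
  refine ⟨_, inter_mem self_mem_nhdsWithin
    (mem_nhdsWithin_of_mem_nhds (Metric.ball_mem_nhds x hr)), ?_⟩
  refine measure_mono_null (fun y hy => ?_) (ae_iff.1 h)
  exact fun h' => hy.1 fun _ => h' hy.2

end TwoPhase

/-! ### The saturation as a function of the chemical potential -/

namespace TwoPhase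

namespace Model

variable {d : ℕ} {D : Model d}

/-- The conditions on the energy parameters at the point `x`. -/
structure EnergyConvexAt (D : Model d) (cmin : ℝ) (x : E d) : Prop where
  γw_pos : 0 < D.γw x
  γn_pos : 0 < D.γn x
  convex : ∀ s ∈ Ioo (0 : ℝ) 1, cmin ≤ D.γw x / s + D.γn x / (1 - s) - 2 * D.γwn x

theorem EnergyAssumptionOn.ae_convexAt {cmin : ℝ} {ν : Measure (E d)}
    (h : D.EnergyAssumptionOn cmin ν) : ∀ᵐ x ∂ν, D.EnergyConvexAt cmin x := by
  filter_upwards [h.pos, h.convex] with x h1 h2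
  exact ⟨h1.1, h1.2.1, h2⟩

theorem hasDerivAt_chemPot (x : E d) {s : ℝ} (hs : s ∈ Ioo (0 : ℝ) 1) :
    HasDerivAt (D.chemPot x) (D.γw x / s + D.γn x / (1 - s) - 2 * D.γwn x) s := by
  have hs1 : (1 : ℝ) - s ≠ 0 := by have := hs.2; intro h; linarith
  have h1 : HasDerivAt (fun s : ℝ => 1 - s) (-1) s := (hasDerivAt_id s).const_sub 1
  have h2 := (Real.hasDerivAt_log hs.1.ne').const_mul (D.γw x)
  have h3 := (h1.log hs1).const_mul (D.γn x)
  have h4 : HasDerivAt (fun s : ℝ => D.γwn x * (1 - 2 * s)) (D.γwn x * -(2 * 1)) s :=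
    (((hasDerivAt_id s).const_mul 2).const_sub 1).const_mul _
  refine ((h2.sub h3).add h4).congr_deriv ?_
  field_simp
  ring

theorem continuousOn_chemPot (x : E d) : ContinuousOn (D.chemPot x) (Ioo 0 1) :=
  fun _ hs => (hasDerivAt_chemPot x hs).continuousAt.continuousWithinAt

namespace EnergyConvexAt

variable {cmin : ℝ} {x : E d}

theorem mul_sub_le (h : D.EnergyConvexAt cmin x) {a b : ℝ} (ha : a ∈ Ioo (0 : ℝ) 1)
    (hb : b ∈ Ioo (0 : ℝ) 1) (hab : a ≤ b) :
    cmin * (b - a) ≤ D.chemPot x b - D.chemPot x a := by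
  refine (convex_Ioo 0 1).mul_sub_le_image_sub_of_le_deriv (continuousOn_chemPot x) ?_ ?_
    a ha b hb hab
  · rw [interior_Ioo]
    exact fun s hs => (hasDerivAt_chemPot x hs).differentiableAt.differentiableWithinAt
  · rw [interior_Ioo]
    intro s hs
    rw [(hasDerivAt_chemPot x hs).deriv]
    exact h.convex s hs

theorem surjOn_chemPot (h : D.EnergyConvexAt cmin x) : SurjOn (D.chemPot x) (Ioo 0 1) univ := by
  refine ContinuousOn.surjOn_of_tendsto ⟨1 / 2, by norm_num⟩ (continuousOn_chemPot x) ?_ ?_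
  · rw [tendsto_comp_coe_Ioo_atBot zero_lt_one]
    have h1 : Tendsto (fun s => D.γw x * Real.log s) (𝓝[>] 0) atBot :=
      Real.tendsto_log_nhdsGT_zero.const_mul_atBot h.γw_pos
    have h2 : Tendsto (fun s => -(D.γn x * Real.log (1 - s)) + D.γwn x * (1 - 2 * s)) (𝓝[>] 0)
        (𝓝 (-(D.γn x * Real.log (1 - 0)) + D.γwn x * (1 - 2 * 0))) := by
      refine Tendsto.mono_left (ContinuousAt.tendsto ?_) nhdsWithin_le_nhds
      have : ContinuousAt (fun s : ℝ => Real.log (1 - s)) 0 :=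
        ContinuousAt.log (by fun_prop) (by norm_num)
      fun_prop
    refine (h1.atBot_add h2).congr fun s => ?_
    simp only [chemPot]; ring
  · rw [tendsto_comp_coe_Ioo_atTop zero_lt_one]
    have h0 : Tendsto (fun s : ℝ => 1 - s) (𝓝[<] 1) (𝓝[>] 0) := by
      refine tendsto_nhdsWithin_iff.2 ⟨?_, ?_⟩
      · have : Tendsto (fun s : ℝ => 1 - s) (𝓝 1) (𝓝 (1 - 1)) := by
          exact (continuous_const.sub continuous_id).tendsto 1
        rw [sub_self] at this
        exact this.mono_left nhdsWithin_le_nhds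
      · filter_upwards [self_mem_nhdsWithin] with s hs
        exact mem_Ioi.2 (sub_pos.2 (mem_Iio.1 hs))
    have h1 : Tendsto (fun s => -(D.γn x * Real.log (1 - s))) (𝓝[<] 1) atTop :=
      tendsto_neg_atBot_atTop.comp
        ((Real.tendsto_log_nhdsGT_zero.comp h0).const_mul_atBot h.γn_pos)
    have h2 : Tendsto (fun s => D.γw x * Real.log s + D.γwn x * (1 - 2 * s)) (𝓝[<] 1)
        (𝓝 (D.γw x * Real.log 1 + D.γwn x * (1 - 2 * 1))) := by
      refine Tendsto.mono_left (ContinuousAt.tendsto ?_) nhdsWithin_le_nhds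
      have : ContinuousAt (fun s : ℝ => Real.log s) 1 :=
        ContinuousAt.log (by fun_prop) (by norm_num)
      fun_prop
    refine (h1.atTop_add h2).congr fun s => ?_
    simp only [chemPot]; ring

theorem satOp_mem (h : D.EnergyConvexAt cmin x) (μ : ℝ) : D.satOp x μ ∈ Ioo (0 : ℝ) 1 :=
  Function.invFunOn_mem (h.surjOn_chemPot (mem_univ μ))

theorem chemPot_satOp (h : D.EnergyConvexAt cmin x) (μ : ℝ) : D.chemPot x (D.satOp x μ) = μ :=
  Function.invFunOn_eq (h.surjOn_chemPot (mem_univ μ))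

theorem lt_satOp_iff (h : D.EnergyConvexAt cmin x) (hc : 0 < cmin) {s : ℝ}
    (hs : s ∈ Ioo (0 : ℝ) 1) (μ : ℝ) : s < D.satOp x μ ↔ D.chemPot x s < μ := by
  have hm := h.satOp_mem μ
  have he := h.chemPot_satOp μ
  constructor
  · intro hlt
    have h1 := h.mul_sub_le hs hm hlt.le
    have h2 : 0 < cmin * (D.satOp x μ - s) := mul_pos hc (sub_pos.2 hlt)
    linarith
  · intro hlt
    by_contra hle
    rw [not_lt] at hle
    have h1 := h.mul_sub_le hm hs hle
    have h2 : 0 ≤ cmin * (s - D.satOp x μ) := mul_nonneg hc.le (sub_nonneg.2 hle)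
    linarith

/-- The saturation is a Lipschitz function of the chemical potential. -/
theorem continuous_satOp (h : D.EnergyConvexAt cmin x) (hc : 0 < cmin) :
    Continuous (D.satOp x) := by
  have hle : ∀ μ μ', D.satOp x μ' ≤ D.satOp x μ →
      cmin * (D.satOp x μ - D.satOp x μ') ≤ μ - μ' := by
    intro μ μ' hab
    have h1 := h.mul_sub_le (h.satOp_mem μ') (h.satOp_mem μ) hab
    rwa [h.chemPot_satOp, h.chemPot_satOp] at h1
  refine (LipschitzWith.of_dist_le_mul (K := (1 / cmin).toNNReal) fun μ μ' => ?_).continuous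
  rw [Real.coe_toNNReal _ (by positivity), Real.dist_eq, Real.dist_eq, div_mul_eq_mul_div, one_mul,
    le_div_iff₀ hc, mul_comm]
  rcases le_total (D.satOp x μ') (D.satOp x μ) with hab | hab
  · rw [abs_of_nonneg (sub_nonneg.2 hab)]
    exact (hle _ _ hab).trans (le_abs_self _)
  · rw [abs_sub_comm, abs_of_nonneg (sub_nonneg.2 hab), abs_sub_comm]
    exact (hle _ _ hab).trans (le_abs_self _)

theorem tendsto_satOp_atTop (h : D.EnergyConvexAt cmin x) (hc : 0 < cmin) :
    Tendsto (D.satOp x) atTop (𝓝 1) := by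
  rw [tendsto_order]
  refine ⟨fun s hs => ?_, fun s hs => Eventually.of_forall fun μ => (h.satOp_mem μ).2.trans hs⟩
  have hs' : max s (1 / 2) ∈ Ioo (0 : ℝ) 1 :=
    ⟨lt_max_of_lt_right (by norm_num), max_lt hs (by norm_num)⟩
  filter_upwards [eventually_gt_atTop (D.chemPot x (max s (1 / 2)))] with μ hμ
  exact (le_max_left _ _).trans_lt ((h.lt_satOp_iff hc hs' μ).2 hμ)

theorem tendsto_satOp_atBot (h : D.EnergyConvexAt cmin x) (hc : 0 < cmin) :
    Tendsto (D.satOp x) atBot (𝓝 0) := by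
  rw [tendsto_order]
  refine ⟨fun s hs => Eventually.of_forall fun μ => hs.trans (h.satOp_mem μ).1, fun s hs => ?_⟩
  have hs' : min (s / 2) (1 / 2) ∈ Ioo (0 : ℝ) 1 :=
    ⟨lt_min (by linarith) (by norm_num), min_lt_of_right_lt (by norm_num)⟩
  filter_upwards [eventually_le_atBot (D.chemPot x (min (s / 2) (1 / 2)))] with μ hμ
  have h1 : D.satOp x μ ≤ min (s / 2) (1 / 2) := by
    rw [← not_lt, h.lt_satOp_iff hc hs', not_lt]; exact hμ
  exact (h1.trans (min_le_left _ _)).trans_lt (by linarith)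

end EnergyConvexAt

/-- The saturation is measurable: its superlevel sets are `{x | chemPot x s < u x}` up to null
sets. -/
theorem EnergyAssumptionOn.aemeasurable_satOp {cmin : ℝ} {ν : Measure (E d)}
    (h : D.EnergyAssumptionOn cmin ν) (hc : 0 < cmin) {u : E d → ℝ} (hu : AEMeasurable u ν) :
    AEMeasurable (fun x => D.satOp x (u x)) ν := by
  refine NullMeasurable.aemeasurable ?_
  have hae := h.ae_convexAt
  refine measurable_of_Ioi (δ := NullMeasurableSpace (E d) ν) fun s => ?_
  change NullMeasurableSet {x | s < D.satOp x (u x)} ν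
  rcases le_or_gt s 0 with h0 | h0
  · refine (nullMeasurableSet_univ (μ := ν)).congr (eventuallyEq_set.2 ?_)
    filter_upwards [hae] with x hx
    exact ⟨fun _ => h0.trans_lt (hx.satOp_mem _).1, fun _ => trivial⟩
  rcases le_or_gt 1 s with h1 | h1
  · refine (nullMeasurableSet_empty (μ := ν)).congr (eventuallyEq_set.2 ?_)
    filter_upwards [hae] with x hx
    exact ⟨fun hf => absurd hf (notMem_empty x), fun hf =>
      absurd ((show s < D.satOp x (u x) from hf).trans (hx.satOp_mem _).2) (not_lt.2 h1)⟩
  · have hm : AEMeasurable (fun x => D.chemPot x s) ν := by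
      have m1 := h.γw_memLp.1.aemeasurable
      have m2 := h.γn_memLp.1.aemeasurable
      have m3 := h.γwn_memLp.1.aemeasurable
      exact ((m1.mul_const _).sub (m2.mul_const _)).add (m3.mul_const _)
    refine (nullMeasurableSet_lt hm hu).congr (eventuallyEq_set.2 ?_)
    filter_upwards [hae] with x hx
    exact (hx.lt_satOp_iff hc ⟨h0, h1⟩ _).symm

/-! ### Truncated functions of the saturation -/

theorem clamp_mem (hS : D.Sε < 1 / 2) (s : ℝ) :
    max D.Sε (min s (1 - D.Sε)) ∈ Icc D.Sε (1 - D.Sε) :=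
  ⟨le_max_left _ _, max_le (by linarith) (min_le_right _ _)⟩

theorem Icc_residual_subset (h0 : 0 < D.Sε) : Icc D.Sε (1 - D.Sε) ⊆ Icc 0 1 :=
  Icc_subset_Icc h0.le (by linarith)

theorem continuous_trunc (h0 : 0 < D.Sε) (hS : D.Sε < 1 / 2) {f : ℝ → ℝ}
    (hf : ContinuousOn f (Icc 0 1)) : Continuous (D.trunc f) :=
  hf.comp_continuous (by fun_prop) fun s => Icc_residual_subset h0 (clamp_mem hS s)

theorem trunc_zero (h0 : 0 < D.Sε) (hS : D.Sε < 1 / 2) (f : ℝ → ℝ) :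
    D.trunc f 0 = f D.Sε := by
  rw [trunc, min_eq_left (by linarith), max_eq_left h0.le]

theorem trunc_one (h0 : 0 < D.Sε) (hS : D.Sε < 1 / 2) (f : ℝ → ℝ) :
    D.trunc f 1 = f (1 - D.Sε) := by
  rw [trunc, min_eq_right (by linarith), max_eq_right (by linarith)]

theorem exists_pos_le_trunc (h0 : 0 < D.Sε) (hS : D.Sε < 1 / 2) {f : ℝ → ℝ}
    (hf : ContinuousOn f (Icc 0 1)) (hpos : ∀ s ∈ Ioo (0 : ℝ) 1, 0 < f s) :
    ∃ c > 0, ∀ s, c ≤ D.trunc f s := by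
  obtain ⟨s₀, hs₀, hmin⟩ := isCompact_Icc.exists_isMinOn
    (⟨_, clamp_mem hS 0⟩ : (Icc D.Sε (1 - D.Sε)).Nonempty) (hf.mono (Icc_residual_subset h0))
  exact ⟨f s₀, hpos s₀ ⟨h0.trans_le hs₀.1, by linarith [hs₀.2]⟩,
    fun s => hmin (clamp_mem hS s)⟩

end Model

end TwoPhase

/-! ### Integrals with a coefficient that depends on the saturation -/

namespace TwoPhase

namespace Model

variable {d : ℕ} {D : Model d}

section Coefficient

variable {cmin : ℝ} {ν : Measure (E d)}

theorem exists_bound_sat (hE : D.EnergyAssumptionOn cmin ν) {F : ℝ → ℝ} (hF : Continuous F) :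
    ∃ C : ℝ, 0 ≤ C ∧ ∀ᵐ x ∂ν, ∀ μ, |F (D.satOp x μ)| ≤ C := by
  obtain ⟨C, hC⟩ := (isCompact_Icc (a := (0 : ℝ)) (b := 1)).exists_bound_of_continuousOn
    hF.continuousOn
  refine ⟨C, (norm_nonneg _).trans (hC 0 (by simp)), ?_⟩
  filter_upwards [hE.ae_convexAt] with x hx μ
  exact hC _ (Ioo_subset_Icc_self (hx.satOp_mem μ))

theorem memLp_sat (hE : D.EnergyAssumptionOn cmin ν) (hc : 0 < cmin) {F : ℝ → ℝ}
    (hF : Continuous F) {u : E d → ℝ} (hu : AEMeasurable u ν) :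
    MemLp (fun x => F (D.satOp x (u x))) ⊤ ν := by
  obtain ⟨C, -, hC⟩ := exists_bound_sat hE hF
  refine memLp_top_of_bound
    (hF.measurable.comp_aemeasurable (hE.aemeasurable_satOp hc hu)).aestronglyMeasurable C ?_
  filter_upwards [hC] with x hx
  exact hx _

theorem exists_bound_integral_sat (hE : D.EnergyAssumptionOn cmin ν) {F : ℝ → ℝ}
    (hF : Continuous F) {g : E d → ℝ} (hg : Integrable g ν) :
    ∃ C : ℝ, ∀ u : E d → ℝ, |∫ x, F (D.satOp x (u x)) * g x ∂ν| ≤ C := by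
  obtain ⟨C, -, hC⟩ := exists_bound_sat hE hF
  refine ⟨∫ x, C * |g x| ∂ν, fun u => ?_⟩
  rw [← Real.norm_eq_abs]
  refine norm_integral_le_of_norm_le (hg.abs.const_mul C) ?_
  filter_upwards [hC] with x hx
  rw [norm_mul]
  exact mul_le_mul_of_nonneg_right (hx _) (abs_nonneg _)

theorem tendsto_integral_sat (hE : D.EnergyAssumptionOn cmin ν) (hc : 0 < cmin) {F : ℝ → ℝ}
    (hF : Continuous F) {g : E d → ℝ} (hg : Integrable g ν) {u : ℕ → E d → ℝ}
    (hu : ∀ n, AEMeasurable (u n) ν) {s : E d → ℝ}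
    (hs : ∀ᵐ x ∂ν, Tendsto (fun n => D.satOp x (u n x)) atTop (𝓝 (s x))) :
    Tendsto (fun n => ∫ x, F (D.satOp x (u n x)) * g x ∂ν) atTop (𝓝 (∫ x, F (s x) * g x ∂ν)) := by
  obtain ⟨C, -, hC⟩ := exists_bound_sat hE hF
  refine tendsto_integral_of_dominated_convergence (fun x => C * |g x|)
    (fun n => (memLp_sat hE hc hF (hu n)).1.mul hg.1) (hg.abs.const_mul C) (fun n => ?_) ?_
  · filter_upwards [hC] with x hx
    rw [norm_mul]
    exact mul_le_mul_of_nonneg_right (hx _) (abs_nonneg _)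
  · filter_upwards [hs] with x hx
    exact ((hF.tendsto _).comp hx).mul_const _

end Coefficient

/-! ### Finite-dimensional families in `L²` -/

section Coordinates

variable {ι : Type*} [Fintype ι] {ν : Measure (E d)}

theorem ae_eq_sum_coord [DecidableEq ι] (T : EuclideanSpace ℝ ι →ₗ[ℝ] Lp ℝ 2 ν)
    (x : EuclideanSpace ℝ ι) :
    T x =ᵐ[ν] fun q => ∑ i, x i * T (EuclideanSpace.single i 1) q := by
  have h1 : T x = ∑ i, x i • T (EuclideanSpace.single i 1) := by
    conv_lhs => rw [← (EuclideanSpace.basisFun ι ℝ).sum_repr x, map_sum]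
    simp
  rw [h1]
  have h2 : ∀ i, (x i • T (EuclideanSpace.single i 1) : Lp ℝ 2 ν) =ᵐ[ν]
      fun q => x i * T (EuclideanSpace.single i 1) q := fun i => by
    filter_upwards [Lp.coeFn_smul (x i) (T (EuclideanSpace.single i 1))] with q hq
    rw [hq, Pi.smul_apply, smul_eq_mul]
  have h3 := Lp.coeFn_finsetSum Finset.univ fun i => x i • T (EuclideanSpace.single i 1)
  filter_upwards [h3, ae_all_iff.2 h2] with q h4 h5
  rw [h4, Finset.sum_apply]
  exact Finset.sum_congr rfl fun i _ => h5 i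

theorem ae_tendsto_add_apply (w : Lp ℝ 2 ν) (T : EuclideanSpace ℝ ι →ₗ[ℝ] Lp ℝ 2 ν)
    {x : ℕ → EuclideanSpace ℝ ι} {x₀ : EuclideanSpace ℝ ι} (hx : Tendsto x atTop (𝓝 x₀)) :
    ∀ᵐ q ∂ν, Tendsto (fun n => (w + T (x n)) q) atTop (𝓝 ((w + T x₀) q)) := by
  classical
  have h1 : ∀ z, ∀ᵐ q ∂ν, (w + T z) q = w q + ∑ i, z i * T (EuclideanSpace.single i 1) q := by
    intro z
    filter_upwards [Lp.coeFn_add w (T z), ae_eq_sum_coord T z] with q h2 h3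
    rw [h2, Pi.add_apply, h3]
  filter_upwards [ae_all_iff.2 fun n => h1 (x n), h1 x₀] with q h2 h3
  simp only [h2, h3]
  refine tendsto_const_nhds.add (tendsto_finsetSum _ fun i _ => ?_)
  have h4 : Tendsto (fun n => x n i) atTop (𝓝 (x₀ i)) :=
    ((EuclideanSpace.proj (𝕜 := ℝ) i).continuous.tendsto x₀).comp hx
  exact h4.mul_const _

theorem ae_exists_tendsto_add_smul (w : Lp ℝ 2 ν) (T : EuclideanSpace ℝ ι →ₗ[ℝ] Lp ℝ 2 ν)
    {t : ℕ → ℝ} {y : ℕ → EuclideanSpace ℝ ι} {y₀ : EuclideanSpace ℝ ι}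
    (hy : Tendsto y atTop (𝓝 y₀)) {c : ℝ} (hT : T y₀ =ᵐ[ν] fun _ => c) :
    ∀ᵐ q ∂ν, ∃ b : ℕ → ℝ, Tendsto b atTop (𝓝 c) ∧
      ∀ n, (w + T (t n • y n)) q = w q + t n * b n := by
  have h0 := ae_tendsto_add_apply 0 T hy
  have h1 : ∀ n, ∀ᵐ q ∂ν, (w + T (t n • y n)) q = w q + t n * (0 + T (y n)) q := by
    intro n
    rw [map_smul, zero_add]
    filter_upwards [Lp.coeFn_add w (t n • T (y n)), Lp.coeFn_smul (t n) (T (y n))] with q h2 h3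
    rw [h2, Pi.add_apply, h3, Pi.smul_apply, smul_eq_mul]
  filter_upwards [h0, ae_all_iff.2 h1, hT] with q h2 h3 h4
  rw [zero_add, h4] at h2
  exact ⟨_, h2, h3⟩

theorem ae_tendsto_atTop_of_pos (w : Lp ℝ 2 ν) (T : EuclideanSpace ℝ ι →ₗ[ℝ] Lp ℝ 2 ν)
    {t : ℕ → ℝ} (ht : Tendsto t atTop atTop) {y : ℕ → EuclideanSpace ℝ ι}
    {y₀ : EuclideanSpace ℝ ι} (hy : Tendsto y atTop (𝓝 y₀)) {c : ℝ} (hc : 0 < c)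
    (hT : T y₀ =ᵐ[ν] fun _ => c) :
    ∀ᵐ q ∂ν, Tendsto (fun n => (w + T (t n • y n)) q) atTop atTop := by
  filter_upwards [ae_exists_tendsto_add_smul (t := t) w T hy hT] with q ⟨b, hb, h⟩
  simp only [h]
  exact tendsto_atTop_add_const_left _ _ (ht.atTop_mul_pos hc hb)

theorem ae_tendsto_atBot_of_neg (w : Lp ℝ 2 ν) (T : EuclideanSpace ℝ ι →ₗ[ℝ] Lp ℝ 2 ν)
    {t : ℕ → ℝ} (ht : Tendsto t atTop atTop) {y : ℕ → EuclideanSpace ℝ ι}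
    {y₀ : EuclideanSpace ℝ ι} (hy : Tendsto y atTop (𝓝 y₀)) {c : ℝ} (hc : c < 0)
    (hT : T y₀ =ᵐ[ν] fun _ => c) :
    ∀ᵐ q ∂ν, Tendsto (fun n => (w + T (t n • y n)) q) atTop atBot := by
  filter_upwards [ae_exists_tendsto_add_smul (t := t) w T hy hT] with q ⟨b, hb, h⟩
  simp only [h]
  exact tendsto_atBot_add_const_left _ _ (ht.atTop_mul_neg hc hb)

end Coordinates

/-! ### The diffusion form and the pairings -/

theorem Standing.exists_bound_K (hD : D.Standing) :
    ∃ Kmax : ℝ, ∀ᵐ x ∂(vol D.Ω), ∀ a b : E d,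
      |inner ℝ (D.K x a) b| ≤ Kmax * (‖a‖ ^ 2 + ‖b‖ ^ 2) := by
  obtain ⟨Kmin, Kmax, hmin, hmax, hK⟩ := hD.K_bound
  refine ⟨Kmax / 2, ?_⟩
  filter_upwards [hK, hD.K_symm] with x h1 h2 a b
  have hsym : inner ℝ (D.K x b) a = inner ℝ (D.K x a) b := by
    rw [h2 b a, real_inner_comm]
  have hpos : ∀ z : E d, 0 ≤ inner ℝ (D.K x z) z := fun z =>
    (mul_nonneg hmin.le real_inner_self_nonneg).trans (h1 z).1
  have ha := (h1 a).2
  have hb := (h1 b).2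
  rw [real_inner_self_eq_norm_sq] at ha hb
  have hp := hpos (a + b)
  have hm := hpos (a - b)
  simp only [map_add, map_sub, inner_add_left, inner_add_right, inner_sub_left, inner_sub_right,
    hsym] at hp hm
  rw [abs_le]
  constructor <;> linarith

theorem integrable_inner_K_grad (hD : D.Standing) (u v : H1 D.Ω) :
    Integrable (fun x => inner ℝ (D.K x (H1.grad u x)) (H1.grad v x)) (vol D.Ω) := by
  obtain ⟨C, hC⟩ := hD.exists_bound_K
  have hu : Integrable (fun x => ‖H1.grad u x‖ ^ 2) (vol D.Ω) :=
    (Lp.memLp _).integrable_norm_pow two_ne_zero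
  have hv : Integrable (fun x => ‖H1.grad v x‖ ^ 2) (vol D.Ω) :=
    (Lp.memLp _).integrable_norm_pow two_ne_zero
  refine ((hu.add hv).const_mul C).mono' ?_ ?_
  · have h1 : AEStronglyMeasurable (fun x => D.K x (H1.grad u x)) (vol D.Ω) :=
      isBoundedBilinearMap_apply.continuous.comp_aestronglyMeasurable
        (hD.K_meas.prodMk (Lp.memLp (H1.grad u)).1)
    exact h1.inner (Lp.memLp (H1.grad v)).1
  · filter_upwards [hC] with x hx
    exact hx _ _

theorem integrable_coeff_mul {ν : Measure (E d)} {f g : E d → ℝ} (hf : MemLp f ⊤ ν)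
    (hg : Integrable g ν) : Integrable (fun x => f x * g x) ν :=
  hg.mul_of_top_right hf

theorem diffForm_add_right (hD : D.Standing) {f : E d → ℝ} (hf : MemLp f ⊤ (vol D.Ω))
    (u v w : H1 D.Ω) : D.diffForm f u (v + w) = D.diffForm f u v + D.diffForm f u w := by
  rw [diffForm, diffForm, diffForm,
    ← integral_add (integrable_coeff_mul hf (integrable_inner_K_grad hD u v))
      (integrable_coeff_mul hf (integrable_inner_K_grad hD u w)), map_add]
  refine integral_congr_ae ?_
  filter_upwards [Lp.coeFn_add (H1.grad v) (H1.grad w)] with x hx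
  rw [hx, Pi.add_apply, inner_add_right, mul_add]

theorem diffForm_smul_right (f : E d → ℝ) (c : ℝ) (u v : H1 D.Ω) :
    D.diffForm f u (c • v) = c * D.diffForm f u v := by
  rw [diffForm, diffForm, ← integral_const_mul, map_smul]
  refine integral_congr_ae ?_
  filter_upwards [Lp.coeFn_smul c (H1.grad v)] with x hx
  rw [hx, Pi.smul_apply, inner_smul_right]
  ring

theorem diffForm_add_left (hD : D.Standing) {f : E d → ℝ} (hf : MemLp f ⊤ (vol D.Ω))
    (u v w : H1 D.Ω) : D.diffForm f (u + v) w = D.diffForm f u w + D.diffForm f v w := by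
  rw [diffForm, diffForm, diffForm,
    ← integral_add (integrable_coeff_mul hf (integrable_inner_K_grad hD u w))
      (integrable_coeff_mul hf (integrable_inner_K_grad hD v w)), map_add]
  refine integral_congr_ae ?_
  filter_upwards [Lp.coeFn_add (H1.grad u) (H1.grad v)] with x hx
  rw [hx, Pi.add_apply, map_add, inner_add_left, mul_add]

theorem diffForm_smul_left (f : E d → ℝ) (c : ℝ) (u v : H1 D.Ω) :
    D.diffForm f (c • u) v = c * D.diffForm f u v := by
  rw [diffForm, diffForm, ← integral_const_mul, map_smul]
  refine integral_congr_ae ?_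
  filter_upwards [Lp.coeFn_smul c (H1.grad u)] with x hx
  rw [hx, Pi.smul_apply, map_smul, real_inner_smul_left]
  ring

theorem diffForm_coeff_add (hD : D.Standing) {f g : E d → ℝ} (hf : MemLp f ⊤ (vol D.Ω))
    (hg : MemLp g ⊤ (vol D.Ω)) (u v : H1 D.Ω) :
    D.diffForm (fun x => f x + g x) u v = D.diffForm f u v + D.diffForm g u v := by
  rw [diffForm, diffForm, diffForm,
    ← integral_add (integrable_coeff_mul hf (integrable_inner_K_grad hD u v))
      (integrable_coeff_mul hg (integrable_inner_K_grad hD u v))]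
  simp only [add_mul]

theorem diffForm_eq_zero_of_grad_eq_zero (f : E d → ℝ) (u : H1 D.Ω) {v : H1 D.Ω}
    (hv : H1.grad v = 0) : D.diffForm f u v = 0 := by
  refine integral_eq_zero_of_ae ?_
  rw [hv]
  filter_upwards [Lp.coeFn_zero (E d) 2 (vol D.Ω)] with x hx
  rw [hx]; simp

theorem exists_mul_norm_sq_le_diffForm (hD : D.Standing) {c : ℝ} (hc : 0 < c) :
    ∃ k > 0, ∀ f : E d → ℝ, MemLp f ⊤ (vol D.Ω) → (∀ x, c ≤ f x) →
      ∀ u, k * ‖H1.grad u‖ ^ 2 ≤ D.diffForm f u u := by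
  obtain ⟨Kmin, Kmax, hmin, -, hK⟩ := hD.K_bound
  refine ⟨c * Kmin, mul_pos hc hmin, fun f hf hcf u => ?_⟩
  rw [Lp_norm_sq_eq_integral, ← integral_const_mul]
  have hu : Integrable (fun x => ‖H1.grad u x‖ ^ 2) (vol D.Ω) :=
    (Lp.memLp _).integrable_norm_pow two_ne_zero
  refine integral_mono_ae (hu.const_mul _)
    (integrable_coeff_mul hf (integrable_inner_K_grad hD u u)) ?_
  filter_upwards [hK] with x hx
  have h1 := (hx (H1.grad u x)).1
  rw [real_inner_self_eq_norm_sq] at h1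
  rw [mul_assoc]
  exact mul_le_mul (hcf x) h1 (by positivity) (hc.le.trans (hcf x))

section Pairing

variable {Ω : Set (E d)} {ν ν' : Measure (E d)} (hle : ν ≤ ν') (R : H1 Ω →L[ℝ] Lp ℝ 2 ν')

include hle in
theorem integrable_of_le [IsFiniteMeasure ν'] (v : H1 Ω) : Integrable (R v) ν :=
  ((Lp.memLp (R v)).integrable (by norm_num)).mono_measure hle

include hle in
theorem integral_coeff_mul_add [IsFiniteMeasure ν'] {f : E d → ℝ} (hf : MemLp f ⊤ ν)
    (v w : H1 Ω) :
    ∫ x, f x * R (v + w) x ∂ν = (∫ x, f x * R v x ∂ν) + ∫ x, f x * R w x ∂ν := by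
  rw [← integral_add (integrable_coeff_mul hf (integrable_of_le hle R v))
    (integrable_coeff_mul hf (integrable_of_le hle R w)), map_add]
  refine integral_congr_ae ?_
  filter_upwards [ae_mono hle (Lp.coeFn_add (R v) (R w))] with x hx
  rw [hx, Pi.add_apply, mul_add]

include hle in
theorem integral_coeff_mul_smul (f : E d → ℝ) (c : ℝ) (v : H1 Ω) :
    ∫ x, f x * R (c • v) x ∂ν = c * ∫ x, f x * R v x ∂ν := by
  rw [← integral_const_mul, map_smul]
  refine integral_congr_ae ?_
  filter_upwards [ae_mono hle (Lp.coeFn_smul c (R v))] with x hx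
  rw [hx, Pi.smul_apply, smul_eq_mul]
  ring

end Pairing

end Model

end TwoPhase

/-! ### Coercivity by compactness -/

namespace TwoPhase

/-- A criterion for positivity on a large sphere. The quadratic part `Q` controls everything but
the kernel of `q`; along sequences that go to infinity in a direction `y₀` of the kernel, the part
`G` of linear growth has to be eventually positive. -/
theorem exists_pos_on_sphere {X : Type*} [NormedAddCommGroup X] [InnerProductSpace ℝ X]
    [FiniteDimensional ℝ X] {Q q : X → ℝ} {G : X → X →ₗ[ℝ] ℝ}
    (hq : Continuous q) (hqs : ∀ (t : ℝ) x, q (t • x) = t ^ 2 * q x)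
    (hq0 : ∀ x, 0 ≤ q x) (hQ : ∀ x, q x ≤ Q x) (hbd : ∀ y, ∃ C, ∀ x, |G x y| ≤ C)
    (hlim : ∀ y₀, y₀ ≠ 0 → q y₀ = 0 → ∀ (t : ℕ → ℝ) (y : ℕ → X), Tendsto t atTop atTop →
      Tendsto y atTop (𝓝 y₀) →
      ∃ L > 0, Tendsto (fun n => G (t n • y n) y₀) atTop (𝓝 L)) :
    ∃ R > 0, ∀ x, ‖x‖ = R → 0 < Q x + G x x := by
  obtain ⟨C, hC⟩ : ∃ C, ∀ x y, |G x y| ≤ C * ‖y‖ := by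
    let b := stdOrthonormalBasis ℝ X
    choose c hc using fun i => hbd (b i)
    refine ⟨∑ i, c i, fun x y => ?_⟩
    have h1 : G x y = ∑ i, inner ℝ (b i) y * G x (b i) := by
      conv_lhs => rw [← b.sum_repr' y, map_sum]
      simp only [map_smul, smul_eq_mul]
    rw [h1, Finset.sum_mul]
    refine (Finset.abs_sum_le_sum_abs _ _).trans (Finset.sum_le_sum fun i _ => ?_)
    rw [abs_mul, mul_comm]
    refine mul_le_mul (hc i x) ?_ (abs_nonneg _) ((abs_nonneg _).trans (hc i x))
    simpa using abs_real_inner_le_norm (b i) y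
  by_contra! hno
  have hpos : ∀ n : ℕ, (0 : ℝ) < n + 1 := fun n => by positivity
  choose x hx hxQ using fun n : ℕ => hno (n + 1) (hpos n)
  let z : ℕ → X := fun n => (n + 1 : ℝ)⁻¹ • x n
  have hz : ∀ n, ‖z n‖ = 1 := fun n => by
    rw [norm_smul, hx, norm_inv, Real.norm_of_nonneg (hpos n).le, inv_mul_cancel₀ (hpos n).ne']
  have hxz : ∀ n, x n = (n + 1 : ℝ) • z n := fun n => by
    rw [smul_smul, mul_inv_cancel₀ (hpos n).ne', one_smul]
  obtain ⟨y₀, hy₀, φ, hφ, hlimφ⟩ := (isCompact_sphere (0 : X) 1).tendsto_subseq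
    (x := z) (fun n => by simpa using hz n)
  have hy₀1 : ‖y₀‖ = 1 := by simpa using hy₀
  have hy₀0 : y₀ ≠ 0 := by rintro rfl; simp at hy₀1
  let t : ℕ → ℝ := fun n => (φ n : ℝ) + 1
  have ht : Tendsto t atTop atTop :=
    tendsto_atTop_add_const_right _ _ (tendsto_natCast_atTop_atTop.comp hφ.tendsto_atTop)
  have htpos : ∀ n, 0 < t n := fun n => hpos (φ n)
  -- divide the inequality at `x n` by `t n`
  have hkey : ∀ n, t n * q (z (φ n)) + G (t n • z (φ n)) (z (φ n)) ≤ 0 := by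
    intro n
    have h1 := hxQ (φ n)
    have h2 := hQ (x (φ n))
    rw [hxz (φ n)] at h1 h2
    rw [hqs] at h2
    rw [map_smul, smul_eq_mul] at h1
    have h3 : t n * (t n * q (z (φ n)) + G (t n • z (φ n)) (z (φ n))) ≤ 0 := by
      simp only [t]
      nlinarith
    exact nonpos_of_mul_nonpos_right h3 (htpos n)
  have hq₀ : q y₀ = 0 := by
    have h1 : Tendsto (fun n => q (z (φ n))) atTop (𝓝 (q y₀)) := (hq.tendsto _).comp hlimφ
    have h2 : Tendsto (fun n => C * (t n)⁻¹) atTop (𝓝 0) := by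
      simpa using ht.inv_tendsto_atTop.const_mul C
    refine le_antisymm (le_of_tendsto_of_tendsto' h1 h2 fun n => ?_) (hq0 y₀)
    have h3 := hC (t n • z (φ n)) (z (φ n))
    rw [hz, mul_one] at h3
    have h4 := (abs_le.1 h3).1
    rw [← div_eq_mul_inv, le_div_iff₀ (htpos n)]
    linarith [hkey n]
  obtain ⟨L, hL, hGL⟩ := hlim y₀ hy₀0 hq₀ t (fun n => z (φ n)) ht hlimφ
  have h5 : Tendsto (fun n => G (t n • z (φ n)) (z (φ n))) atTop (𝓝 (L + 0)) := by
    have h6 : Tendsto (fun n => G (t n • z (φ n)) (z (φ n) - y₀)) atTop (𝓝 0) := by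
      have h7 : Tendsto (fun n => C * ‖z (φ n) - y₀‖) atTop (𝓝 0) := by
        have := (tendsto_iff_norm_sub_tendsto_zero.1 hlimφ).const_mul C
        simpa using this
      exact squeeze_zero_norm (fun n => hC _ _) h7
    refine (hGL.add h6).congr fun n => ?_
    rw [← map_add, add_sub_cancel]
  have h8 : L + 0 ≤ 0 := le_of_tendsto' h5 fun n => by
    have := mul_nonneg (htpos n).le (hq0 (z (φ n)))
    linarith [hkey n]
  linarith

namespace Model

variable {d : ℕ} {D : Model d}

/-! ### The residual of the scheme -/

/-- The hypotheses of the existence theorem on the data, with a common convexity constant `cmin` of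
the energy. -/
structure Admissible (D : Model d) (cmin : ℝ) (Sk : E d → ℝ) : Prop where
  standing : D.Standing
  flow : D.FlowAssumption
  bdry : D.BoundaryAssumption
  cmin_pos : 0 < cmin
  energy : D.EnergyAssumptionOn cmin (vol D.Ω)
  energy_bdry : D.EnergyAssumptionOn cmin (surf D.Γ₂)
  Sk_meas : AEMeasurable Sk (vol D.Ω)
  Sk_mem : ∀ᵐ x ∂(vol D.Ω), D.Sε ≤ Sk x ∧ Sk x ≤ 1 - D.Sε

/-- The part of the residual, tested with `(ζ, π)`, that is bounded in the unknowns: the diffusion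
of the Dirichlet data `u` (the sum of both data) and `p`, the discrete time derivative, the sources
and the Neumann data. The saturations `S` in `Ω` and `Sb` on `Γ₂` are independent arguments. -/
noncomputable def loadForm (D : Model d) (N : ℕ) (Sk S Sb : E d → ℝ) (u p ζ π : H1 D.Ω) : ℝ :=
  D.diffForm (fun x => D.trunc D.lamw (S x)) u (ζ + π)
    + D.diffForm (fun x => D.trunc D.lamn (S x)) p π
    + D.pairing (fun x => D.poro x * ((S x - Sk x) / D.τ N)) ζ
    - D.pairing (fun x => D.trunc D.qw (S x)) ζ
    - D.pairing (fun x => D.trunc D.qt (S x)) π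
    - D.bdryPairing (fun x => D.trunc D.φ₄ (Sb x)) ζ
    - D.bdryPairing (fun x => D.trunc D.φ₂₄ (Sb x)) π

/-- The saturation in `Ω` that belongs to the chemical potential `μ`. -/
noncomputable def sat (D : Model d) (μ : H1 D.Ω) (x : E d) : ℝ := D.satOp x (H1.val μ x)

namespace Admissible

variable {cmin : ℝ} {Sk : E d → ℝ}

theorem lamw_cont (H : D.Admissible cmin Sk) : ContinuousOn D.lamw (Icc 0 1) :=
  H.flow.krw_cont.div_const _

theorem lamn_cont (H : D.Admissible cmin Sk) : ContinuousOn D.lamn (Icc 0 1) :=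
  H.flow.krn_cont.div_const _

theorem lamw_pos (H : D.Admissible cmin Sk) {s : ℝ} (hs : s ∈ Ioo (0 : ℝ) 1) : 0 < D.lamw s :=
  div_pos (H.flow.krw_pos s ⟨hs.1, hs.2.le⟩) H.standing.ηw_pos

theorem lamn_pos (H : D.Admissible cmin Sk) {s : ℝ} (hs : s ∈ Ioo (0 : ℝ) 1) : 0 < D.lamn s :=
  div_pos (H.flow.krn_pos s ⟨hs.1.le, hs.2⟩) H.standing.ηn_pos

theorem trunc_cont (H : D.Admissible cmin Sk) {f : ℝ → ℝ} (hf : ContinuousOn f (Icc 0 1)) :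
    Continuous (D.trunc f) :=
  continuous_trunc H.standing.Sε_pos H.standing.Sε_lt hf

theorem qt_cont (H : D.Admissible cmin Sk) : ContinuousOn D.qt (Icc 0 1) :=
  H.flow.qw_cont.add H.flow.qn_cont

theorem φ₂₄_cont (H : D.Admissible cmin Sk) : ContinuousOn D.φ₂₄ (Icc 0 1) :=
  H.bdry.φ₄_cont.add H.bdry.φ₂_cont

theorem surf_le (H : D.Admissible cmin Sk) : surf D.Γ₂ ≤ surf (frontier D.Ω) :=
  Measure.restrict_mono (H.standing.union_eq ▸ subset_union_right) le_rfl

theorem surf_le₁ (H : D.Admissible cmin Sk) : surf D.Γ₁ ≤ surf (frontier D.Ω) :=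
  Measure.restrict_mono (H.standing.union_eq ▸ subset_union_left) le_rfl

theorem finite_vol (H : D.Admissible cmin Sk) : IsFiniteMeasure (vol D.Ω) :=
  isFiniteMeasure_vol H.standing.isBounded

theorem finite_surf (H : D.Admissible cmin Sk) : IsFiniteMeasure (surf (frontier D.Ω)) :=
  isFiniteMeasure_surf_frontier H.standing.isOpen H.standing.isBounded H.standing.lipschitz

theorem aemeasurable_val (μ : H1 D.Ω) : AEMeasurable (H1.val μ) (vol D.Ω) :=
  (Lp.memLp (H1.val μ)).1.aemeasurable

theorem aemeasurable_trace (H : D.Admissible cmin Sk) (μ : H1 D.Ω) :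
    AEMeasurable (trace D.Ω μ) (surf D.Γ₂) :=
  (Lp.memLp (trace D.Ω μ)).1.aemeasurable.mono_measure H.surf_le

theorem integrable_val (H : D.Admissible cmin Sk) (v : H1 D.Ω) :
    Integrable (H1.val v) (vol D.Ω) := by
  have := H.finite_vol
  exact integrable_of_le le_rfl H1.val v

theorem integrable_trace (H : D.Admissible cmin Sk) (v : H1 D.Ω) :
    Integrable (trace D.Ω v) (surf D.Γ₂) := by
  have := H.finite_surf
  exact integrable_of_le H.surf_le (trace D.Ω) v

theorem memLp_sat_vol (H : D.Admissible cmin Sk) {F : ℝ → ℝ} (hF : Continuous F) (μ : H1 D.Ω) :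
    MemLp (fun x => F (D.sat μ x)) ⊤ (vol D.Ω) :=
  memLp_sat H.energy H.cmin_pos hF (aemeasurable_val μ)

theorem memLp_sat_surf (H : D.Admissible cmin Sk) {F : ℝ → ℝ} (hF : Continuous F) (μ : H1 D.Ω) :
    MemLp (fun x => F (D.bdrySat μ x)) ⊤ (surf D.Γ₂) :=
  memLp_sat H.energy_bdry H.cmin_pos hF (H.aemeasurable_trace μ)

theorem memLp_saturation (H : D.Admissible cmin Sk) (μ : H1 D.Ω) :
    MemLp (D.sat μ) ⊤ (vol D.Ω) :=
  H.memLp_sat_vol continuous_id μ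

theorem memLp_Sk (H : D.Admissible cmin Sk) : MemLp Sk ⊤ (vol D.Ω) := by
  refine memLp_top_of_bound H.Sk_meas.aestronglyMeasurable 1 ?_
  filter_upwards [H.Sk_mem] with x hx
  have := H.standing.Sε_pos
  rw [Real.norm_eq_abs, abs_le]
  constructor <;> linarith

theorem memLp_increment (H : D.Admissible cmin Sk) (N : ℕ) {S : E d → ℝ}
    (hS : MemLp S ⊤ (vol D.Ω)) :
    MemLp (fun x => D.poro x * ((S x - Sk x) / D.τ N)) ⊤ (vol D.Ω) := by
  have h1 : MemLp (fun x => (D.τ N)⁻¹ * (S x - Sk x)) ⊤ (vol D.Ω) :=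
    (hS.sub H.memLp_Sk).const_mul _
  have h2 := h1.mul' (r := ⊤) H.flow.poro_memLp
  simp only [div_eq_inv_mul]
  exact h2

theorem loadForm_add (H : D.Admissible cmin Sk) (N : ℕ) (μ u p ζ π ζ' π' : H1 D.Ω) :
    D.loadForm N Sk (D.sat μ) (D.bdrySat μ) u p (ζ + ζ') (π + π')
      = D.loadForm N Sk (D.sat μ) (D.bdrySat μ) u p ζ π
        + D.loadForm N Sk (D.sat μ) (D.bdrySat μ) u p ζ' π' := by
  have := H.finite_vol
  have := H.finite_surf
  have e1 : ζ + ζ' + (π + π') = (ζ + π) + (ζ' + π') := by abel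
  simp only [loadForm, e1]
  rw [diffForm_add_right H.standing (H.memLp_sat_vol (H.trunc_cont H.lamw_cont) μ),
    diffForm_add_right H.standing (H.memLp_sat_vol (H.trunc_cont H.lamn_cont) μ)]
  simp only [pairing, bdryPairing]
  rw [integral_coeff_mul_add le_rfl H1.val
      (H.memLp_increment N (H.memLp_saturation μ)),
    integral_coeff_mul_add le_rfl H1.val (H.memLp_sat_vol (H.trunc_cont H.flow.qw_cont) μ),
    integral_coeff_mul_add le_rfl H1.val (H.memLp_sat_vol (H.trunc_cont H.qt_cont) μ),
    integral_coeff_mul_add H.surf_le (trace D.Ω)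
      (H.memLp_sat_surf (H.trunc_cont H.bdry.φ₄_cont) μ),
    integral_coeff_mul_add H.surf_le (trace D.Ω)
      (H.memLp_sat_surf (H.trunc_cont H.φ₂₄_cont) μ)]
  ring

theorem loadForm_smul (H : D.Admissible cmin Sk) (N : ℕ) (S Sb : E d → ℝ) (u p ζ π : H1 D.Ω)
    (c : ℝ) :
    D.loadForm N Sk S Sb u p (c • ζ) (c • π) = c * D.loadForm N Sk S Sb u p ζ π := by
  simp only [loadForm, ← smul_add, diffForm_smul_right]
  simp only [pairing, bdryPairing]
  rw [integral_coeff_mul_smul le_rfl H1.val, integral_coeff_mul_smul le_rfl H1.val,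
    integral_coeff_mul_smul le_rfl H1.val, integral_coeff_mul_smul H.surf_le (trace D.Ω),
    integral_coeff_mul_smul H.surf_le (trace D.Ω)]
  ring

/-- The discrete time derivative is affine in the saturation. -/
theorem pairing_increment (H : D.Admissible cmin Sk) (N : ℕ) {S : E d → ℝ}
    (hS : MemLp S ⊤ (vol D.Ω)) (ζ : H1 D.Ω) :
    D.pairing (fun x => D.poro x * ((S x - Sk x) / D.τ N)) ζ
      = (∫ x in D.Ω, S x * ((D.τ N)⁻¹ * (D.poro x * H1.val ζ x)))
        - ∫ x in D.Ω, Sk x * ((D.τ N)⁻¹ * (D.poro x * H1.val ζ x)) := by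
  have hg : Integrable (fun x => (D.τ N)⁻¹ * (D.poro x * H1.val ζ x)) (vol D.Ω) :=
    (integrable_coeff_mul H.flow.poro_memLp (H.integrable_val ζ)).const_mul _
  rw [← integral_sub (integrable_coeff_mul hS hg) (integrable_coeff_mul H.memLp_Sk hg), pairing]
  refine integral_congr_ae (Eventually.of_forall fun x => ?_)
  simp only [div_eq_mul_inv]
  ring

theorem integrable_poro_mul (H : D.Admissible cmin Sk) (N : ℕ) (ζ : H1 D.Ω) :
    Integrable (fun x => (D.τ N)⁻¹ * (D.poro x * H1.val ζ x)) (vol D.Ω) :=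
  (integrable_coeff_mul H.flow.poro_memLp (H.integrable_val ζ)).const_mul _

theorem tendsto_loadForm (H : D.Admissible cmin Sk) (N : ℕ) (u p ζ π : H1 D.Ω)
    {μ : ℕ → H1 D.Ω} {s sb : E d → ℝ} (hsm : MemLp s ⊤ (vol D.Ω))
    (hs : ∀ᵐ x ∂(vol D.Ω), Tendsto (fun n => D.sat (μ n) x) atTop (𝓝 (s x)))
    (hsb : ∀ᵐ x ∂(surf D.Γ₂), Tendsto (fun n => D.bdrySat (μ n) x) atTop (𝓝 (sb x))) :
    Tendsto (fun n => D.loadForm N Sk (D.sat (μ n)) (D.bdrySat (μ n)) u p ζ π) atTop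
      (𝓝 (D.loadForm N Sk s sb u p ζ π)) := by
  have hvol : ∀ {F : ℝ → ℝ}, Continuous F → ∀ {g : E d → ℝ}, Integrable g (vol D.Ω) →
      Tendsto (fun n => ∫ x in D.Ω, F (D.sat (μ n) x) * g x) atTop
        (𝓝 (∫ x in D.Ω, F (s x) * g x)) := fun hF _ hg =>
    tendsto_integral_sat H.energy H.cmin_pos hF hg (fun n => aemeasurable_val (μ n)) hs
  have hsurf : ∀ {F : ℝ → ℝ}, Continuous F → ∀ {g : E d → ℝ}, Integrable g (surf D.Γ₂) →
      Tendsto (fun n => ∫ x, F (D.bdrySat (μ n) x) * g x ∂(surf D.Γ₂)) atTop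
        (𝓝 (∫ x, F (sb x) * g x ∂(surf D.Γ₂))) := fun hF _ hg =>
    tendsto_integral_sat H.energy_bdry H.cmin_pos hF hg (fun n => H.aemeasurable_trace (μ n)) hsb
  have h3 : Tendsto (fun n => D.pairing (fun x => D.poro x * ((D.sat (μ n) x - Sk x) / D.τ N)) ζ)
      atTop (𝓝 (D.pairing (fun x => D.poro x * ((s x - Sk x) / D.τ N)) ζ)) := by
    rw [H.pairing_increment N hsm]
    refine Tendsto.congr (fun n => (H.pairing_increment N
      (H.memLp_saturation (μ n)) ζ).symm) ?_
    exact (hvol continuous_id (H.integrable_poro_mul N ζ)).sub_const _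
  exact (((((((hvol (H.trunc_cont H.lamw_cont) (integrable_inner_K_grad H.standing u (ζ + π))).add
    (hvol (H.trunc_cont H.lamn_cont) (integrable_inner_K_grad H.standing p π))).add h3).sub
    (hvol (H.trunc_cont H.flow.qw_cont) (H.integrable_val ζ))).sub
    (hvol (H.trunc_cont H.qt_cont) (H.integrable_val π))).sub
    (hsurf (H.trunc_cont H.bdry.φ₄_cont) (H.integrable_trace ζ))).sub
    (hsurf (H.trunc_cont H.φ₂₄_cont) (H.integrable_trace π)))

theorem exists_bound_loadForm (H : D.Admissible cmin Sk) (N : ℕ) (u p ζ π : H1 D.Ω) :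
    ∃ C, ∀ μ : H1 D.Ω, |D.loadForm N Sk (D.sat μ) (D.bdrySat μ) u p ζ π| ≤ C := by
  obtain ⟨C₁, h₁⟩ := exists_bound_integral_sat H.energy (H.trunc_cont H.lamw_cont)
    (integrable_inner_K_grad H.standing u (ζ + π))
  obtain ⟨C₂, h₂⟩ := exists_bound_integral_sat H.energy (H.trunc_cont H.lamn_cont)
    (integrable_inner_K_grad H.standing p π)
  obtain ⟨C₃, h₃⟩ := exists_bound_integral_sat H.energy continuous_id (H.integrable_poro_mul N ζ)
  obtain ⟨C₄, h₄⟩ := exists_bound_integral_sat H.energy (H.trunc_cont H.flow.qw_cont)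
    (H.integrable_val ζ)
  obtain ⟨C₅, h₅⟩ := exists_bound_integral_sat H.energy (H.trunc_cont H.qt_cont)
    (H.integrable_val π)
  obtain ⟨C₆, h₆⟩ := exists_bound_integral_sat H.energy_bdry (H.trunc_cont H.bdry.φ₄_cont)
    (H.integrable_trace ζ)
  obtain ⟨C₇, h₇⟩ := exists_bound_integral_sat H.energy_bdry (H.trunc_cont H.φ₂₄_cont)
    (H.integrable_trace π)
  refine ⟨C₁ + C₂ + (C₃ + |∫ x in D.Ω, Sk x * ((D.τ N)⁻¹ * (D.poro x * H1.val ζ x))|) + C₄ + C₅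
    + C₆ + C₇, fun μ => ?_⟩
  rw [loadForm, H.pairing_increment N (H.memLp_saturation μ)]
  have tri : ∀ a b : ℝ, |a - b| ≤ |a| + |b| := fun a b => by
    simpa [sub_eq_add_neg] using abs_add_le a (-b)
  refine (tri _ _).trans (add_le_add ?_ (h₇ _))
  refine (tri _ _).trans (add_le_add ?_ (h₆ _))
  refine (tri _ _).trans (add_le_add ?_ (h₅ _))
  refine (tri _ _).trans (add_le_add ?_ (h₄ _))
  refine (abs_add_le _ _).trans (add_le_add ?_ ?_)
  · exact (abs_add_le _ _).trans (add_le_add (h₁ _) (h₂ _))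
  · exact (tri _ _).trans (add_le_add (h₃ _) le_rfl)

end Admissible

end Model

end TwoPhase

namespace TwoPhase

namespace Model

variable {d : ℕ} {D : Model d}

/-! ### The kernel of the gradient -/

theorem Standing.exists_const_of_grad_eq_zero (hD : D.Standing) {u : H1 D.Ω}
    (hu : H1.grad u = 0) :
    ∃ c : ℝ, H1.val u =ᵐ[vol D.Ω] (fun _ => c) ∧
      trace D.Ω u =ᵐ[surf (frontier D.Ω)] fun _ => c := by
  obtain ⟨c, hc⟩ := exists_ae_eq_const_of_grad_eq_zero hD.isOpen hD.isBounded hD.isConnected hu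
  exact ⟨c, hc, isTraceOperator_trace hD.isOpen hD.isBounded hD.lipschitz (fun _ => c)
    contDiff_const u hc⟩

theorem Standing.eq_zero_of_val (hD : D.Standing) {u : H1 D.Ω}
    (hu : H1.val u =ᵐ[vol D.Ω] fun _ => (0 : ℝ)) : u = 0 := by
  refine H1.ext_val hD.isOpen hD.isBounded ?_
  rw [map_zero]
  exact Lp.ext (hu.trans (Lp.coeFn_zero ℝ 2 (vol D.Ω)).symm)

theorem Standing.measureReal_pos (hD : D.Standing) : 0 < volume.real D.Ω :=
  ENNReal.toReal_pos (hD.isOpen.measure_pos volume hD.isConnected.nonempty).ne'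
    hD.isBounded.measure_lt_top.ne

/-- `W` as a linear subspace. -/
noncomputable def subspaceW (D : Model d) (h : surf D.Γ₁ ≤ surf (frontier D.Ω)) :
    Submodule ℝ (H1 D.Ω) where
  carrier := D.W
  zero_mem' := by
    change trace D.Ω 0 =ᵐ[surf D.Γ₁] 0
    rw [map_zero]
    exact ae_mono h (Lp.coeFn_zero _ _ _)
  add_mem' := by
    intro a b ha hb
    change trace D.Ω (a + b) =ᵐ[surf D.Γ₁] 0
    rw [map_add]
    filter_upwards [ae_mono h (Lp.coeFn_add (trace D.Ω a) (trace D.Ω b)),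
      (show trace D.Ω a =ᵐ[surf D.Γ₁] 0 from ha), (show trace D.Ω b =ᵐ[surf D.Γ₁] 0 from hb)]
      with x h1 h2 h3
    rw [h1, Pi.add_apply, h2, h3, Pi.zero_apply, add_zero]
  smul_mem' := by
    intro c a ha
    change trace D.Ω (c • a) =ᵐ[surf D.Γ₁] 0
    rw [map_smul]
    filter_upwards [ae_mono h (Lp.coeFn_smul c (trace D.Ω a)),
      (show trace D.Ω a =ᵐ[surf D.Γ₁] 0 from ha)] with x h1 h2
    rw [h1, Pi.smul_apply, h2, Pi.zero_apply, smul_zero]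

namespace Admissible

variable {cmin : ℝ} {Sk : E d → ℝ}

theorem sum_mem_W (H : D.Admissible cmin Sk) {m : ℕ} {ξ : Fin m → H1 D.Ω} (hξ : ∀ i, ξ i ∈ D.W)
    (a : Fin m → ℝ) : ∑ i, a i • ξ i ∈ D.W :=
  (D.subspaceW H.surf_le₁).sum_mem (t := Finset.univ) (f := fun i => a i • ξ i) fun i _ =>
    (D.subspaceW H.surf_le₁).smul_mem (a i) (hξ i)

theorem sum_mem_V (H : D.Admissible cmin Sk) {m : ℕ} {v : Fin m → H1 D.Ω} (hv : ∀ i, v i ∈ D.V)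
    (a : Fin m → ℝ) : ∑ i, a i • v i ∈ D.V := by
  have := H.finite_vol
  refine ⟨H.sum_mem_W (fun i => (hv i).1) a, fun h0 => ?_⟩
  let mean : H1 D.Ω →ₗ[ℝ] ℝ :=
    { toFun := fun u => ∫ x in D.Ω, H1.val u x
      map_add' := fun u w => by
        simpa using integral_coeff_mul_add le_rfl H1.val (memLp_top_const (1 : ℝ)) u w
      map_smul' := fun c u => by
        simpa using integral_coeff_mul_smul le_rfl H1.val (fun _ => (1 : ℝ)) c u }
  have h1 : mean (∑ i, a i • v i) = 0 := by
    rw [map_sum]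
    refine Finset.sum_eq_zero fun i _ => ?_
    rw [map_smul, show mean (v i) = 0 from (hv i).2 h0, smul_zero]
  exact h1

theorem const_eq_zero_of_trace (H : D.Admissible cmin Sk) (hΓ : surf D.Γ₁ univ ≠ 0) {u : H1 D.Ω}
    {c : ℝ} (hu : trace D.Ω u =ᵐ[surf D.Γ₁] 0)
    (hc : trace D.Ω u =ᵐ[surf (frontier D.Ω)] fun _ => c) : c = 0 := by
  have h1 : ∀ᵐ x ∂(surf D.Γ₁), c = 0 := by
    filter_upwards [hu, ae_mono H.surf_le₁ hc] with x h2 h3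
    rw [← h3, h2, Pi.zero_apply]
  have h2 : NeZero (surf D.Γ₁) := ⟨fun h => hΓ (by rw [h]; simp)⟩
  exact h1.exists.choose_spec

/-- On `V` the gradient is injective. -/
theorem eq_zero_of_mem_V (H : D.Admissible cmin Sk) {u : H1 D.Ω} (hu : u ∈ D.V)
    (hg : H1.grad u = 0) : u = 0 := by
  obtain ⟨c, hc, hct⟩ := H.standing.exists_const_of_grad_eq_zero hg
  have hc0 : c = 0 := by
    by_cases hΓ : surf D.Γ₁ univ = 0
    · have h1 := hu.2 hΓ
      rw [integral_congr_ae hc, integral_const, smul_eq_mul, measureReal_restrict_apply_univ] at h1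
      exact (mul_eq_zero.1 h1).resolve_left H.standing.measureReal_pos.ne'
    · exact H.const_eq_zero_of_trace hΓ hu.1 hct
  subst hc0
  exact H.standing.eq_zero_of_val hc

/-! ### The residual at constant saturations -/

theorem integral_coeff_zero {Ω : Set (E d)} {ν ν' : Measure (E d)} (hle : ν ≤ ν')
    (R : H1 Ω →L[ℝ] Lp ℝ 2 ν') (f : E d → ℝ) : ∫ x, f x * R 0 x ∂ν = 0 := by
  simpa using integral_coeff_mul_smul hle R f 0 0

theorem pairing_zero (f : E d → ℝ) : D.pairing f 0 = 0 :=
  integral_coeff_zero le_rfl H1.val f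

theorem bdryPairing_zero (H : D.Admissible cmin Sk) (f : E d → ℝ) : D.bdryPairing f 0 = 0 :=
  integral_coeff_zero H.surf_le (trace D.Ω) f

theorem diffForm_zero_right (f : E d → ℝ) (u : H1 D.Ω) : D.diffForm f u 0 = 0 :=
  diffForm_eq_zero_of_grad_eq_zero f u (map_zero _)

theorem loadForm_const (H : D.Admissible cmin Sk) (N : ℕ) (s : ℝ) (u p : H1 D.Ω) {z : H1 D.Ω}
    {c : ℝ} (hz : H1.grad z = 0) (hv : H1.val z =ᵐ[vol D.Ω] fun _ => c)
    (ht : trace D.Ω z =ᵐ[surf (frontier D.Ω)] fun _ => c) :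
    D.loadForm N Sk (fun _ => s) (fun _ => s) u p z 0
      = c * ((∫ x in D.Ω, D.poro x * ((s - Sk x) / D.τ N))
        - (volume.real D.Ω * D.trunc D.qw s + (surf D.Γ₂).real univ * D.trunc D.φ₄ s)) := by
  have e1 : ∀ f : E d → ℝ, D.pairing f z = c * ∫ x in D.Ω, f x := by
    intro f
    rw [pairing, ← integral_const_mul]
    refine integral_congr_ae ?_
    filter_upwards [hv] with x hx
    rw [hx, mul_comm]
  have e2 : ∀ f : E d → ℝ, D.bdryPairing f z = c * ∫ x, f x ∂(surf D.Γ₂) := by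
    intro f
    rw [bdryPairing, ← integral_const_mul]
    refine integral_congr_ae ?_
    filter_upwards [ae_mono H.surf_le ht] with x hx
    rw [hx, mul_comm]
  rw [loadForm, add_zero, diffForm_eq_zero_of_grad_eq_zero _ _ hz, diffForm_zero_right,
    pairing_zero, H.bdryPairing_zero, e1, e1, e2, integral_const, integral_const,
    measureReal_restrict_apply_univ, smul_eq_mul, smul_eq_mul]
  ring

theorem integrable_increment (H : D.Admissible cmin Sk) (N : ℕ) (s : ℝ) :
    Integrable (fun x => D.poro x * ((s - Sk x) / D.τ N)) (vol D.Ω) := by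
  have := H.finite_vol
  exact (H.memLp_increment N (memLp_top_const s)).integrable le_top

theorem integral_increment_one_pos (H : D.Admissible cmin Sk) {N : ℕ} (hN : 0 < N) :
    0 < ∫ x in D.Ω, D.poro x * ((1 - Sk x) / D.τ N) := by
  have := H.finite_vol
  obtain ⟨φm, hφm, hφ⟩ := H.flow.poro_pos
  have hτ : 0 < D.τ N := div_pos H.standing.T_pos (by exact_mod_cast hN)
  have hS := H.standing.Sε_pos
  calc 0 < volume.real D.Ω * (φm * (D.Sε / D.τ N)) :=
        mul_pos H.standing.measureReal_pos (by positivity)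
    _ = ∫ _ in D.Ω, φm * (D.Sε / D.τ N) := by
        rw [integral_const, measureReal_restrict_apply_univ, smul_eq_mul]
    _ ≤ _ := by
        refine integral_mono_ae (integrable_const _) (H.integrable_increment N 1) ?_
        filter_upwards [hφ, H.Sk_mem] with x h1 h2
        have h3 : D.Sε / D.τ N ≤ (1 - Sk x) / D.τ N := by gcongr; linarith
        exact mul_le_mul h1 h3 (by positivity) (hφm.le.trans h1)

theorem integral_increment_zero_neg (H : D.Admissible cmin Sk) {N : ℕ} (hN : 0 < N) :
    ∫ x in D.Ω, D.poro x * ((0 - Sk x) / D.τ N) < 0 := by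
  have := H.finite_vol
  obtain ⟨φm, hφm, hφ⟩ := H.flow.poro_pos
  have hτ : 0 < D.τ N := div_pos H.standing.T_pos (by exact_mod_cast hN)
  have hS := H.standing.Sε_pos
  rw [← neg_pos, ← integral_neg]
  calc 0 < volume.real D.Ω * (φm * (D.Sε / D.τ N)) :=
        mul_pos H.standing.measureReal_pos (by positivity)
    _ = ∫ _ in D.Ω, φm * (D.Sε / D.τ N) := by
        rw [integral_const, measureReal_restrict_apply_univ, smul_eq_mul]
    _ ≤ _ := by
        refine integral_mono_ae (integrable_const _) (H.integrable_increment N 0).neg ?_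
        filter_upwards [hφ, H.Sk_mem] with x h1 h2
        have h3 : D.Sε / D.τ N ≤ Sk x / D.τ N := by gcongr; exact h2.1
        have h4 : φm * (D.Sε / D.τ N) ≤ D.poro x * (Sk x / D.τ N) :=
          mul_le_mul h1 h3 (by positivity) (hφm.le.trans h1)
        have h5 : -(D.poro x * ((0 - Sk x) / D.τ N)) = D.poro x * (Sk x / D.τ N) := by ring
        rw [h5]
        exact h4

/-- In the pure Neumann problem, the solvability condition and the sign conditions say that the
wetting phase is injected at the lower residual saturation and extracted at the upper one. -/
theorem residual_flux_sign (H : D.Admissible cmin Sk) (hres : D.ResidualAssumption)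
    (hcomp : D.Compatible) (hΓ : surf D.Γ₁ univ = 0) :
    volume.real D.Ω * D.qw (1 - D.Sε) + (surf D.Γ₂).real univ * D.φ₄ (1 - D.Sε) ≤ 0 ∧
      0 ≤ volume.real D.Ω * D.qw D.Sε + (surf D.Γ₂).real univ * D.φ₄ D.Sε := by
  have h0 := H.standing.Sε_pos
  have h1 := H.standing.Sε_lt
  set a := volume.real D.Ω
  set b := (surf D.Γ₂).real univ
  have ha : 0 ≤ a := measureReal_nonneg
  have hb : 0 ≤ b := measureReal_nonneg
  have hbal : ∀ s ∈ ({D.Sε, 1 - D.Sε} : Set ℝ), a * D.qt s + b * D.φ₂₄ s = 0 := by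
    intro s hs
    have h2 := hcomp hΓ s hs
    rwa [integral_const, integral_const, measureReal_restrict_apply_univ, smul_eq_mul,
      smul_eq_mul] at h2
  have hid : ∀ s, (D.lamw s + D.lamn s) * (a * D.qw s + b * D.φ₄ s)
      = D.lamw s * (a * D.qt s + b * D.φ₂₄ s)
        + a * (D.lamn s * D.qw s - D.lamw s * D.qn s)
        + b * (D.lamn s * D.φ₄ s - D.lamw s * D.φ₂ s) := by
    intro s
    simp only [qt, φ₂₄]
    ring
  have hlam : ∀ s ∈ Ioo (0 : ℝ) 1, 0 < D.lamw s + D.lamn s := fun s hs =>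
    add_pos (H.lamw_pos hs) (H.lamn_pos hs)
  constructor
  · have h2 := hid (1 - D.Sε)
    rw [hbal _ (by simp), mul_zero, zero_add] at h2
    have h3 := mul_nonpos_of_nonneg_of_nonpos ha hres.q_right
    have h4 := mul_nonpos_of_nonneg_of_nonpos hb hres.φ_right
    exact nonpos_of_mul_nonpos_right (h2.le.trans (by linarith))
      (hlam _ ⟨by linarith, by linarith⟩)
  · have h2 := hid D.Sε
    rw [hbal _ (by simp), mul_zero, zero_add] at h2
    have h3 := mul_nonneg ha hres.q_left
    have h4 := mul_nonneg hb hres.φ_left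
    exact nonneg_of_mul_nonneg_right (by rw [h2]; linarith) (hlam _ ⟨by linarith, by linarith⟩)

/-- A fully saturated medium has too much of the wetting phase: the saturation increment is positive
because `Sk ≤ 1 - Sε`, and the sources and the boundary flux do not feed the phase. -/
theorem loadForm_one_pos (H : D.Admissible cmin Sk) (hres : D.ResidualAssumption)
    (hcomp : D.Compatible) (hΓ : surf D.Γ₁ univ = 0) {N : ℕ} (hN : 0 < N) (u p : H1 D.Ω)
    {z : H1 D.Ω} {c : ℝ} (hz : H1.grad z = 0) (hv : H1.val z =ᵐ[vol D.Ω] fun _ => c)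
    (ht : trace D.Ω z =ᵐ[surf (frontier D.Ω)] fun _ => c) (hc : 0 < c) :
    0 < D.loadForm N Sk (fun _ => 1) (fun _ => 1) u p z 0 := by
  rw [H.loadForm_const N 1 u p hz hv ht, trunc_one H.standing.Sε_pos H.standing.Sε_lt,
    trunc_one H.standing.Sε_pos H.standing.Sε_lt]
  have h1 := H.integral_increment_one_pos hN
  have h2 := (H.residual_flux_sign hres hcomp hΓ).1
  exact mul_pos hc (by linarith)

theorem loadForm_zero_pos (H : D.Admissible cmin Sk) (hres : D.ResidualAssumption)
    (hcomp : D.Compatible) (hΓ : surf D.Γ₁ univ = 0) {N : ℕ} (hN : 0 < N) (u p : H1 D.Ω)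
    {z : H1 D.Ω} {c : ℝ} (hz : H1.grad z = 0) (hv : H1.val z =ᵐ[vol D.Ω] fun _ => c)
    (ht : trace D.Ω z =ᵐ[surf (frontier D.Ω)] fun _ => c) (hc : c < 0) :
    0 < D.loadForm N Sk (fun _ => 0) (fun _ => 0) u p z 0 := by
  rw [H.loadForm_const N 0 u p hz hv ht, trunc_zero H.standing.Sε_pos H.standing.Sε_lt,
    trunc_zero H.standing.Sε_pos H.standing.Sε_lt]
  have h1 := H.integral_increment_zero_neg hN
  have h2 := (H.residual_flux_sign hres hcomp hΓ).2
  exact mul_pos_of_neg_of_neg hc (by linarith)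

/-! ### Solution of the discrete problem -/

/-- Linear combinations of `ξ`, with the coefficients read off from a vector through `j`. -/
noncomputable def lincomb {Ω : Set (E d)} {ι : Type*} [Fintype ι] {m : ℕ} (j : Fin m → ι)
    (ξ : Fin m → H1 Ω) : EuclideanSpace ℝ ι →ₗ[ℝ] H1 Ω where
  toFun x := ∑ i, x (j i) • ξ i
  map_add' x y := by simp [add_smul, Finset.sum_add_distrib]
  map_smul' c x := by simp [mul_smul, Finset.smul_sum]

section Continuity

variable {ι : Type*} [Fintype ι]

theorem ae_tendsto_sat (H : D.Admissible cmin Sk) (μ₀ : H1 D.Ω)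
    (Z : EuclideanSpace ℝ ι →ₗ[ℝ] H1 D.Ω) {x : ℕ → EuclideanSpace ℝ ι}
    {x₀ : EuclideanSpace ℝ ι} (hx : Tendsto x atTop (𝓝 x₀)) :
    (∀ᵐ q ∂(vol D.Ω), Tendsto (fun n => D.sat (μ₀ + Z (x n)) q) atTop
        (𝓝 (D.sat (μ₀ + Z x₀) q))) ∧
      ∀ᵐ q ∂(surf D.Γ₂), Tendsto (fun n => D.bdrySat (μ₀ + Z (x n)) q) atTop
        (𝓝 (D.bdrySat (μ₀ + Z x₀) q)) := by
  constructor
  · filter_upwards [H.energy.ae_convexAt,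
      ae_tendsto_add_apply (H1.val μ₀) ((H1.val : H1 D.Ω →L[ℝ] _).toLinearMap.comp Z) hx]
      with q h1 h2
    simp only [sat, map_add]
    exact ((h1.continuous_satOp H.cmin_pos).tendsto _).comp h2
  · filter_upwards [H.energy_bdry.ae_convexAt, ae_mono H.surf_le
      (ae_tendsto_add_apply (trace D.Ω μ₀) ((trace D.Ω).toLinearMap.comp Z) hx)] with q h1 h2
    simp only [bdrySat, map_add]
    exact ((h1.continuous_satOp H.cmin_pos).tendsto _).comp h2

theorem continuous_loadForm (H : D.Admissible cmin Sk) (N : ℕ) (μ₀ u p ζ π : H1 D.Ω)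
    (Z : EuclideanSpace ℝ ι →ₗ[ℝ] H1 D.Ω) :
    Continuous fun x => D.loadForm N Sk (D.sat (μ₀ + Z x)) (D.bdrySat (μ₀ + Z x)) u p ζ π := by
  refine continuous_iff_seqContinuous.2 fun x x₀ hx => ?_
  obtain ⟨h1, h2⟩ := H.ae_tendsto_sat μ₀ Z hx
  exact H.tendsto_loadForm N u p ζ π (H.memLp_saturation _) h1 h2

theorem continuous_diffForm (H : D.Admissible cmin Sk) {F : ℝ → ℝ} (hF : Continuous F)
    (μ₀ z : H1 D.Ω) (Z L : EuclideanSpace ℝ ι →ₗ[ℝ] H1 D.Ω) :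
    Continuous fun x => D.diffForm (fun q => F (D.sat (μ₀ + Z x) q)) (L x) z := by
  classical
  have hsum : ∀ x, D.diffForm (fun q => F (D.sat (μ₀ + Z x) q)) (L x) z
      = ∑ i, x i * D.diffForm (fun q => F (D.sat (μ₀ + Z x) q))
        (L (EuclideanSpace.single i 1)) z := by
    intro x
    let B : H1 D.Ω →ₗ[ℝ] ℝ :=
      { toFun := fun u => D.diffForm (fun q => F (D.sat (μ₀ + Z x) q)) u z
        map_add' := fun u w => diffForm_add_left H.standing (H.memLp_sat_vol hF _) u w z
        map_smul' := fun c u => diffForm_smul_left _ c u z }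
    change B (L x) = ∑ i, x i * B (L (EuclideanSpace.single i 1))
    conv_lhs => rw [← (EuclideanSpace.basisFun ι ℝ).sum_repr x, map_sum, map_sum]
    simp
  simp only [hsum]
  refine continuous_finsetSum _ fun i _ => ((EuclideanSpace.proj (𝕜 := ℝ) i).continuous).mul ?_
  refine continuous_iff_seqContinuous.2 fun x x₀ hx => ?_
  exact tendsto_integral_sat H.energy H.cmin_pos hF
    (integrable_inner_K_grad H.standing _ z) (fun n => aemeasurable_val (μ₀ + Z (x n)))
    (H.ae_tendsto_sat μ₀ Z hx).1

/-- In a direction in which the chemical potential tends to `±∞`, the load form becomes positive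
on the corresponding constant. -/
theorem exists_tendsto_loadForm_pos (H : D.Admissible cmin Sk) (hres : D.ResidualAssumption)
    (hcomp : D.Compatible) (hΓ : surf D.Γ₁ univ = 0) {N : ℕ} (hN : 0 < N) (μ₀ u p : H1 D.Ω)
    (Z : EuclideanSpace ℝ ι →ₗ[ℝ] H1 D.Ω) {t : ℕ → ℝ} {y : ℕ → EuclideanSpace ℝ ι}
    {y₀ : EuclideanSpace ℝ ι} (ht : Tendsto t atTop atTop) (hy : Tendsto y atTop (𝓝 y₀)) {c : ℝ}
    (hz : H1.grad (Z y₀) = 0) (hv : H1.val (Z y₀) =ᵐ[vol D.Ω] fun _ => c)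
    (htr : trace D.Ω (Z y₀) =ᵐ[surf (frontier D.Ω)] fun _ => c) (hc : c ≠ 0) :
    ∃ L > 0, Tendsto (fun n => D.loadForm N Sk (D.sat (μ₀ + Z (t n • y n)))
      (D.bdrySat (μ₀ + Z (t n • y n))) u p (Z y₀) 0) atTop (𝓝 L) := by
  have := H.finite_vol
  rcases lt_or_gt_of_ne hc with hc | hc
  · refine ⟨_, H.loadForm_zero_pos hres hcomp hΓ hN u p hz hv htr hc,
      H.tendsto_loadForm N u p (Z y₀) 0 (memLp_top_const 0) ?_ ?_⟩
    · filter_upwards [H.energy.ae_convexAt, ae_tendsto_atBot_of_neg (H1.val μ₀)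
        ((H1.val : H1 D.Ω →L[ℝ] _).toLinearMap.comp Z) ht hy hc hv] with q h1 h2
      simp only [sat, map_add]
      exact (h1.tendsto_satOp_atBot H.cmin_pos).comp h2
    · filter_upwards [H.energy_bdry.ae_convexAt, ae_mono H.surf_le (ae_tendsto_atBot_of_neg
        (trace D.Ω μ₀) ((trace D.Ω).toLinearMap.comp Z) ht hy hc htr)] with q h1 h2
      simp only [bdrySat, map_add]
      exact (h1.tendsto_satOp_atBot H.cmin_pos).comp h2
  · refine ⟨_, H.loadForm_one_pos hres hcomp hΓ hN u p hz hv htr hc,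
      H.tendsto_loadForm N u p (Z y₀) 0 (memLp_top_const 1) ?_ ?_⟩
    · filter_upwards [H.energy.ae_convexAt, ae_tendsto_atTop_of_pos (H1.val μ₀)
        ((H1.val : H1 D.Ω →L[ℝ] _).toLinearMap.comp Z) ht hy hc hv] with q h1 h2
      simp only [sat, map_add]
      exact (h1.tendsto_satOp_atTop H.cmin_pos).comp h2
    · filter_upwards [H.energy_bdry.ae_convexAt, ae_mono H.surf_le (ae_tendsto_atTop_of_pos
        (trace D.Ω μ₀) ((trace D.Ω).toLinearMap.comp Z) ht hy hc htr)] with q h1 h2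
      simp only [bdrySat, map_add]
      exact (h1.tendsto_satOp_atTop H.cmin_pos).comp h2

end Continuity

/-- The load form at the chemical potential `μ`, as a linear functional of the pair of test
functions. -/
noncomputable def loadFunctional (H : D.Admissible cmin Sk) (N : ℕ) (μ u p : H1 D.Ω) :
    (H1 D.Ω × H1 D.Ω) →ₗ[ℝ] ℝ where
  toFun z := D.loadForm N Sk (D.sat μ) (D.bdrySat μ) u p z.1 z.2
  map_add' z z' := H.loadForm_add N μ u p z.1 z.2 z'.1 z'.2
  map_smul' c z := H.loadForm_smul N (D.sat μ) (D.bdrySat μ) u p z.1 z.2 c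

/-- The diffusive part of the scheme at the chemical potential `μ`, in the unknowns `u` (the sum of
the increments of potential and pressure) and `p` (the increment of the pressure), as a linear
functional of the pair of test functions. -/
noncomputable def diffFunctional (H : D.Admissible cmin Sk) (μ u p : H1 D.Ω) :
    (H1 D.Ω × H1 D.Ω) →ₗ[ℝ] ℝ where
  toFun z := D.diffForm (fun q => D.trunc D.lamw (D.sat μ q)) u (z.1 + z.2)
    + D.diffForm (fun q => D.trunc D.lamn (D.sat μ q)) p z.2
  map_add' z z' := by
    have e : z.1 + z'.1 + (z.2 + z'.2) = (z.1 + z.2) + (z'.1 + z'.2) := by abel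
    rw [Prod.fst_add, Prod.snd_add, e,
      diffForm_add_right H.standing (H.memLp_sat_vol (H.trunc_cont H.lamw_cont) μ),
      diffForm_add_right H.standing (H.memLp_sat_vol (H.trunc_cont H.lamn_cont) μ)]
    ring
  map_smul' c z := by
    rw [Prod.smul_fst, Prod.smul_snd, ← smul_add, diffForm_smul_right, diffForm_smul_right,
      RingHom.id_apply, smul_eq_mul, mul_add]

theorem diffFunctional_apply (H : D.Admissible cmin Sk) (μ u p : H1 D.Ω) (z : H1 D.Ω × H1 D.Ω) :
    H.diffFunctional μ u p z = D.diffForm (fun q => D.trunc D.lamw (D.sat μ q)) u (z.1 + z.2)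
      + D.diffForm (fun q => D.trunc D.lamn (D.sat μ q)) p z.2 := rfl

theorem loadFunctional_apply (H : D.Admissible cmin Sk) (N : ℕ) (μ u p : H1 D.Ω)
    (z : H1 D.Ω × H1 D.Ω) :
    H.loadFunctional N μ u p z = D.loadForm N Sk (D.sat μ) (D.bdrySat μ) u p z.1 z.2 := rfl

/-- Tested with the unknowns themselves, the diffusive part controls the gradients, because the
truncated mobilities are bounded below. -/
theorem exists_le_diffFunctional (H : D.Admissible cmin Sk) :
    ∃ kw > 0, ∃ kn > 0, ∀ μ ζ π : H1 D.Ω,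
      kw * ‖H1.grad (ζ + π)‖ ^ 2 + kn * ‖H1.grad π‖ ^ 2
        ≤ H.diffFunctional μ (ζ + π) π (ζ, π) := by
  obtain ⟨cw, hcw, hcw'⟩ := exists_pos_le_trunc H.standing.Sε_pos H.standing.Sε_lt H.lamw_cont
    (fun s hs => H.lamw_pos hs)
  obtain ⟨cn, hcn, hcn'⟩ := exists_pos_le_trunc H.standing.Sε_pos H.standing.Sε_lt H.lamn_cont
    (fun s hs => H.lamn_pos hs)
  obtain ⟨kw, hkw, hkw'⟩ := exists_mul_norm_sq_le_diffForm H.standing hcw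
  obtain ⟨kn, hkn, hkn'⟩ := exists_mul_norm_sq_le_diffForm H.standing hcn
  exact ⟨kw, hkw, kn, hkn, fun μ ζ π => add_le_add
    (hkw' _ (H.memLp_sat_vol (H.trunc_cont H.lamw_cont) μ) (fun _ => hcw' _) _)
    (hkn' _ (H.memLp_sat_vol (H.trunc_cont H.lamn_cont) μ) (fun _ => hcn' _) _)⟩

section Residual

variable {ι : Type*} [Fintype ι]

theorem continuous_residual (H : D.Admissible cmin Sk) (N : ℕ) (μ₀ u p : H1 D.Ω)
    (Z P : EuclideanSpace ℝ ι →ₗ[ℝ] H1 D.Ω) (z : H1 D.Ω × H1 D.Ω) :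
    Continuous fun x => H.diffFunctional (μ₀ + Z x) (Z x + P x) (P x) z
      + H.loadFunctional N (μ₀ + Z x) u p z := by
  simp only [diffFunctional_apply, loadFunctional_apply]
  exact ((H.continuous_diffForm (H.trunc_cont H.lamw_cont) μ₀ (z.1 + z.2) Z (Z + P)).add
    (H.continuous_diffForm (H.trunc_cont H.lamn_cont) μ₀ z.2 Z P)).add
    (H.continuous_loadForm N μ₀ u p z.1 z.2 Z)

/-- In the directions in which the diffusive part degenerates, the load form becomes positive. -/
theorem exists_tendsto_loadFunctional_pos (H : D.Admissible cmin Sk) (hres : D.ResidualAssumption)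
    (hcomp : D.Compatible) {N : ℕ} (hN : 0 < N) (μ₀ u p : H1 D.Ω)
    {Z P : EuclideanSpace ℝ ι →ₗ[ℝ] H1 D.Ω} (hZ : ∀ x, Z x ∈ D.W)
    (hinj : ∀ x, Z x = 0 → P x = 0 → x = 0) {t : ℕ → ℝ}
    {y : ℕ → EuclideanSpace ℝ ι} {y₀ : EuclideanSpace ℝ ι} (hy₀ : y₀ ≠ 0)
    (hg : H1.grad (Z y₀) = 0) (hP₀ : P y₀ = 0)
    (ht : Tendsto t atTop atTop) (hy : Tendsto y atTop (𝓝 y₀)) :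
    ∃ L > 0, Tendsto (fun n => H.loadFunctional N (μ₀ + Z (t n • y n)) u p (Z y₀, P y₀)) atTop
      (𝓝 L) := by
  obtain ⟨c, hcv, hct⟩ := H.standing.exists_const_of_grad_eq_zero hg
  have hc : c ≠ 0 := by
    rintro rfl
    exact hy₀ (hinj y₀ (H.standing.eq_zero_of_val hcv) hP₀)
  have hΓ : surf D.Γ₁ univ = 0 := by
    by_contra hΓ
    exact hc (H.const_eq_zero_of_trace hΓ (hZ y₀) hct)
  simp only [loadFunctional_apply, hP₀]
  exact H.exists_tendsto_loadForm_pos hres hcomp hΓ hN μ₀ u p Z ht hy hg hcv hct hc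

theorem exists_residual_pos_on_sphere (H : D.Admissible cmin Sk) (hres : D.ResidualAssumption)
    (hcomp : D.Compatible) {N : ℕ} (hN : 0 < N) (μ₀ u p : H1 D.Ω)
    {Z P : EuclideanSpace ℝ ι →ₗ[ℝ] H1 D.Ω} (hZ : ∀ x, Z x ∈ D.W) (hP : ∀ x, P x ∈ D.V)
    (hinj : ∀ x, Z x = 0 → P x = 0 → x = 0) :
    ∃ R > 0, ∀ x, ‖x‖ = R → 0 < H.diffFunctional (μ₀ + Z x) (Z x + P x) (P x) (Z x, P x)
      + H.loadFunctional N (μ₀ + Z x) u p (Z x, P x) := by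
  obtain ⟨kw, hkw, kn, hkn, hk⟩ := H.exists_le_diffFunctional
  have hZc : Continuous Z := Z.continuous_of_finiteDimensional
  have hPc : Continuous P := P.continuous_of_finiteDimensional
  refine exists_pos_on_sphere
    (Q := fun x => H.diffFunctional (μ₀ + Z x) (Z x + P x) (P x) (Z x, P x))
    (q := fun x => kw * ‖H1.grad (Z x + P x)‖ ^ 2 + kn * ‖H1.grad (P x)‖ ^ 2)
    (G := fun x => (H.loadFunctional N (μ₀ + Z x) u p).comp (Z.prod P)) ?_ ?_ ?_ ?_ ?_ ?_
  · exact (((H1.grad.continuous.comp (hZc.add hPc)).norm.pow 2).const_mul _).add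
      (((H1.grad.continuous.comp hPc).norm.pow 2).const_mul _)
  · intro t x
    simp only [map_smul, ← smul_add, norm_smul, mul_pow, Real.norm_eq_abs, sq_abs]
    ring
  · intro x
    positivity
  · exact fun x => hk (μ₀ + Z x) (Z x) (P x)
  · intro y
    obtain ⟨C, hC⟩ := H.exists_bound_loadForm N u p (Z y) (P y)
    exact ⟨C, fun x => hC _⟩
  · intro y₀ hy₀ hq t y ht hy
    have h1 : 0 ≤ kw * ‖H1.grad (Z y₀ + P y₀)‖ ^ 2 := by positivity
    have h2 : 0 ≤ kn * ‖H1.grad (P y₀)‖ ^ 2 := by positivity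
    have h3 : kn * ‖H1.grad (P y₀)‖ ^ 2 = 0 := le_antisymm (by linarith) h2
    have h4 : kw * ‖H1.grad (Z y₀ + P y₀)‖ ^ 2 = 0 := le_antisymm (by linarith) h1
    have hP₀ : P y₀ = 0 := H.eq_zero_of_mem_V (hP y₀) (by simpa [hkn.ne'] using h3)
    rw [hP₀, add_zero] at h4
    exact H.exists_tendsto_loadFunctional_pos hres hcomp hN μ₀ u p hZ hinj hy₀
      (by simpa [hkw.ne'] using h4) hP₀ ht hy

theorem exists_residual_eq_zero (H : D.Admissible cmin Sk) (hres : D.ResidualAssumption)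
    (hcomp : D.Compatible) {N : ℕ} (hN : 0 < N) (μ₀ u p : H1 D.Ω)
    {Z P : EuclideanSpace ℝ ι →ₗ[ℝ] H1 D.Ω} (hZ : ∀ x, Z x ∈ D.W) (hP : ∀ x, P x ∈ D.V)
    (hinj : ∀ x, Z x = 0 → P x = 0 → x = 0) :
    ∃ x, ∀ y, H.diffFunctional (μ₀ + Z x) (Z x + P x) (P x) (Z y, P y)
      + H.loadFunctional N (μ₀ + Z x) u p (Z y, P y) = 0 := by
  obtain ⟨R, hR, hpos⟩ := H.exists_residual_pos_on_sphere hres hcomp hN μ₀ u p hZ hP hinj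
  exact exists_forall_eq_zero_of_apply_self_pos
    (A := fun x => (H.diffFunctional (μ₀ + Z x) (Z x + P x) (P x)
      + H.loadFunctional N (μ₀ + Z x) u p).comp (Z.prod P))
    (fun y => H.continuous_residual N μ₀ u p Z P (Z y, P y)) hR hpos

end Residual

/-- The discrete solution in coordinates: the residual, tested with all pairs of discrete
functions, vanishes. -/
theorem exists_coeff_residual_eq_zero (H : D.Admissible cmin Sk) (hres : D.ResidualAssumption)
    (hcomp : D.Compatible) {N : ℕ} (hN : 0 < N) {m : ℕ} {ξ v : Fin m → H1 D.Ω}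
    (hξ : LinearIndependent ℝ ξ) (hv : LinearIndependent ℝ v)
    (hξW : ∀ i, ξ i ∈ D.W) (hvV : ∀ i, v i ∈ D.V) (μ₀ p₀ : H1 D.Ω) :
    ∃ α β : Fin m → ℝ, ∀ a b : Fin m → ℝ,
      D.diffForm (fun q => D.trunc D.lamw (D.sat (μ₀ + ∑ i, α i • ξ i) q))
          (∑ i, α i • ξ i + ∑ i, β i • v i) (∑ i, a i • ξ i + ∑ i, b i • v i)
        + D.diffForm (fun q => D.trunc D.lamn (D.sat (μ₀ + ∑ i, α i • ξ i) q))
          (∑ i, β i • v i) (∑ i, b i • v i)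
        + D.loadForm N Sk (D.sat (μ₀ + ∑ i, α i • ξ i)) (D.bdrySat (μ₀ + ∑ i, α i • ξ i))
          (μ₀ + p₀) p₀ (∑ i, a i • ξ i) (∑ i, b i • v i) = 0 := by
  obtain ⟨x, hx⟩ := H.exists_residual_eq_zero hres hcomp hN μ₀ (μ₀ + p₀) p₀
    (Z := lincomb (ι := Fin m ⊕ Fin m) Sum.inl ξ) (P := lincomb Sum.inr v)
    (fun x => H.sum_mem_W hξW fun i => x (Sum.inl i))
    (fun x => H.sum_mem_V hvV fun i => x (Sum.inr i))
    (fun x h1 h2 => by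
      have h1 := Fintype.linearIndependent_iff.1 hξ (fun i => x (Sum.inl i)) h1
      have h2 := Fintype.linearIndependent_iff.1 hv (fun i => x (Sum.inr i)) h2
      ext i
      rcases i with i | i
      · exact h1 i
      · exact h2 i)
  exact ⟨fun i => x (Sum.inl i), fun i => x (Sum.inr i), fun a b =>
    hx (WithLp.toLp 2 (Sum.elim a b))⟩

end Admissible

end Model

end TwoPhase

theorem theorem3p2 {d : ℕ} (hd : d = 2 ∨ d = 3) (D : TwoPhase.Model d)
    (hD : D.Standing) (hflow : D.FlowAssumption) (henergy : D.EnergyAssumption)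
    (hbdry : D.BoundaryAssumption) (hres : D.ResidualAssumption) (hcomp : D.Compatible)
    (N k : ℕ) (hk : k < N)
    (Sk : TwoPhase.E d → ℝ) (hSk_meas : AEMeasurable Sk (TwoPhase.vol D.Ω))
    (hSk : ∀ᵐ x ∂(TwoPhase.vol D.Ω), D.Sε ≤ Sk x ∧ Sk x ≤ 1 - D.Sε)
    (m : ℕ) (ξ v : Fin m → TwoPhase.H1 D.Ω)
    (hξ : LinearIndependent ℝ ξ) (hv : LinearIndependent ℝ v)
    (hξ_mem : ∀ i, ξ i ∈ D.W ∩ D.Bdd) (hv_mem : ∀ i, v i ∈ D.V ∩ D.Bdd) :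
    ∃ (S : TwoPhase.E d → ℝ) (μ p : TwoPhase.H1 D.Ω),
      D.IsDiscreteWeakSolution N k Sk ξ v S μ p := by
  obtain ⟨cmin, hcmin, hE, hE₂⟩ := henergy
  have H : D.Admissible cmin Sk := ⟨hD, hflow, hbdry, hcmin, hE, hE₂, hSk_meas, hSk⟩
  obtain ⟨α, β, h⟩ := H.exists_coeff_residual_eq_zero hres hcomp (by omega : 0 < N) hξ hv
    (fun i => (hξ_mem i).1) (fun i => (hv_mem i).1) (D.avg N k D.φ₁) (D.avg N k D.φ₃)
  set μ₀ := D.avg N k D.φ₁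
  set p₀ := D.avg N k D.φ₃
  set ζ := ∑ i, α i • ξ i with hζ
  set π := ∑ i, β i • v i with hπ
  have hw := H.memLp_sat_vol (H.trunc_cont H.lamw_cont) (μ₀ + ζ)
  have hn := H.memLp_sat_vol (H.trunc_cont H.lamn_cont) (μ₀ + ζ)
  refine ⟨D.sat (μ₀ + ζ), μ₀ + ζ, p₀ + π, ⟨α, rfl⟩, ⟨β, rfl⟩, Eventually.of_forall fun x => rfl,
    ?_, ?_⟩
  · intro z hz
    obtain ⟨b, rfl⟩ := (Submodule.mem_span_range_iff_exists_fun ℝ).1 hz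
    have h1 := h 0 b
    simp only [Pi.zero_apply, zero_smul, Finset.sum_const_zero, zero_add,
      TwoPhase.Model.loadForm, TwoPhase.Model.Admissible.pairing_zero, H.bdryPairing_zero] at h1
    have h2 : D.diffForm (fun x => D.trunc D.lamt (D.sat (μ₀ + ζ) x)) (p₀ + π) (∑ i, b i • v i)
        = D.diffForm (fun x => D.trunc D.lamw (D.sat (μ₀ + ζ) x)) (p₀ + π) (∑ i, b i • v i)
          + D.diffForm (fun x => D.trunc D.lamn (D.sat (μ₀ + ζ) x)) (p₀ + π) (∑ i, b i • v i) :=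
      TwoPhase.Model.diffForm_coeff_add hD hw hn _ _
    rw [h2]
    simp only [TwoPhase.Model.diffForm_add_left hD hw, TwoPhase.Model.diffForm_add_left hD hn]
      at h1 ⊢
    linarith
  · intro z hz
    obtain ⟨a, rfl⟩ := (Submodule.mem_span_range_iff_exists_fun ℝ).1 hz
    have h1 := h a 0
    simp only [Pi.zero_apply, zero_smul, Finset.sum_const_zero, add_zero,
      TwoPhase.Model.loadForm, TwoPhase.Model.Admissible.pairing_zero, H.bdryPairing_zero,
      TwoPhase.Model.Admissible.diffForm_zero_right] at h1
    simp only [TwoPhase.Model.diffForm_add_left hD hw] at h1 ⊢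
    linarith
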